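/- Let $X$ be the line $\mathbb R$ or the circle $\mathbb T=\mathbb R/2\pi\mathbb Z$ (functions on $\mathbb T$ are $2\pi$-periodic functions), and consider the Novikov equation on $X$, $$u_t+u^2u_x+\partial_xD^{-2}\Big[u^3+\tfrac32uu_x^2\Big]+D^{-2}\Big[\tfrac12u_x^3\Big]=0,\qquad D^{-2}=(1-\partial_x^2)^{-1},$$ understood in the sense of distributions. Let $E(x)=e^{-|x|}$ if $X=\mathbb R$ and $E(x)=\cosh([x]_p-\pi)$, $[x]_p=x-2\pi\lfloor x/2\pi\rfloor$, if $X=\mathbb T$. A 2-peakon solution on $[0,T)$ is a solution of the form $$u(x,t)=p_1(t)E(x-q_1(t))+p_2(t)E(x-q_2(t)),\qquad 0\le t<T,$$ with $C^1$ positions $q_1<q_2$ (and $q_2<q_1+2\pi$ if $X=\mathbb T$) and $C^1$ nowhere vanishing momenta $p_1,p_2$; its lifespan is $T$ if it does not extend to a 2-peakon solution on a longer interval $[0,T')$. The Sobolev norms are $\|f\|_{H^s}^2=\int_{\mathbb R}(1+\xi^2)^s|\widehat f(\xi)|^2\,d\xi$ on $\mathbb R$ and $\|f\|_{H^s}^2=\sum_{n\in\mathbb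 Z}(1+n^2)^s|\widehat f(n)|^2$ on $\mathbb T$, with $\widehat f(\xi)=\int_X e^{-i\xi x}f(x)\,dx$ (over one period if $X=\mathbb T$). Theorem. For every $s<3/2$ and every $\varepsilon>0$ there is a 2-peakon solution $u$ of the Novikov equation on $X$ with lifespan $T$, $0<T<\varepsilon$, and with initial size $\|u(0)\|_{H^s}<\varepsilon$, which ends with a collision, $q_2(t)-q_1(t)\to0$ as $t\to T^-$, which belongs to $C([0,T);H^\sigma)$ for all $\sigma<3/2$, and which has the following properties. (1) If $5/4<\sigma<3/2$, then $\|u(t)\|_{H^\sigma}\to\infty$ as $t\to T^-$ (norm inflation). (2) There are $c_T>0$ and $q_T>0$ such that, for the antipeakon $$u(T)=-\sqrt{c_T}\,e^{-|x-q_T|}\ \text{ if } X=\mathbb R,\qquad u(T)=-\frac{\sqrt{c_T}}{\cosh\pi}\cosh([x-q_T]_p-\pi)\ \text{ if } X=\mathbb T,$$ and for all $\sigma<5/4$: $\|u(t)\|_{H^\sigma}$ tends to a number $C_\sigma>0$ as $t\to T^-$, $C_\sigma=\|u(T)\|_{H^\sigma}$, and $u(t)\to u(T)$ in $H^\sigma$;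 thus $u$, extended by $u(T)$, belongs to $C([0,T];H^\sigma)$. For $\sigma=5/4$ nothing is asserted about the behaviour of $\|u(t)\|_{H^\sigma}$ as $t\to T^-$. -/

import Mathlib

open Filter Topology MeasureTheory
open scoped ENNReal ContDiff

noncomputable section

namespace Novikov

/-- The two spatial domains: the real line `ℝ` and the circle `𝕋 = ℝ / 2πℤ`.
A function on the circle is represented by a `2π`-periodic function on `ℝ`. -/
inductive Domain
  | line
  | circle

/-- The representative `[x]_p = x - 2π ⌊x / 2π⌋` of `x` in `[0, 2π)`. -/
def perMod (x : ℝ) : ℝ := x - 2 * Real.pi * (⌊x / (2 * Real.pi)⌋ : ℝ)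

namespace Domain

/-- `f : ℝ → ℝ` represents a function on the domain. -/
def IsFun : Domain → (ℝ → ℝ) → Prop
  | line, _ => True
  | circle, f => Function.Periodic f (2 * Real.pi)

/-- Lebesgue measure on the domain (for the circle: on one period). -/
def meas : Domain → Measure ℝ
  | line => volume
  | circle => volume.restrict (Set.Ioc 0 (2 * Real.pi))

/-- Test functions: `C_c^∞(ℝ)` on the line, smooth `2π`-periodic functions on the circle. -/
def IsTest : Domain → (ℝ → ℝ) → Prop
  | line, φ => ContDiff ℝ ∞ φ ∧ HasCompactSupport φ
  | circle, φ => ContDiff ℝ ∞ φ ∧ Function.Periodic φ (2 * Real.pi)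

/-- The profile of a peakon: `e^{-|x|}` on the line, `cosh ([x]_p - π)` on the circle. -/
def profile : Domain → ℝ → ℝ
  | line, x => Real.exp (-|x|)
  | circle, x => Real.cosh (perMod x - Real.pi)

/-- The kernel of the Bessel potential `(1 - ∂_x²)⁻¹`, i.e. the solution of `g - g'' = δ₀`
on the domain. -/
def green : Domain → ℝ → ℝ
  | line, x => Real.exp (-|x|) / 2
  | circle, x => Real.cosh (perMod x - Real.pi) / (2 * Real.sinh Real.pi)

/-- The Bessel potential `D⁻² f = (1 - ∂_x²)⁻¹ f`, for integrable `f`. -/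
def bessel (X : Domain) (f : ℝ → ℝ) (x : ℝ) : ℝ :=
  ∫ y, X.green (x - y) * f y ∂X.meas

/-- The Fourier transform `∫ e^{-i ξ x} f(x) dx` of an integrable function on the domain
(evaluated at integers `ξ` in the case of the circle). -/
def fourier (X : Domain) (f : ℝ → ℝ) (ξ : ℝ) : ℂ :=
  ∫ x, Complex.exp (-(Complex.I * (ξ : ℂ) * (x : ℂ))) * (f x : ℂ) ∂X.meas

/-- The Sobolev norm `‖f‖_{H^s}` of an integrable function `f` on the domain, for any real `s`
(with value `∞` if `f` is not in `H^s`). -/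
def hsNorm (X : Domain) (s : ℝ) (f : ℝ → ℝ) : ℝ≥0∞ :=
  match X with
  | line =>
      (∫⁻ ξ : ℝ, ENNReal.ofReal ((1 + ξ ^ 2) ^ s * ‖fourier line f ξ‖ ^ 2)) ^ (1 / 2 : ℝ)
  | circle =>
      (∑' n : ℤ, ENNReal.ofReal ((1 + (n : ℝ) ^ 2) ^ s * ‖fourier circle f (n : ℝ)‖ ^ 2))
        ^ (1 / 2 : ℝ)

/-- `f` is an integrable function on the domain that belongs to `H^s`. -/
def MemHs (X : Domain) (s : ℝ) (f : ℝ → ℝ) : Prop :=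
  X.IsFun f ∧ Integrable f X.meas ∧ X.hsNorm s f < ⊤

/-- `u ∈ C(I; H^s)` (with integrable values). -/
def ContinuousInHs (X : Domain) (s : ℝ) (I : Set ℝ) (u : ℝ → ℝ → ℝ) : Prop :=
  (∀ t ∈ I, X.MemHs s (u t)) ∧
    ∀ t₀ ∈ I, Tendsto (fun t => X.hsNorm s (u t - u t₀)) (𝓝[I] t₀) (𝓝 0)

/-- `v` is the weak derivative of `f` on the domain (for locally integrable `f`, `v`). -/
def IsWeakDeriv (X : Domain) (f v : ℝ → ℝ) : Prop :=
  ∀ φ : ℝ → ℝ, X.IsTest φ → ∫ x, f x * deriv φ x ∂X.meas = -∫ x, v x * φ x ∂X.meas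

/-- `u : [0,T) → W^{1,3}` is a solution of the Novikov equation
`u_t + u² u_x + ∂_x D⁻² [u³ + (3/2) u u_x²] + D⁻² [(1/2) u_x³] = 0`
on the time interval `[0, T)`, in the sense of distributions in `x` for every time `t`
(one-sided time derivative at `t = 0`). Here `v` is the weak derivative `u_x`;
since `u(t), v(t) ∈ L³`, all the integrals converge absolutely. -/
def IsNovikovSolution (X : Domain) (T : ℝ) (u : ℝ → ℝ → ℝ) : Prop :=
  ∃ v : ℝ → ℝ → ℝ,
    (∀ t ∈ Set.Ico 0 T, X.IsFun (u t) ∧ X.IsFun (v t) ∧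
      MemLp (u t) 3 X.meas ∧ MemLp (v t) 3 X.meas ∧ X.IsWeakDeriv (u t) (v t)) ∧
    ∀ φ : ℝ → ℝ, X.IsTest φ → ∀ t ∈ Set.Ico 0 T,
      HasDerivWithinAt (fun τ => ∫ x, u τ x * φ x ∂X.meas)
        (-(∫ x, u t x ^ 2 * v t x * φ x ∂X.meas)
          + (∫ x, X.bessel (fun y => u t y ^ 3 + 3 / 2 * (u t y * v t y ^ 2)) x * deriv φ x
              ∂X.meas)
          - ∫ x, X.bessel (fun y => 1 / 2 * v t y ^ 3) x * φ x ∂X.meas)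
        (Set.Ico 0 T) t

/-- The function `p₁(t) E(x - q₁(t)) + p₂(t) E(x - q₂(t))`, with `E` the peakon profile. -/
def twoPeakon (X : Domain) (q₁ q₂ p₁ p₂ : ℝ → ℝ) (t x : ℝ) : ℝ :=
  p₁ t * X.profile (x - q₁ t) + p₂ t * X.profile (x - q₂ t)

/-- The (anti)peaks at `a` and `b` are at distinct places of the domain, `a` to the left of `b`
(on the circle: `b` lies in the period that starts at `a`). -/
def Ordered : Domain → ℝ → ℝ → Prop
  | line, a, b => a < b
  | circle, a, b => a < b ∧ b < a + 2 * Real.pi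

/-- The positions `q₁, q₂` and the momenta `p₁, p₂` define a 2-peakon solution of the Novikov
equation on `[0, T)`: they are continuously differentiable, the momenta do not vanish, the
positions are distinct, and the 2-peakon solves the equation. -/
structure IsTwoPeakonSolution (X : Domain) (T : ℝ) (q₁ q₂ p₁ p₂ : ℝ → ℝ) : Prop where
  contDiffOn_q₁ : ContDiffOn ℝ 1 q₁ (Set.Ico 0 T)
  contDiffOn_q₂ : ContDiffOn ℝ 1 q₂ (Set.Ico 0 T)
  contDiffOn_p₁ : ContDiffOn ℝ 1 p₁ (Set.Ico 0 T)
  contDiffOn_p₂ : ContDiffOn ℝ 1 p₂ (Set.Ico 0 T)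
  p₁_ne_zero : ∀ t ∈ Set.Ico 0 T, p₁ t ≠ 0
  p₂_ne_zero : ∀ t ∈ Set.Ico 0 T, p₂ t ≠ 0
  ordered : ∀ t ∈ Set.Ico 0 T, X.Ordered (q₁ t) (q₂ t)
  solution : X.IsNovikovSolution T (X.twoPeakon q₁ q₂ p₁ p₂)

/-- The 2-peakon solution given by `q₁, q₂, p₁, p₂` has lifespan `T`: it is a 2-peakon solution
on `[0, T)` and is not the restriction of a 2-peakon solution on a longer interval `[0, T')`. -/
def HasLifespan (X : Domain) (T : ℝ) (q₁ q₂ p₁ p₂ : ℝ → ℝ) : Prop :=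
  X.IsTwoPeakonSolution T q₁ q₂ p₁ p₂ ∧
    ∀ (T' : ℝ) (Q₁ Q₂ P₁ P₂ : ℝ → ℝ), T < T' → X.IsTwoPeakonSolution T' Q₁ Q₂ P₁ P₂ →
      ∃ t ∈ Set.Ico 0 T, X.twoPeakon Q₁ Q₂ P₁ P₂ t ≠ X.twoPeakon q₁ q₂ p₁ p₂ t

/-- The antipeakon of speed `c` located at `q`: `-√c e^{-|x - q|}` on the line and
`-(√c / cosh π) cosh ([x - q]_p - π)` on the circle. -/
def antipeakon : Domain → ℝ → ℝ → ℝ → ℝ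
  | line, c, q, x => -√c * Real.exp (-|x - q|)
  | circle, c, q, x => -(√c / Real.cosh Real.pi) * Real.cosh (perMod (x - q) - Real.pi)

end Domain

end Novikov

end

noncomputable section

namespace Novikov

/-! Let `E` be the profile, `a` its height, `q = q₂ - q₁` the gap and `A = E(q)`. Off the peaks `E''
= E`, and `E² - E'²` is constant. After `D⁻²` has been moved onto the test function, the weak
Novikov equation for two peakons is the integral of an exact derivative, so only the jumps at the
peaks survive (`novikov_flux`). They vanish against the time derivative as soon as `qᵢ' = u(qᵢ)²`,
`p₁' = p₁ u(q₁) p₂ E'(q)`, `p₂' = -p₂ u(q₂) p₁ E'(q)`.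

This system is solved explicitly. It conserves `H = a(p₁² + p₂²) + 2A p₁p₂`, a multiple of the
squared `H¹` norm, and `k² = (p₁p₂)²(a² - A²)`. With a parameter `η > 0` such that `(a - A)/(a + A)
= k²η⁴`, the sum `w` and the difference `z` of the momenta satisfy `a w² = H - 2k²η²` and `a z² = H
+ 2/η²`. What remains is one scalar equation for `η`, whose speed stays positive down to `η = 0`, so
the collision is reached in finite time (`exists_isCollision`). The branch `z < w < 0` is taken: an
antipeakon on the left, a weaker peakon on the right. At the collision `q` is of order `η⁴`, hence
`z²` is of order `q^(-1/2)`, while `w` tends to `-√(H/a)`.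

On the Fourier side the 2-peakon is `2·slope/(1+ξ²)` times an amplitude whose squared modulus is `w²
cos²(ξq/2) + z² sin²(ξq/2)` (`norm_peaksAmp_sq`). The first term survives as the antipeakon. For `σ`
near `5/4` the second contributes to the squared `H^σ` norm a quantity of order `z² q^(3-2σ)`, that
is `q^(5/2-2σ)`: it explodes for `σ > 5/4` and disappears for `σ < 5/4`.

The lifespan is exactly `T` because a continuation would have bounded momenta near `T`, hence
uniformly Lipschitz values, while the difference quotient of `u` between the two peaks is unbounded.
Smallness is a matter of choosing first `H`, then the initial `η₀`, then `k`
(`exists_small_isCollision`). -/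

/-! ### Reduction modulo the period -/

theorem perMod_of_mem {x : ℝ} {n : ℤ} (h₁ : n * (2 * Real.pi) ≤ x)
    (h₂ : x < (n + 1) * (2 * Real.pi)) : perMod x = x - n * (2 * Real.pi) := by
  have hp := Real.two_pi_pos
  have : ⌊x / (2 * Real.pi)⌋ = n := by
    rw [Int.floor_eq_iff]
    exact ⟨by rwa [le_div_iff₀ hp], by rwa [div_lt_iff₀ hp]⟩
  rw [perMod, this]; ring

theorem exists_period (x : ℝ) :
    ∃ n : ℤ, n * (2 * Real.pi) ≤ x ∧ x < (n + 1) * (2 * Real.pi) := by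
  have hp := Real.two_pi_pos
  refine ⟨⌊x / (2 * Real.pi)⌋, ?_, ?_⟩
  · rw [← le_div_iff₀ hp]; exact Int.floor_le _
  · rw [← div_lt_iff₀ hp]; exact Int.lt_floor_add_one _

theorem perMod_periodic : Function.Periodic perMod (2 * Real.pi) := by
  intro x
  obtain ⟨n, h₁, h₂⟩ := exists_period x
  rw [perMod_of_mem h₁ h₂, perMod_of_mem (n := n + 1)] <;> push_cast <;> linarith

theorem perMod_mem (x : ℝ) : 0 ≤ perMod x ∧ perMod x < 2 * Real.pi := by
  obtain ⟨n, h₁, h₂⟩ := exists_period x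
  rw [perMod_of_mem h₁ h₂]
  constructor <;> linarith

theorem measurable_perMod : Measurable perMod := by
  unfold perMod
  fun_prop

namespace Domain

/-! ### The profile: one-sided derivatives, symmetry and bounds -/

variable (X : Domain)

/-- The points of the real line that represent the peak of the profile. -/
def IsPeak : Domain → ℝ → Prop
  | line, x => x = 0
  | circle, x => ∃ n : ℤ, x = n * (2 * Real.pi)

/-- The right derivative of the profile. -/
def dprofile : Domain → ℝ → ℝ
  | line, x => if 0 ≤ x then -Real.exp (-x) else Real.exp x
  | circle, x => Real.sinh (perMod x - Real.pi)

/-- The height of the peak. -/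
def height : Domain → ℝ
  | line => 1
  | circle => Real.cosh Real.pi

/-- The left slope of the profile at the peak. -/
def slope : Domain → ℝ
  | line => 1
  | circle => Real.sinh Real.pi

theorem height_pos : 0 < X.height := by
  cases X
  · exact one_pos
  · exact Real.cosh_pos _

theorem slope_pos : 0 < X.slope := by
  cases X
  · exact one_pos
  · exact Real.sinh_pos_iff.2 Real.pi_pos

theorem isPeak_neg {x : ℝ} : X.IsPeak (-x) ↔ X.IsPeak x := by
  cases X
  · simp [IsPeak]
  · constructor
    · rintro ⟨n, hn⟩
      exact ⟨-n, by push_cast; linarith⟩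
    · rintro ⟨n, hn⟩
      exact ⟨-n, by push_cast; linarith⟩

theorem countable_isPeak (a : ℝ) : {x | X.IsPeak (x - a)}.Countable := by
  cases X
  · refine (Set.countable_singleton a).mono ?_
    intro x hx
    exact sub_eq_zero.1 hx
  · refine (Set.countable_range fun n : ℤ => n * (2 * Real.pi) + a).mono ?_
    rintro x ⟨n, hn⟩
    exact ⟨n, by simp only; linarith⟩

theorem not_isPeak_circle {x : ℝ} (h : ¬circle.IsPeak x) :
    ∃ n : ℤ, n * (2 * Real.pi) < x ∧ x < (n + 1) * (2 * Real.pi) := by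
  obtain ⟨n, h₁, h₂⟩ := exists_period x
  exact ⟨n, lt_of_le_of_ne h₁ fun e => h ⟨n, e.symm⟩, h₂⟩

theorem not_isPeak_of_ordered {x : ℝ} (h : X.Ordered 0 x) : ¬X.IsPeak x := by
  cases X
  · exact ne_of_gt h
  · rintro ⟨n, rfl⟩
    obtain ⟨h₁, h₂⟩ := h
    have hp := Real.two_pi_pos
    have h₁' : (0 : ℝ) < n := by
      by_contra hn
      nlinarith
    have h₂' : (n : ℝ) < 1 := by
      by_contra hn
      nlinarith
    have : (0 : ℤ) < n := by exact_mod_cast h₁'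
    have : n < (1 : ℤ) := by exact_mod_cast h₂'
    omega

theorem ordered_sub {a b : ℝ} : X.Ordered 0 (b - a) ↔ X.Ordered a b := by
  cases X
  · simp [Ordered]
  · simp only [Ordered, sub_pos, zero_add]
    refine and_congr Iff.rfl ⟨fun h => by linarith, fun h => by linarith⟩

theorem profile_neg (x : ℝ) : X.profile (-x) = X.profile x := by
  cases X
  · simp [profile]
  · by_cases h : circle.IsPeak x
    · obtain ⟨n, rfl⟩ := h
      have hp := Real.two_pi_pos
      have e₁ := perMod_of_mem (x := n * (2 * Real.pi)) (n := n) le_rfl (by linarith)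
      have e₂ := perMod_of_mem (x := -(n * (2 * Real.pi))) (n := -n) (by push_cast; linarith)
        (by push_cast; linarith)
      simp only [profile]
      rw [e₁, e₂]
      push_cast
      ring_nf
    · obtain ⟨n, h₁, h₂⟩ := not_isPeak_circle h
      have e₁ := perMod_of_mem h₁.le h₂
      have e₂ := perMod_of_mem (x := -x) (n := -n - 1) (by push_cast; linarith)
        (by push_cast; linarith)
      simp only [profile]
      rw [e₁, e₂, ← Real.cosh_neg]
      push_cast
      ring_nf

theorem dprofile_neg {x : ℝ} (h : ¬X.IsPeak x) : X.dprofile (-x) = -X.dprofile x := by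
  cases X
  · simp only [dprofile]
    rcases lt_or_gt_of_ne (show x ≠ 0 from h) with h | h
    · rw [if_pos (by linarith), if_neg (by linarith)]; simp
    · rw [if_neg (by linarith), if_pos (by linarith)]; simp
  · obtain ⟨n, h₁, h₂⟩ := not_isPeak_circle h
    have e₁ := perMod_of_mem h₁.le h₂
    have e₂ := perMod_of_mem (x := -x) (n := -n - 1) (by push_cast; linarith)
      (by push_cast; linarith)
    simp only [dprofile]
    rw [e₁, e₂, ← Real.sinh_neg]
    push_cast
    ring_nf

theorem isFun_profile (a : ℝ) : X.IsFun fun x => X.profile (x - a) := by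
  cases X
  · trivial
  · intro x
    simp only [profile]
    rw [show x + 2 * Real.pi - a = x - a + 2 * Real.pi by ring, perMod_periodic]

theorem isFun_dprofile (a : ℝ) : X.IsFun fun x => X.dprofile (x - a) := by
  cases X
  · trivial
  · intro x
    simp only [dprofile]
    rw [show x + 2 * Real.pi - a = x - a + 2 * Real.pi by ring, perMod_periodic]

/-- To the right of any point, a peak included, the profile is locally a single smooth function, so
right derivatives exist everywhere. Reflection then yields the left derivatives, and off the peaks
the two agree, for both domains at once. -/
theorem hasDerivWithinAt_profile (x : ℝ) :
    HasDerivWithinAt X.profile (X.dprofile x) (Set.Ici x) x := by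
  cases X
  · by_cases h : 0 ≤ x
    · simp only [dprofile, if_pos h]
      have : HasDerivAt (fun y : ℝ => Real.exp (-y)) (-Real.exp (-x)) x := by
        simpa using (hasDerivAt_neg x).exp
      refine this.hasDerivWithinAt.congr (fun y hy => ?_) ?_
      · simp only [profile]; rw [abs_of_nonneg (h.trans hy)]
      · simp only [profile]; rw [abs_of_nonneg h]
    · simp only [dprofile, if_neg h]
      push Not at h
      refine HasDerivAt.hasDerivWithinAt ((Real.hasDerivAt_exp x).congr_of_eventuallyEq ?_)
      filter_upwards [Iio_mem_nhds h] with y hy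
      simp only [profile]; rw [abs_of_neg hy, neg_neg]
  · obtain ⟨n, h₁, h₂⟩ := exists_period x
    simp only [dprofile, perMod_of_mem h₁ h₂]
    have : HasDerivAt (fun y : ℝ => Real.cosh (y - n * (2 * Real.pi) - Real.pi))
        (Real.sinh (x - n * (2 * Real.pi) - Real.pi)) x := by
      simpa using (((hasDerivAt_id x).sub_const (n * (2 * Real.pi))).sub_const Real.pi).cosh
    refine this.hasDerivWithinAt.congr_of_eventuallyEq ?_ ?_
    · filter_upwards [self_mem_nhdsWithin, mem_nhdsWithin_of_mem_nhds (Iio_mem_nhds h₂)] with y hy hy'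
      simp only [profile]; rw [perMod_of_mem (h₁.trans hy) hy']
    · simp only [profile]; rw [perMod_of_mem h₁ h₂]

theorem hasDerivWithinAt_dprofile (x : ℝ) :
    HasDerivWithinAt X.dprofile (X.profile x) (Set.Ici x) x := by
  cases X
  · by_cases h : 0 ≤ x
    · simp only [profile, abs_of_nonneg h]
      have : HasDerivAt (fun y : ℝ => -Real.exp (-y)) (Real.exp (-x)) x := by
        simpa using (hasDerivAt_neg x).exp.fun_neg
      refine this.hasDerivWithinAt.congr (fun y hy => ?_) ?_
      · simp only [dprofile]; rw [if_pos (h.trans hy)]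
      · simp only [dprofile]; rw [if_pos h]
    · push Not at h
      simp only [profile, abs_of_neg h, neg_neg]
      refine HasDerivAt.hasDerivWithinAt ((Real.hasDerivAt_exp x).congr_of_eventuallyEq ?_)
      filter_upwards [Iio_mem_nhds h] with y hy
      simp only [dprofile]; rw [if_neg (not_le.2 hy)]
  · obtain ⟨n, h₁, h₂⟩ := exists_period x
    simp only [profile, perMod_of_mem h₁ h₂]
    have : HasDerivAt (fun y : ℝ => Real.sinh (y - n * (2 * Real.pi) - Real.pi))
        (Real.cosh (x - n * (2 * Real.pi) - Real.pi)) x := by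
      simpa using (((hasDerivAt_id x).sub_const (n * (2 * Real.pi))).sub_const Real.pi).sinh
    refine this.hasDerivWithinAt.congr_of_eventuallyEq ?_ ?_
    · filter_upwards [self_mem_nhdsWithin, mem_nhdsWithin_of_mem_nhds (Iio_mem_nhds h₂)] with y hy hy'
      simp only [dprofile]; rw [perMod_of_mem (h₁.trans hy) hy']
    · simp only [dprofile]; rw [perMod_of_mem h₁ h₂]

theorem hasDerivAt_of_right_of_left {f : ℝ → ℝ} {f' x : ℝ}
    (h₁ : HasDerivWithinAt f f' (Set.Ici x) x) (h₂ : HasDerivWithinAt f f' (Set.Iic x) x) :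
    HasDerivAt f f' x := by
  rw [← hasDerivWithinAt_univ, ← Set.Ici_union_Iic (a := x)]
  exact h₁.union h₂

theorem isOpen_not_isPeak : IsOpen {x | ¬X.IsPeak x} := by
  rw [isOpen_iff_mem_nhds]
  intro x hx
  cases X
  · exact isOpen_ne.mem_nhds hx
  · obtain ⟨n, h₁, h₂⟩ := not_isPeak_circle hx
    filter_upwards [Ioo_mem_nhds h₁ h₂] with y hy
    rintro ⟨m, rfl⟩
    have hp := Real.two_pi_pos
    have h₁' : (n : ℝ) < m := lt_of_mul_lt_mul_right hy.1 hp.le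
    have h₂' : (m : ℝ) < n + 1 := lt_of_mul_lt_mul_right hy.2 hp.le
    have : n < m := by exact_mod_cast h₁'
    have : m < n + 1 := by exact_mod_cast h₂'
    omega

theorem hasDerivAt_profile {x : ℝ} (hx : ¬X.IsPeak x) :
    HasDerivAt X.profile (X.dprofile x) x := by
  refine hasDerivAt_of_right_of_left (X.hasDerivWithinAt_profile x) ?_
  have h := (X.hasDerivWithinAt_profile (-x)).scomp (h := Neg.neg) (s := Set.Iic x) x
    (hasDerivAt_neg x).hasDerivWithinAt (fun y hy => Set.mem_Ici.2 (neg_le_neg hy))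
  rw [X.dprofile_neg hx] at h
  have e : X.profile ∘ Neg.neg = X.profile := funext X.profile_neg
  rw [e] at h
  simpa using h

theorem hasDerivAt_dprofile {x : ℝ} (hx : ¬X.IsPeak x) :
    HasDerivAt X.dprofile (X.profile x) x := by
  refine hasDerivAt_of_right_of_left (X.hasDerivWithinAt_dprofile x) ?_
  have h := ((X.hasDerivWithinAt_dprofile (-x)).scomp (h := Neg.neg) (s := Set.Iic x) x
    (hasDerivAt_neg x).hasDerivWithinAt (fun y hy => Set.mem_Ici.2 (neg_le_neg hy))).neg
  rw [X.profile_neg] at h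
  have e : X.dprofile =ᶠ[𝓝 x] -(X.dprofile ∘ Neg.neg) := by
    filter_upwards [X.isOpen_not_isPeak.mem_nhds hx] with y hy
    simp [X.dprofile_neg hy]
  refine (HasDerivWithinAt.congr_of_eventuallyEq (f₁ := X.dprofile) h
    (mem_nhdsWithin_of_mem_nhds e) e.self_of_nhds).congr_deriv ?_
  simp

theorem continuous_profile : Continuous X.profile := by
  rw [continuous_iff_continuousAt]
  intro x
  rw [← continuousWithinAt_univ, ← Set.Ici_union_Iic (a := x)]
  refine (X.hasDerivWithinAt_profile x).continuousWithinAt.union ?_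
  have h := (X.hasDerivWithinAt_profile (-x)).continuousWithinAt.comp (f := Neg.neg)
    (s := Set.Iic x) continuous_neg.continuousWithinAt (fun y hy => Set.mem_Ici.2 (neg_le_neg hy))
  have e : X.profile ∘ Neg.neg = X.profile := funext X.profile_neg
  rwa [e] at h

theorem measurable_dprofile : Measurable X.dprofile := by
  cases X
  · unfold dprofile
    exact Measurable.ite measurableSet_Ici (by fun_prop) (by fun_prop)
  · unfold dprofile
    exact Real.continuous_sinh.measurable.comp (measurable_perMod.sub_const _)

theorem profile_pos (x : ℝ) : 0 < X.profile x := by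
  cases X
  · exact Real.exp_pos _
  · exact Real.cosh_pos _

theorem profile_le (x : ℝ) : X.profile x ≤ X.height := by
  cases X
  · simp [profile, height]
  · simp only [profile, height]
    rw [Real.cosh_le_cosh, abs_of_pos Real.pi_pos, abs_le]
    have := perMod_mem x
    constructor <;> linarith

theorem abs_dprofile_le (x : ℝ) : |X.dprofile x| ≤ X.profile x := by
  cases X
  · simp only [dprofile, profile]
    split_ifs with h
    · rw [abs_neg, abs_of_pos (Real.exp_pos _), abs_of_nonneg h]
    · push Not at h
      rw [abs_of_pos (Real.exp_pos _), abs_of_neg h, neg_neg]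
  · simp only [dprofile, profile]
    rw [abs_le]
    constructor
    · have := Real.exp_pos (perMod x - Real.pi)
      have := Real.cosh_add_sinh (perMod x - Real.pi)
      linarith
    · exact (Real.sinh_lt_cosh _).le

theorem profile_zero : X.profile 0 = X.height := by
  cases X
  · simp [profile, height]
  · simp [profile, height, perMod]

theorem dprofile_zero : X.dprofile 0 = -X.slope := by
  cases X
  · simp [dprofile, slope]
  · simp [dprofile, slope, perMod]

theorem green_eq (x : ℝ) : X.green x = X.profile x / (2 * X.slope) := by
  cases X
  · simp [green, profile, slope]
  · simp [green, profile, slope]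

theorem tendsto_dprofile_right : Tendsto X.dprofile (𝓝[>] 0) (𝓝 (-X.slope)) := by
  rw [← X.dprofile_zero]
  exact (X.hasDerivWithinAt_dprofile 0).continuousWithinAt.mono_left
    (nhdsWithin_mono _ Set.Ioi_subset_Ici_self)

theorem eventually_not_isPeak : ∀ᶠ x in 𝓝[>] (0 : ℝ), ¬X.IsPeak x := by
  filter_upwards [Ioo_mem_nhdsGT Real.two_pi_pos] with x hx
  refine X.not_isPeak_of_ordered ?_
  cases X
  · exact hx.1
  · exact ⟨hx.1, by linarith [hx.2]⟩

theorem tendsto_dprofile_left : Tendsto X.dprofile (𝓝[<] 0) (𝓝 X.slope) := by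
  have hn : Tendsto Neg.neg (𝓝[<] (0 : ℝ)) (𝓝[>] 0) := by
    simpa using tendsto_neg_nhdsLT (a := (0 : ℝ))
  have h := (X.tendsto_dprofile_right.comp hn).neg
  rw [neg_neg] at h
  refine h.congr' ?_
  filter_upwards [hn.eventually X.eventually_not_isPeak] with x hx
  rw [isPeak_neg] at hx
  simp [X.dprofile_neg hx]

/-- The mean value inequality needs right derivatives only, so the segment may cross peaks. -/
theorem abs_profile_sub_le (x y : ℝ) :
    |X.profile x - X.profile y| ≤ X.height * |x - y| := by
  wlog h : y ≤ x generalizing x y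
  · rw [abs_sub_comm, abs_sub_comm x]
    exact this y x (le_of_not_ge h)
  have := norm_image_sub_le_of_norm_deriv_right_le_segment (f := X.profile) (a := y) (b := x)
    X.continuous_profile.continuousOn (fun z _ => X.hasDerivWithinAt_profile z)
    (C := X.height) (fun z _ => (X.abs_dprofile_le z).trans (X.profile_le z)) x
    (Set.right_mem_Icc.2 h)
  rwa [abs_of_nonneg (sub_nonneg.2 h)]

instance : SFinite X.meas := by
  cases X <;> simp only [meas] <;> infer_instance

theorem integrable_of_bounded_circle {f : ℝ → ℝ} (hf : Measurable f) {C : ℝ}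
    (hC : ∀ x, |f x| ≤ C) : Integrable f circle.meas := by
  refine Measure.integrableOn_of_bounded (M := C) ?_ hf.aestronglyMeasurable ?_
  · simp [ENNReal.mul_eq_top]
  · exact Eventually.of_forall hC

theorem integrable_profile (a : ℝ) : Integrable (fun x => X.profile (x - a)) X.meas := by
  have hm : Measurable fun x => X.profile (x - a) :=
    X.continuous_profile.measurable.comp (measurable_id.sub_const a)
  cases X
  · refine Integrable.comp_sub_right (f := line.profile) (μ := volume) ?_ a
    have h₁ : IntegrableOn line.profile (Set.Ioi 0) := by
      refine (integrableOn_exp_neg_Ioi 0).congr_fun ?_ measurableSet_Ioi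
      intro x hx
      simp only [profile]; rw [abs_of_pos hx]
    have h₂ : IntegrableOn line.profile (Set.Iic 0) := by
      refine (integrableOn_exp_Iic 0).congr_fun ?_ measurableSet_Iic
      intro x hx
      simp only [profile]; rw [abs_of_nonpos hx, neg_neg]
    rw [← integrableOn_univ, ← Set.Iic_union_Ioi (a := (0 : ℝ))]
    exact h₂.union h₁
  · refine integrable_of_bounded_circle hm (C := circle.height) fun x => ?_
    rw [abs_of_pos (circle.profile_pos _)]
    exact circle.profile_le _

/-! ### The jump formula -/

/-- `f` tends to zero at infinity, if the domain is unbounded. -/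
def Decays (X : Domain) (f : ℝ → ℝ) : Prop := X = line → Tendsto f (cocompact ℝ) (𝓝 0)

theorem Decays.of_le {X : Domain} {f g : ℝ → ℝ} (hg : X.Decays g) {C : ℝ}
    (h : ∀ x, |f x| ≤ C * |g x|) : X.Decays f := by
  intro hX
  have := ((hg hX).abs.const_mul C)
  rw [abs_zero, mul_zero] at this
  exact squeeze_zero_norm h this

theorem decays_profile (a : ℝ) : X.Decays fun x => X.profile (x - a) := by
  rintro rfl
  simp only [profile]
  refine Real.tendsto_exp_neg_atTop_nhds_zero.comp ?_
  exact (tendsto_norm_cocompact_atTop (E := ℝ)).comp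
    (Homeomorph.subRight a).isClosedEmbedding.tendsto_cocompact

/-- The jump formula: if `F` is differentiable off the points `a`, `b` of the domain, with
one-sided limits there, then the integral of `F'` is minus the sum of the jumps of `F`. -/
theorem integral_eq_jumps {a b : ℝ} (hab : X.Ordered a b) {F F' : ℝ → ℝ} (hFd : X.Decays F)
    (hF : X.IsFun F) (hF' : X.IsFun F') (hint : Integrable F' X.meas)
    (hd : ∀ x, ¬X.IsPeak (x - a) → ¬X.IsPeak (x - b) → HasDerivAt F (F' x) x)
    {la ra lb rb : ℝ} (hla : Tendsto F (𝓝[<] a) (𝓝 la)) (hra : Tendsto F (𝓝[>] a) (𝓝 ra))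
    (hlb : Tendsto F (𝓝[<] b) (𝓝 lb)) (hrb : Tendsto F (𝓝[>] b) (𝓝 rb)) :
    ∫ x, F' x ∂X.meas = (la - ra) + (lb - rb) := by
  cases X
  · have hab : a < b := hab
    simp only [meas] at hint ⊢
    have hii : ∀ c d : ℝ, IntervalIntegrable F' volume c d := fun c d => hint.intervalIntegrable
    have h0 := hFd rfl
    rw [cocompact_eq_atBot_atTop, tendsto_sup] at h0
    have h1 := intervalIntegral_tendsto_integral hint tendsto_neg_atTop_atBot tendsto_id
    -- The integral over `[-R, R]` splits at `a` and `b` once `R` is large, and the boundary values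
    -- `F (±R)` vanish in the limit.
    refine tendsto_nhds_unique h1 ?_
    have h2 : Tendsto (fun R => (la - F (-R)) + (lb - ra) + (F R - rb)) atTop
        (𝓝 ((la - 0) + (lb - ra) + (0 - rb))) :=
      (((h0.1.comp tendsto_neg_atTop_atBot).const_sub la).add_const _).add (h0.2.sub_const rb)
    rw [show (la - 0) + (lb - ra) + (0 - rb) = (la - ra) + (lb - rb) by ring] at h2
    refine h2.congr' ?_
    filter_upwards [eventually_gt_atTop (-a), eventually_gt_atTop b] with R hR1 hR2
    have hR1 : -R < a := by linarith
    have hcont : ∀ x, x ≠ a → x ≠ b → HasDerivAt F (F' x) x := fun x ha hb =>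
      hd x (fun h => ha (sub_eq_zero.1 h)) (fun h => hb (sub_eq_zero.1 h))
    have i1 := intervalIntegral.integral_eq_sub_of_hasDerivAt_of_tendsto hR1
      (fun x hx => hcont x hx.2.ne (hx.2.trans hab).ne) (hii _ _)
      ((hcont _ hR1.ne (hR1.trans hab).ne).continuousAt.mono_left nhdsWithin_le_nhds) hla
    have i2 := intervalIntegral.integral_eq_sub_of_hasDerivAt_of_tendsto hab
      (fun x hx => hcont x hx.1.ne' hx.2.ne) (hii _ _) hra hlb
    have i3 := intervalIntegral.integral_eq_sub_of_hasDerivAt_of_tendsto hR2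
      (fun x hx => hcont x (hab.trans hx.1).ne' hx.1.ne') (hii _ _) hrb
      ((hcont _ (hab.trans hR2).ne' hR2.ne').continuousAt.mono_left nhdsWithin_le_nhds)
    rw [← i1, ← i2, ← i3]
    simp only [id]
    rw [intervalIntegral.integral_add_adjacent_intervals (hii _ _) (hii _ _),
      intervalIntegral.integral_add_adjacent_intervals (hii _ _) (hii _ _)]
  · obtain ⟨hab, hba⟩ := hab
    have hp := Real.two_pi_pos
    have hper : Function.Periodic F' (2 * Real.pi) := hF'
    have hii₀ : IntervalIntegrable F' volume 0 (0 + 2 * Real.pi) := by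
      rw [zero_add, intervalIntegrable_iff_integrableOn_Ioc_of_le hp.le]
      exact hint
    have hii : ∀ c d : ℝ, IntervalIntegrable F' volume c d :=
      fun c d => hper.intervalIntegrable hp.ne' hii₀ c d
    -- Integrating over the period that begins at `a` leaves `b` as the only interior jump. The left
    -- limit at `a` is recovered at the right end `a + 2π`.
    have e : ∫ x, F' x ∂circle.meas = ∫ x in a..(a + 2 * Real.pi), F' x := by
      rw [hper.intervalIntegral_add_eq a 0, zero_add, intervalIntegral.integral_of_le hp.le]
      rfl
    have hnp : ∀ x c : ℝ, c < x → x < c + 2 * Real.pi → ¬circle.IsPeak (x - c) := by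
      intro x c h₁ h₂
      exact not_isPeak_of_ordered _ ((ordered_sub _).2 ⟨h₁, h₂⟩)
    have hnp' : ∀ x c : ℝ, x < c → c < x + 2 * Real.pi → ¬circle.IsPeak (x - c) := by
      intro x c h₁ h₂
      rw [← isPeak_neg, neg_sub]
      exact hnp c x h₁ h₂
    have hla' : Tendsto F (𝓝[<] (a + 2 * Real.pi)) (𝓝 la) := by
      have hs : Tendsto (fun x => x - 2 * Real.pi) (𝓝[<] (a + 2 * Real.pi)) (𝓝[<] a) := by
        refine tendsto_nhdsWithin_of_tendsto_nhds_of_eventually_within _ ?_ ?_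
        · have : Tendsto (fun x => x - 2 * Real.pi) (𝓝 (a + 2 * Real.pi)) (𝓝 (a + 2 * Real.pi - 2 * Real.pi)) :=
            (continuous_id.sub continuous_const).tendsto _
          rw [add_sub_cancel_right] at this
          exact this.mono_left nhdsWithin_le_nhds
        · filter_upwards [self_mem_nhdsWithin] with x hx
          simp only [Set.mem_Iio] at hx ⊢
          linarith
      refine (hla.comp hs).congr fun x => ?_
      exact (show Function.Periodic F (2 * Real.pi) from hF).sub_eq x
    have i1 := intervalIntegral.integral_eq_sub_of_hasDerivAt_of_tendsto hab
      (fun x hx => hd x (hnp x a hx.1 (by linarith [hx.2])) (hnp' x b hx.2 (by linarith [hx.1])))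
      (hii _ _) hra hlb
    have i2 := intervalIntegral.integral_eq_sub_of_hasDerivAt_of_tendsto hba
      (fun x hx => hd x (hnp x a (by linarith [hx.1]) hx.2) (hnp x b hx.1 (by linarith [hx.2])))
      (hii _ _) hrb hla'
    rw [e, ← intervalIntegral.integral_add_adjacent_intervals (hii a b) (hii _ _), i1, i2]
    ring

end Domain

theorem integrable_mul_bounded {μ : Measure ℝ} {f g : ℝ → ℝ} (hf : Integrable f μ)
    (hg : Measurable g) {C : ℝ} (hC : ∀ x, |g x| ≤ C) : Integrable (fun x => f x * g x) μ :=
  hf.mul_bdd hg.aestronglyMeasurable (Eventually.of_forall (p := fun x => ‖g x‖ ≤ C) hC)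

/-! ### The Bessel potential of test functions -/

namespace Domain

variable (X : Domain)

variable {X} in
theorem IsFun.mul {f g : ℝ → ℝ} (hf : X.IsFun f) (hg : X.IsFun g) :
    X.IsFun fun x => f x * g x := by
  cases X
  · trivial
  · exact Function.Periodic.mul (show Function.Periodic f _ from hf) hg

variable {X} in
theorem IsFun.add {f g : ℝ → ℝ} (hf : X.IsFun f) (hg : X.IsFun g) :
    X.IsFun fun x => f x + g x := by
  cases X
  · trivial
  · exact Function.Periodic.add (show Function.Periodic f _ from hf) hg

variable {X} in
theorem IsFun.sub {f g : ℝ → ℝ} (hf : X.IsFun f) (hg : X.IsFun g) :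
    X.IsFun fun x => f x - g x := by
  cases X
  · trivial
  · exact Function.Periodic.sub (show Function.Periodic f _ from hf) hg

variable {X} in
theorem IsFun.comp {f : ℝ → ℝ} (hf : X.IsFun f) (h : ℝ → ℝ) : X.IsFun fun x => h (f x) := by
  cases X
  · trivial
  · exact Function.Periodic.comp (show Function.Periodic f _ from hf) h

theorem isFun_const (c : ℝ) : X.IsFun fun _ => c := by
  cases X
  · trivial
  · exact fun _ => rfl

theorem ordered_add_one (x : ℝ) : X.Ordered x (x + 1) := by
  cases X
  · exact lt_add_one x
  · exact ⟨lt_add_one x, by linarith [Real.pi_gt_three]⟩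

theorem not_isPeak_one : ¬X.IsPeak 1 := by
  refine X.not_isPeak_of_ordered ?_
  simpa using X.ordered_add_one 0

theorem measurable_profile_sub (a : ℝ) : Measurable fun x => X.profile (x - a) :=
  X.continuous_profile.measurable.comp (measurable_id.sub_const a)

theorem measurable_dprofile_sub (a : ℝ) : Measurable fun x => X.dprofile (x - a) :=
  X.measurable_dprofile.comp (measurable_id.sub_const a)

theorem abs_profile_le (x : ℝ) : |X.profile x| ≤ X.height := by
  rw [abs_of_pos (X.profile_pos x)]
  exact X.profile_le x

theorem abs_dprofile_le_height (x : ℝ) : |X.dprofile x| ≤ X.height :=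
  (X.abs_dprofile_le x).trans (X.profile_le x)

theorem integrable_dprofile (a : ℝ) : Integrable (fun x => X.dprofile (x - a)) X.meas :=
  (X.integrable_profile a).mono' (X.measurable_dprofile_sub a).aestronglyMeasurable
    (Eventually.of_forall fun x => X.abs_dprofile_le (x - a))

theorem decays_mul_of_bounded {f g : ℝ → ℝ} (hf : X.Decays f) {C : ℝ} (hC : ∀ x, |g x| ≤ C) :
    X.Decays fun x => f x * g x := by
  refine hf.of_le (C := C) fun x => ?_
  rw [abs_mul, mul_comm]
  exact mul_le_mul_of_nonneg_right (hC x) (abs_nonneg _)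

theorem tendsto_sub_nhdsLT (a : ℝ) : Tendsto (fun x : ℝ => x - a) (𝓝[<] a) (𝓝[<] 0) := by
  refine tendsto_nhdsWithin_of_tendsto_nhds_of_eventually_within _ ?_ ?_
  · have : Tendsto (fun x : ℝ => x - a) (𝓝 a) (𝓝 (a - a)) :=
      (continuous_id.sub continuous_const).tendsto _
    rw [sub_self] at this
    exact this.mono_left nhdsWithin_le_nhds
  · filter_upwards [self_mem_nhdsWithin] with x hx
    exact sub_neg.2 (Set.mem_Iio.1 hx)

theorem tendsto_sub_nhdsGT (a : ℝ) : Tendsto (fun x : ℝ => x - a) (𝓝[>] a) (𝓝[>] 0) := by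
  refine tendsto_nhdsWithin_of_tendsto_nhds_of_eventually_within _ ?_ ?_
  · have : Tendsto (fun x : ℝ => x - a) (𝓝 a) (𝓝 (a - a)) :=
      (continuous_id.sub continuous_const).tendsto _
    rw [sub_self] at this
    exact this.mono_left nhdsWithin_le_nhds
  · filter_upwards [self_mem_nhdsWithin] with x hx
    exact sub_pos.2 (Set.mem_Ioi.1 hx)

theorem tendsto_dprofile_sub_left (a : ℝ) :
    Tendsto (fun x => X.dprofile (x - a)) (𝓝[<] a) (𝓝 X.slope) :=
  X.tendsto_dprofile_left.comp (tendsto_sub_nhdsLT a)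

theorem tendsto_dprofile_sub_right (a : ℝ) :
    Tendsto (fun x => X.dprofile (x - a)) (𝓝[>] a) (𝓝 (-X.slope)) :=
  X.tendsto_dprofile_right.comp (tendsto_sub_nhdsGT a)

theorem hasDerivAt_profile_sub {x a : ℝ} (h : ¬X.IsPeak (x - a)) :
    HasDerivAt (fun x => X.profile (x - a)) (X.dprofile (x - a)) x :=
  (X.hasDerivAt_profile h).comp_sub_const x a

theorem hasDerivAt_dprofile_sub {x a : ℝ} (h : ¬X.IsPeak (x - a)) :
    HasDerivAt (fun x => X.dprofile (x - a)) (X.profile (x - a)) x :=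
  (X.hasDerivAt_dprofile h).comp_sub_const x a

theorem profile_sub_comm (x y : ℝ) : X.profile (x - y) = X.profile (y - x) := by
  rw [← X.profile_neg, neg_sub]

theorem continuous_profile_sub (a : ℝ) : Continuous fun x => X.profile (x - a) :=
  X.continuous_profile.comp (continuous_id.sub continuous_const)

theorem bessel_eq (f : ℝ → ℝ) (x : ℝ) :
    X.bessel f x = (2 * X.slope)⁻¹ * ∫ y, X.profile (y - x) * f y ∂X.meas := by
  rw [bessel, ← integral_const_mul]
  congr 1
  ext y
  rw [green_eq, profile_sub_comm]
  ring

theorem integral_profile_mul (f : ℝ → ℝ) (x : ℝ) :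
    ∫ y, X.profile (y - x) * f y ∂X.meas = 2 * X.slope * X.bessel f x := by
  have := X.slope_pos
  rw [bessel_eq]
  field_simp

/-- The profile is a fundamental solution of `1 - ∂²`. -/
theorem integral_profile_sub_deriv2 {φ φ₁ φ₂ : ℝ → ℝ} (h₁ : ∀ x, HasDerivAt φ (φ₁ x) x)
    (h₂ : ∀ x, HasDerivAt φ₁ (φ₂ x) x) (hc : Continuous φ₂) (hφ : X.IsFun φ) (hφ₁ : X.IsFun φ₁)
    (hφ₂ : X.IsFun φ₂) {C : ℝ} (hC : ∀ x, |φ x| ≤ C) (hC₁ : ∀ x, |φ₁ x| ≤ C)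
    (hC₂ : ∀ x, |φ₂ x| ≤ C) (x : ℝ) :
    ∫ y, X.profile (y - x) * (φ y - φ₂ y) ∂X.meas = 2 * X.slope * φ x := by
  have c : Continuous φ := continuous_iff_continuousAt.2 fun x => (h₁ x).continuousAt
  have c₁ : Continuous φ₁ := continuous_iff_continuousAt.2 fun x => (h₂ x).continuousAt
  have hPC := X.continuous_profile_sub x
  have hpk : ¬X.IsPeak (x + 1 - x) := by simpa using X.not_isPeak_one
  have hDC : ContinuousAt (fun y => X.dprofile (y - x)) (x + 1) :=
    (X.hasDerivAt_dprofile_sub hpk).continuousAt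
  -- Since `E'' = E`, the derivative of `F = E'φ - Eφ'` is `E(φ - φ'')`, and only `E'` jumps, by
  -- `-2·slope` at `x`. The jump formula wants two points; `x + 1` is a dummy at which `F` is
  -- continuous.
  set F : ℝ → ℝ := fun y => X.dprofile (y - x) * φ y - X.profile (y - x) * φ₁ y with hFdef
  have hb : ContinuousAt F (x + 1) :=
    (hDC.mul c.continuousAt).sub (hPC.continuousAt.mul c₁.continuousAt)
  have key := X.integral_eq_jumps (X.ordered_add_one x) (F := F)
    (F' := fun y => X.profile (y - x) * (φ y - φ₂ y)) ?_ ?_ ?_ ?_ ?_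
    (la := X.slope * φ x - X.profile (x - x) * φ₁ x)
    (ra := -X.slope * φ x - X.profile (x - x) * φ₁ x) (lb := F (x + 1)) (rb := F (x + 1))
    ?_ ?_ ?_ ?_
  · rw [key]; ring
  · refine (X.decays_profile x).of_le (C := 2 * C) fun y => ?_
    have := X.abs_dprofile_le (y - x)
    have hP := X.profile_pos (y - x)
    rw [abs_of_pos hP]
    calc |F y| ≤ |X.dprofile (y - x) * φ y| + |X.profile (y - x) * φ₁ y| := abs_sub _ _
      _ ≤ X.profile (y - x) * C + X.profile (y - x) * C := by
        rw [abs_mul, abs_mul, abs_of_pos hP]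
        have := hC y
        have := hC₁ y
        gcongr
      _ = 2 * C * X.profile (y - x) := by ring
  · exact ((X.isFun_dprofile x).mul hφ).sub ((X.isFun_profile x).mul hφ₁)
  · exact (X.isFun_profile x).mul (hφ.sub hφ₂)
  · refine integrable_mul_bounded (X.integrable_profile x) (c.sub hc).measurable
      (C := C + C) fun y => ?_
    exact (abs_sub _ _).trans (add_le_add (hC y) (hC₂ y))
  · intro y hy _
    refine (((X.hasDerivAt_dprofile_sub hy).mul (h₁ y)).sub
      ((X.hasDerivAt_profile_sub hy).mul (h₂ y))).congr_deriv ?_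
    ring
  · exact ((X.tendsto_dprofile_sub_left x).mul (c.continuousAt.mono_left nhdsWithin_le_nhds)).sub
      ((hPC.mul c₁).continuousAt.mono_left nhdsWithin_le_nhds)
  · exact ((X.tendsto_dprofile_sub_right x).mul (c.continuousAt.mono_left nhdsWithin_le_nhds)).sub
      ((hPC.mul c₁).continuousAt.mono_left nhdsWithin_le_nhds)
  · exact hb.mono_left nhdsWithin_le_nhds
  · exact hb.mono_left nhdsWithin_le_nhds

/-- Differentiation under the integral hits the Lipschitz kernel. As the profile itself has no jump,
an integration by parts without boundary terms passes the derivative to `φ`. -/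
theorem hasDerivAt_bessel {φ φ₁ : ℝ → ℝ} (h₁ : ∀ x, HasDerivAt φ (φ₁ x) x)
    (hφ : X.IsFun φ) (hφ₁ : X.IsFun φ₁) {C : ℝ} (hC : ∀ x, |φ x| ≤ C)
    (hi : Integrable φ X.meas) (hi₁ : Integrable φ₁ X.meas) (x : ℝ) :
    HasDerivAt (X.bessel φ) (X.bessel φ₁ x) x := by
  have c : Continuous φ := continuous_iff_continuousAt.2 fun x => (h₁ x).continuousAt
  have hPC := X.continuous_profile_sub x
  have hpk : ∀ᵐ y ∂X.meas, ¬X.IsPeak (y - x) := by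
    have h0 : ∀ᵐ y ∂(volume : Measure ℝ), ¬X.IsPeak (y - x) := by
      rw [ae_iff]
      simp only [not_not]
      exact (X.countable_isPeak x).measure_zero _
    cases X
    · exact h0
    · exact ae_restrict_of_ae h0
  have hpi : Integrable (fun y => X.profile (y - x) * φ y) X.meas := by
    simp_rw [mul_comm (X.profile _)]
    exact integrable_mul_bounded hi (X.measurable_profile_sub x) fun y => X.abs_profile_le _
  have hpi₁ : Integrable (fun y => X.profile (y - x) * φ₁ y) X.meas := by
    simp_rw [mul_comm (X.profile _)]
    exact integrable_mul_bounded hi₁ (X.measurable_profile_sub x) fun y => X.abs_profile_le _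
  have hdi : Integrable (fun y => X.dprofile (y - x) * φ y) X.meas := by
    simp_rw [mul_comm (X.dprofile _)]
    exact integrable_mul_bounded hi (X.measurable_dprofile_sub x)
      fun y => X.abs_dprofile_le_height _
  have D := (hasDerivAt_integral_of_dominated_loc_of_lip (μ := X.meas) (x₀ := x)
    (F := fun x y => X.profile (y - x) * φ y) (F' := fun y => -(X.dprofile (y - x) * φ y))
    (bound := fun y => X.height * |φ y|) univ_mem
    (Eventually.of_forall fun x' =>
      ((X.measurable_profile_sub x').mul c.measurable).aestronglyMeasurable) hpi
    ((X.measurable_dprofile_sub x).mul c.measurable).neg.aestronglyMeasurable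
    (Eventually.of_forall fun y => ?_) (hi.abs.const_mul _) ?_).2
  · have ibp := X.integral_eq_jumps (X.ordered_add_one x) (F := fun y => X.profile (y - x) * φ y)
      (F' := fun y => X.profile (y - x) * φ₁ y - -(X.dprofile (y - x) * φ y))
      (X.decays_mul_of_bounded (X.decays_profile x) hC) ((X.isFun_profile x).mul hφ)
      (((X.isFun_profile x).mul hφ₁).sub (((X.isFun_dprofile x).mul hφ).comp Neg.neg))
      (hpi₁.sub hdi.neg) (fun y hy _ =>
        ((X.hasDerivAt_profile_sub hy).mul (h₁ y)).congr_deriv (by ring))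
      ((hPC.mul c).continuousAt.mono_left nhdsWithin_le_nhds)
      ((hPC.mul c).continuousAt.mono_left nhdsWithin_le_nhds)
      ((hPC.mul c).continuousAt.mono_left nhdsWithin_le_nhds)
      ((hPC.mul c).continuousAt.mono_left nhdsWithin_le_nhds)
    rw [integral_sub hpi₁ hdi.fun_neg] at ibp
    simp only [Pi.mul_apply, sub_self, add_zero] at ibp
    have e : X.bessel φ = fun x => (2 * X.slope)⁻¹ * ∫ y, X.profile (y - x) * φ y ∂X.meas :=
      funext fun x => X.bessel_eq φ x
    rw [e, bessel_eq]
    refine (D.const_mul _).congr_deriv ?_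
    congr 1
    linarith
  · refine LipschitzOnWith.of_dist_le_mul fun s _ t _ => ?_
    rw [Real.dist_eq, Real.dist_eq, ← sub_mul, abs_mul, Real.coe_nnabs,
      abs_of_nonneg (mul_nonneg X.height_pos.le (abs_nonneg _))]
    have := X.abs_profile_sub_le (y - s) (y - t)
    rw [sub_sub_sub_cancel_left, abs_sub_comm t s] at this
    calc _ ≤ X.height * |s - t| * |φ y| := by gcongr
      _ = _ := by ring
  · filter_upwards [hpk] with y hy
    have := (((X.hasDerivAt_profile hy).scomp x ((hasDerivAt_id x).const_sub y)).mul_const (φ y))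
    refine this.congr_deriv ?_
    simp

/-- Fubini, for a kernel that is even and bounded. -/
theorem integral_bessel_mul {f ψ : ℝ → ℝ} (hf : Integrable f X.meas) (hψ : Integrable ψ X.meas) :
    ∫ x, X.bessel f x * ψ x ∂X.meas = ∫ x, f x * X.bessel ψ x ∂X.meas := by
  have e₁ : ∀ x, X.bessel f x * ψ x
      = ∫ y, (2 * X.slope)⁻¹ * (X.profile (y - x) * (f y * ψ x)) ∂X.meas := by
    intro x
    rw [bessel_eq, integral_const_mul, mul_assoc, ← integral_mul_const]
    simp_rw [mul_assoc]
  have e₂ : ∀ y, f y * X.bessel ψ y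
      = ∫ x, (2 * X.slope)⁻¹ * (X.profile (y - x) * (f y * ψ x)) ∂X.meas := by
    intro y
    rw [bessel_eq, integral_const_mul, mul_left_comm, ← integral_const_mul]
    congr 2
    ext x
    rw [profile_sub_comm]
    ring
  simp_rw [e₁, e₂]
  refine integral_integral_swap ?_
  refine Integrable.const_mul ?_ _
  have h := (hψ.mul_prod hf).bdd_mul (c := X.height) (f := fun p : ℝ × ℝ => X.profile (p.2 - p.1))
    (X.continuous_profile.comp (continuous_snd.sub continuous_fst)).aestronglyMeasurable
    (Eventually.of_forall fun p => X.abs_profile_le _)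
  refine h.congr (Eventually.of_forall fun p => ?_)
  simp only
  ring

theorem abs_bessel_le {f : ℝ → ℝ} (hf : Integrable f X.meas) (x : ℝ) :
    |X.bessel f x| ≤ (2 * X.slope)⁻¹ * (X.height * ∫ y, |f y| ∂X.meas) := by
  have hs := X.slope_pos
  rw [bessel_eq, abs_mul, abs_of_pos (by positivity)]
  gcongr
  rw [← integral_const_mul]
  rw [← Real.norm_eq_abs]
  refine norm_integral_le_of_norm_le (hf.abs.const_mul _) (Eventually.of_forall fun y => ?_)
  simp only [norm_mul, Real.norm_eq_abs]
  gcongr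
  exact X.abs_profile_le _

theorem isFun_bessel (f : ℝ → ℝ) : X.IsFun (X.bessel f) := by
  cases X
  · trivial
  · intro x
    simp only [bessel]
    congr 1
    ext y
    simp only [green]
    rw [show x + 2 * Real.pi - y = x - y + 2 * Real.pi by ring, perMod_periodic]

variable {X} in
theorem IsTest.contDiff {φ : ℝ → ℝ} (h : X.IsTest φ) : ContDiff ℝ ∞ φ := by
  cases X <;> exact h.1

variable {X} in
theorem IsTest.isFun {φ : ℝ → ℝ} (h : X.IsTest φ) : X.IsFun φ := by
  cases X
  · trivial
  · exact h.2

theorem _root_.Function.Periodic.deriv' {φ : ℝ → ℝ} {c : ℝ} (h : Function.Periodic φ c) :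
    Function.Periodic (deriv φ) c := by
  intro x
  rw [← deriv_comp_add_const]
  congr 1
  exact funext h

variable {X} in
theorem IsTest.deriv {φ : ℝ → ℝ} (h : X.IsTest φ) : X.IsTest (deriv φ) := by
  have hd : ContDiff ℝ ∞ (_root_.deriv φ) := (contDiff_infty_iff_deriv.1 h.contDiff).2
  cases X
  · exact ⟨hd, h.2.deriv⟩
  · exact ⟨hd, h.2.deriv'⟩

variable {X} in
theorem IsTest.hasDerivAt {φ : ℝ → ℝ} (h : X.IsTest φ) (x : ℝ) :
    HasDerivAt φ (_root_.deriv φ x) x :=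
  (h.contDiff.differentiable (by simp) x).hasDerivAt

variable {X} in
theorem IsTest.bounded {φ : ℝ → ℝ} (h : X.IsTest φ) : ∃ C, ∀ x, |φ x| ≤ C := by
  cases X
  · exact h.2.exists_bound_of_continuous h.1.continuous
  · obtain ⟨C, hC⟩ := (isCompact_Icc (a := (0 : ℝ)) (b := 2 * Real.pi)).exists_bound_of_continuousOn
      h.1.continuous.continuousOn
    refine ⟨C, fun x => ?_⟩
    obtain ⟨y, hy, hxy⟩ := h.2.exists_mem_Ico₀ Real.two_pi_pos x
    rw [hxy]
    exact hC y ⟨hy.1, hy.2.le⟩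

variable {X} in
theorem IsTest.integrable {φ : ℝ → ℝ} (h : X.IsTest φ) : Integrable φ X.meas := by
  cases X
  · exact h.1.continuous.integrable_of_hasCompactSupport (μ := volume) h.2
  · obtain ⟨C, hC⟩ := h.bounded
    exact integrable_of_bounded_circle h.contDiff.continuous.measurable hC

variable {X} in
theorem IsTest.hasDerivAt_bessel {φ : ℝ → ℝ} (h : X.IsTest φ) (x : ℝ) :
    HasDerivAt (X.bessel φ) (X.bessel (_root_.deriv φ) x) x := by
  obtain ⟨C, hC⟩ := h.bounded
  exact X.hasDerivAt_bessel h.hasDerivAt h.isFun h.deriv.isFun hC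
    h.integrable h.deriv.integrable x

-- The fundamental solution property gives `D⁻²φ'' = D⁻²φ - φ`, and `D⁻²` commutes with the
-- derivative. Thus `Ψ = D⁻²φ` is twice differentiable with `Ψ'' = Ψ - φ`.
variable {X} in
theorem IsTest.hasDerivAt_bessel_deriv {φ : ℝ → ℝ} (h : X.IsTest φ) (x : ℝ) :
    HasDerivAt (X.bessel (_root_.deriv φ)) (X.bessel φ x - φ x) x := by
  refine (h.deriv.hasDerivAt_bessel x).congr_deriv ?_
  obtain ⟨C, hC⟩ := h.bounded
  obtain ⟨C₁, hC₁⟩ := h.deriv.bounded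
  obtain ⟨C₂, hC₂⟩ := h.deriv.deriv.bounded
  have key := X.integral_profile_sub_deriv2 h.hasDerivAt h.deriv.hasDerivAt
    h.deriv.deriv.contDiff.continuous h.isFun h.deriv.isFun h.deriv.deriv.isFun
    (C := max C (max C₁ C₂)) (fun x => (hC x).trans (le_max_left _ _))
    (fun x => (hC₁ x).trans ((le_max_left _ _).trans (le_max_right _ _)))
    (fun x => (hC₂ x).trans ((le_max_right _ _).trans (le_max_right _ _))) x
  have hi : ∀ {ψ : ℝ → ℝ}, X.IsTest ψ → Integrable (fun y => X.profile (y - x) * ψ y) X.meas := by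
    intro ψ hψ
    simp_rw [mul_comm (X.profile _)]
    exact integrable_mul_bounded hψ.integrable (X.measurable_profile_sub x)
      fun y => X.abs_profile_le _
  simp_rw [mul_sub] at key
  rw [integral_sub (hi h) (hi h.deriv.deriv), integral_profile_mul, integral_profile_mul] at key
  have hs := X.slope_pos
  have : 2 * X.slope * (X.bessel φ x - X.bessel (_root_.deriv (_root_.deriv φ)) x)
      = 2 * X.slope * φ x := by linarith
  have := mul_left_cancel₀ (by positivity) this
  linarith

end Domain

theorem memLp_three_of_bounded {μ : Measure ℝ} {f : ℝ → ℝ} (hf : Integrable f μ) {C : ℝ}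
    (hC : ∀ x, |f x| ≤ C) : MemLp f 3 μ := by
  rw [← integrable_norm_rpow_iff hf.aestronglyMeasurable (by norm_num) (by norm_num)]
  refine (hf.abs.const_mul (C ^ 2)).mono' ?_ (Eventually.of_forall fun x => ?_)
  · exact (hf.aestronglyMeasurable.norm.aemeasurable.pow_const _).aestronglyMeasurable
  · have h0 : (0 : ℝ) ≤ |f x| := abs_nonneg _
    have : (3 : ℝ≥0∞).toReal = ((3 : ℕ) : ℝ) := by simp
    rw [this, Real.rpow_natCast, norm_pow, Real.norm_eq_abs, Real.norm_eq_abs, abs_abs,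
      show |f x| ^ 3 = |f x| ^ 2 * |f x| by ring]
    have := hC x
    gcongr

/-! ### Superpositions of two peakons and the weak Novikov equation -/

namespace Domain

/-- The superposition of two peakons with momenta `P₁`, `P₂` at `a`, `b`. -/
def peaks (X : Domain) (a b P₁ P₂ x : ℝ) : ℝ :=
  P₁ * X.profile (x - a) + P₂ * X.profile (x - b)

/-- The derivative of `peaks`. -/
def dpeaks (X : Domain) (a b P₁ P₂ x : ℝ) : ℝ :=
  P₁ * X.dprofile (x - a) + P₂ * X.dprofile (x - b)

variable (X : Domain) (a b P₁ P₂ : ℝ)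

theorem continuous_peaks : Continuous (X.peaks a b P₁ P₂) :=
  ((X.continuous_profile_sub a).const_mul P₁).add ((X.continuous_profile_sub b).const_mul P₂)

theorem measurable_dpeaks : Measurable (X.dpeaks a b P₁ P₂) :=
  ((X.measurable_dprofile_sub a).const_mul P₁).add ((X.measurable_dprofile_sub b).const_mul P₂)

theorem isFun_peaks : X.IsFun (X.peaks a b P₁ P₂) :=
  ((X.isFun_const P₁).mul (X.isFun_profile a)).add ((X.isFun_const P₂).mul (X.isFun_profile b))

theorem isFun_dpeaks : X.IsFun (X.dpeaks a b P₁ P₂) :=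
  ((X.isFun_const P₁).mul (X.isFun_dprofile a)).add ((X.isFun_const P₂).mul (X.isFun_dprofile b))

theorem integrable_peaks : Integrable (X.peaks a b P₁ P₂) X.meas :=
  ((X.integrable_profile a).const_mul P₁).add ((X.integrable_profile b).const_mul P₂)

theorem integrable_dpeaks : Integrable (X.dpeaks a b P₁ P₂) X.meas :=
  ((X.integrable_dprofile a).const_mul P₁).add ((X.integrable_dprofile b).const_mul P₂)

theorem abs_peaks_le (x : ℝ) : |X.peaks a b P₁ P₂ x| ≤ (|P₁| + |P₂|) * X.height := by
  refine (abs_add_le _ _).trans ?_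
  rw [abs_mul, abs_mul, add_mul]
  gcongr <;> exact X.abs_profile_le _

theorem abs_dpeaks_le (x : ℝ) : |X.dpeaks a b P₁ P₂ x| ≤ (|P₁| + |P₂|) * X.height := by
  refine (abs_add_le _ _).trans ?_
  rw [abs_mul, abs_mul, add_mul]
  gcongr <;> exact X.abs_dprofile_le_height _

theorem decays_peaks : X.Decays (X.peaks a b P₁ P₂) := by
  intro h
  have := ((X.decays_profile a h).const_mul P₁).add ((X.decays_profile b h).const_mul P₂)
  rwa [mul_zero, mul_zero, add_zero] at this

variable {a b} {x : ℝ}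

theorem hasDerivAt_peaks (ha : ¬X.IsPeak (x - a)) (hb : ¬X.IsPeak (x - b)) :
    HasDerivAt (X.peaks a b P₁ P₂) (X.dpeaks a b P₁ P₂ x) x :=
  ((X.hasDerivAt_profile_sub ha).const_mul P₁).add ((X.hasDerivAt_profile_sub hb).const_mul P₂)

theorem hasDerivAt_dpeaks (ha : ¬X.IsPeak (x - a)) (hb : ¬X.IsPeak (x - b)) :
    HasDerivAt (X.dpeaks a b P₁ P₂) (X.peaks a b P₁ P₂ x) x :=
  ((X.hasDerivAt_dprofile_sub ha).const_mul P₁).add ((X.hasDerivAt_dprofile_sub hb).const_mul P₂)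

theorem not_isPeak_sub (hab : X.Ordered a b) : ¬X.IsPeak (b - a) := X.not_isPeak_of_ordered (X.ordered_sub.2 hab)

theorem not_isPeak_sub' (hab : X.Ordered a b) : ¬X.IsPeak (a - b) := by
  rw [← isPeak_neg, neg_sub]
  exact X.not_isPeak_sub hab

/-- At a peak its own profile switches slope from `slope` to `-slope`, while the other one
contributes a continuous term. That term is the mean of the two limits, hence the factor that
remains in the jump of `v²`; it reappears in the equations of the momenta. -/
theorem tendsto_dpeaks_first_left (hab : X.Ordered a b) :
    Tendsto (X.dpeaks a b P₁ P₂) (𝓝[<] a)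
    (𝓝 (P₁ * X.slope + P₂ * -X.dprofile (b - a))) := by
  have h := (X.hasDerivAt_dprofile_sub (X.not_isPeak_sub' hab)).continuousAt
  have e : X.dprofile (a - b) = -X.dprofile (b - a) := by
    rw [← X.dprofile_neg (X.not_isPeak_sub hab), neg_sub]
  rw [← e]
  exact ((X.tendsto_dprofile_sub_left a).const_mul P₁).add
    ((h.mono_left nhdsWithin_le_nhds).const_mul P₂)

theorem tendsto_dpeaks_first_right (hab : X.Ordered a b) :
    Tendsto (X.dpeaks a b P₁ P₂) (𝓝[>] a)
    (𝓝 (P₁ * -X.slope + P₂ * -X.dprofile (b - a))) := by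
  have h := (X.hasDerivAt_dprofile_sub (X.not_isPeak_sub' hab)).continuousAt
  have e : X.dprofile (a - b) = -X.dprofile (b - a) := by
    rw [← X.dprofile_neg (X.not_isPeak_sub hab), neg_sub]
  rw [← e]
  exact ((X.tendsto_dprofile_sub_right a).const_mul P₁).add
    ((h.mono_left nhdsWithin_le_nhds).const_mul P₂)

theorem tendsto_dpeaks_second_left (hab : X.Ordered a b) :
    Tendsto (X.dpeaks a b P₁ P₂) (𝓝[<] b)
    (𝓝 (P₁ * X.dprofile (b - a) + P₂ * X.slope)) :=
  (((X.hasDerivAt_dprofile_sub (X.not_isPeak_sub hab)).continuousAt.mono_left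
    nhdsWithin_le_nhds).const_mul P₁).add ((X.tendsto_dprofile_sub_left b).const_mul P₂)

theorem tendsto_dpeaks_second_right (hab : X.Ordered a b) :
    Tendsto (X.dpeaks a b P₁ P₂) (𝓝[>] b)
    (𝓝 (P₁ * X.dprofile (b - a) + P₂ * -X.slope)) :=
  (((X.hasDerivAt_dprofile_sub (X.not_isPeak_sub hab)).continuousAt.mono_left
    nhdsWithin_le_nhds).const_mul P₁).add ((X.tendsto_dprofile_sub_right b).const_mul P₂)

theorem isWeakDeriv_peaks (hab : X.Ordered a b) :
    X.IsWeakDeriv (X.peaks a b P₁ P₂) (X.dpeaks a b P₁ P₂) := by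
  intro φ hφ
  obtain ⟨C, hC⟩ := hφ.bounded
  obtain ⟨C₁, hC₁⟩ := hφ.deriv.bounded
  have hu := X.continuous_peaks a b P₁ P₂
  have c := hφ.contDiff.continuous
  have i₁ := integrable_mul_bounded (X.integrable_peaks a b P₁ P₂)
    hφ.deriv.contDiff.continuous.measurable hC₁
  have i₂ := integrable_mul_bounded (X.integrable_dpeaks a b P₁ P₂) c.measurable hC
  have key := X.integral_eq_jumps hab (F := fun x => X.peaks a b P₁ P₂ x * φ x)
    (F' := fun x => X.peaks a b P₁ P₂ x * deriv φ x + X.dpeaks a b P₁ P₂ x * φ x)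
    (X.decays_mul_of_bounded (X.decays_peaks a b P₁ P₂) hC)
    ((X.isFun_peaks a b P₁ P₂).mul hφ.isFun)
    (((X.isFun_peaks a b P₁ P₂).mul hφ.deriv.isFun).add
      ((X.isFun_dpeaks a b P₁ P₂).mul hφ.isFun)) (i₁.add i₂)
    (fun x ha hb => ((X.hasDerivAt_peaks P₁ P₂ ha hb).mul (hφ.hasDerivAt x)).congr_deriv
      (by ring))
    ((hu.mul c).continuousAt.mono_left nhdsWithin_le_nhds)
    ((hu.mul c).continuousAt.mono_left nhdsWithin_le_nhds)
    ((hu.mul c).continuousAt.mono_left nhdsWithin_le_nhds)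
    ((hu.mul c).continuousAt.mono_left nhdsWithin_le_nhds)
  rw [integral_add i₁ i₂] at key
  simp only [Pi.mul_apply, sub_self, add_zero] at key
  linarith

theorem peaks_first : X.peaks a b P₁ P₂ a = P₁ * X.height + P₂ * X.profile (b - a) := by
  rw [peaks, sub_self, profile_zero, profile_sub_comm]

theorem peaks_second : X.peaks a b P₁ P₂ b = P₁ * X.profile (b - a) + P₂ * X.height := by
  rw [peaks, sub_self, profile_zero]

/-- The spatial part of the Novikov equation for a superposition of two peakons. -/
theorem novikov_flux (hab : X.Ordered a b) {φ : ℝ → ℝ} (hφ : X.IsTest φ) :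
    -(∫ x, X.peaks a b P₁ P₂ x ^ 2 * X.dpeaks a b P₁ P₂ x * φ x ∂X.meas)
      + (∫ x, X.bessel (fun y => X.peaks a b P₁ P₂ y ^ 3
          + 3 / 2 * (X.peaks a b P₁ P₂ y * X.dpeaks a b P₁ P₂ y ^ 2)) x * deriv φ x ∂X.meas)
      - ∫ x, X.bessel (fun y => 1 / 2 * X.dpeaks a b P₁ P₂ y ^ 3) x * φ x ∂X.meas
    = 2 * X.slope *
      (P₁ * (X.peaks a b P₁ P₂ a ^ 2 * X.bessel (deriv φ) a
          + X.peaks a b P₁ P₂ a * (P₂ * X.dprofile (b - a)) * X.bessel φ a)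
        + P₂ * (X.peaks a b P₁ P₂ b ^ 2 * X.bessel (deriv φ) b
          - X.peaks a b P₁ P₂ b * (P₁ * X.dprofile (b - a)) * X.bessel φ b)) := by
  set u := X.peaks a b P₁ P₂ with hu_def
  set v := X.dpeaks a b P₁ P₂ with hv_def
  set Ψ := X.bessel φ with hΨ_def
  set Ψ₁ := X.bessel (deriv φ) with hΨ₁_def
  set M := (|P₁| + |P₂|) * X.height with hM
  have hu : Continuous u := X.continuous_peaks a b P₁ P₂
  have hv : Measurable v := X.measurable_dpeaks a b P₁ P₂
  have hui : Integrable u X.meas := X.integrable_peaks a b P₁ P₂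
  have hvi : Integrable v X.meas := X.integrable_dpeaks a b P₁ P₂
  have huM : ∀ x, |u x| ≤ M := X.abs_peaks_le a b P₁ P₂
  have hvM : ∀ x, |v x| ≤ M := X.abs_dpeaks_le a b P₁ P₂
  have hM0 : 0 ≤ M := (abs_nonneg _).trans (huM 0)
  have huf : X.IsFun u := X.isFun_peaks a b P₁ P₂
  have hvf : X.IsFun v := X.isFun_dpeaks a b P₁ P₂
  obtain ⟨C, hC⟩ := hφ.bounded
  obtain ⟨K, hK⟩ : ∃ K, ∀ x, |Ψ x| ≤ K := ⟨_, X.abs_bessel_le hφ.integrable⟩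
  obtain ⟨K₁, hK₁⟩ : ∃ K, ∀ x, |Ψ₁ x| ≤ K := ⟨_, X.abs_bessel_le hφ.deriv.integrable⟩
  have hK0 : 0 ≤ K := (abs_nonneg _).trans (hK 0)
  have hK₁0 : 0 ≤ K₁ := (abs_nonneg _).trans (hK₁ 0)
  have cφ := hφ.contDiff.continuous
  have cΨ : Continuous Ψ := continuous_iff_continuousAt.2 fun x =>
    (hφ.hasDerivAt_bessel x).continuousAt
  have cΨ₁ : Continuous Ψ₁ := continuous_iff_continuousAt.2 fun x =>
    (hφ.hasDerivAt_bessel_deriv x).continuousAt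
  have uv_le : ∀ x, |u x * v x| ≤ M * M := fun x => by
    rw [abs_mul]; exact mul_le_mul (huM x) (hvM x) (abs_nonneg _) hM0
  have uu_le : ∀ x, |u x * u x| ≤ M * M := fun x => by
    rw [abs_mul]; exact mul_le_mul (huM x) (huM x) (abs_nonneg _) hM0
  have vv_le : ∀ x, |v x * v x| ≤ M * M := fun x => by
    rw [abs_mul]; exact mul_le_mul (hvM x) (hvM x) (abs_nonneg _) hM0
  have i_uuv : Integrable (fun x => u x ^ 2 * v x) X.meas := by
    refine (integrable_mul_bounded hvi (hu.measurable.mul hu.measurable) uu_le).congr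
      (Eventually.of_forall fun x => ?_)
    simp only [Pi.mul_apply]; ring
  have i_f : Integrable (fun y => u y ^ 3 + 3 / 2 * (u y * v y ^ 2)) X.meas := by
    have h₁ := integrable_mul_bounded hui (hu.measurable.mul hu.measurable) uu_le
    have h₂ := integrable_mul_bounded hui (hv.mul hv) vv_le
    refine (h₁.add (h₂.const_mul (3 / 2))).congr (Eventually.of_forall fun x => ?_)
    simp only [Pi.mul_apply, Pi.add_apply]; ring
  have i_g : Integrable (fun y => 1 / 2 * v y ^ 3) X.meas := by
    have h₂ := integrable_mul_bounded hvi (hv.mul hv) vv_le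
    refine (h₂.const_mul (1 / 2)).congr (Eventually.of_forall fun x => ?_)
    simp only [Pi.mul_apply]; ring
  -- With `D⁻²` on the test function, all that remains is local in `u`, `v`, `Ψ` and `Ψ'`.
  rw [X.integral_bessel_mul i_f hφ.deriv.integrable, X.integral_bessel_mul i_g hφ.integrable]
  have j₁ := integrable_mul_bounded i_uuv cφ.measurable hC
  have j₂ := integrable_mul_bounded i_f cΨ₁.measurable hK₁
  have j₃ := integrable_mul_bounded i_g cΨ.measurable hK
  have j₂₁ : Integrable (fun x => (u x ^ 3 + 3 / 2 * (u x * v x ^ 2)) * Ψ₁ x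
      - u x ^ 2 * v x * φ x) X.meas := j₂.sub j₁
  have j : Integrable (fun x => (u x ^ 3 + 3 / 2 * (u x * v x ^ 2)) * Ψ₁ x
      - u x ^ 2 * v x * φ x - 1 / 2 * v x ^ 3 * Ψ x) X.meas := j₂₁.sub j₃
  have e : -(∫ x, u x ^ 2 * v x * φ x ∂X.meas)
      + (∫ x, (u x ^ 3 + 3 / 2 * (u x * v x ^ 2)) * Ψ₁ x ∂X.meas)
      - ∫ x, 1 / 2 * v x ^ 3 * Ψ x ∂X.meas
      = ∫ x, (u x ^ 3 + 3 / 2 * (u x * v x ^ 2)) * Ψ₁ x - u x ^ 2 * v x * φ x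
        - 1 / 2 * v x ^ 3 * Ψ x ∂X.meas := by
    rw [integral_sub j₂₁ j₃, integral_sub j₂ j₁]
    ring
  rw [e]
  -- Off the peaks the integrand is the derivative of `u(uvΨ' - ½v²Ψ)`, because `u' = v`, `v' = u`
  -- and `Ψ'' = Ψ - φ`. Only `v` jumps, so the one-sided limits of this primitive are determined by
  -- those of `v`.
  have hF : ∀ {l : Filter ℝ} {c V : ℝ}, l ≤ 𝓝 c → Tendsto v l (𝓝 V) →
      Tendsto (fun x => u x * (u x * v x * Ψ₁ x - 1 / 2 * (v x * v x) * Ψ x)) l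
        (𝓝 (u c * (u c * V * Ψ₁ c - 1 / 2 * (V * V) * Ψ c))) := by
    intro l c V hl hV
    have hu' : Tendsto u l (𝓝 (u c)) := hu.continuousAt.mono_left hl
    have h1 : Tendsto Ψ l (𝓝 (Ψ c)) := cΨ.continuousAt.mono_left hl
    have h2 : Tendsto Ψ₁ l (𝓝 (Ψ₁ c)) := cΨ₁.continuousAt.mono_left hl
    exact hu'.mul (((hu'.mul hV).mul h2).sub (((hV.mul hV).const_mul _).mul h1))
  rw [X.integral_eq_jumps hab (F := fun x => u x * (u x * v x * Ψ₁ x - 1 / 2 * (v x * v x) * Ψ x))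
    ?_ ?_ ?_ j ?_
    (hF nhdsWithin_le_nhds (X.tendsto_dpeaks_first_left P₁ P₂ hab))
    (hF nhdsWithin_le_nhds (X.tendsto_dpeaks_first_right P₁ P₂ hab))
    (hF nhdsWithin_le_nhds (X.tendsto_dpeaks_second_left P₁ P₂ hab))
    (hF nhdsWithin_le_nhds (X.tendsto_dpeaks_second_right P₁ P₂ hab))]
  · ring
  · refine X.decays_mul_of_bounded (X.decays_peaks a b P₁ P₂)
      (C := M * M * K₁ + 1 / 2 * (M * M) * K) fun x => (abs_sub _ _).trans ?_
    rw [abs_mul (u x * v x), abs_mul _ (Ψ x), abs_mul (1 / 2)]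
    have h1 := uv_le x
    have h2 := vv_le x
    have h3 := hK x
    have h4 := hK₁ x
    rw [show |(1 / 2 : ℝ)| = 1 / 2 by norm_num]
    gcongr
  · exact huf.mul (((huf.mul hvf).mul (X.isFun_bessel _)).sub
      (((X.isFun_const _).mul (hvf.mul hvf)).mul (X.isFun_bessel _)))
  · exact (((((huf.comp fun y => y ^ 3).add ((X.isFun_const _).mul
      (huf.mul (hvf.comp fun y => y ^ 2))))).mul (X.isFun_bessel _)).sub
      (((huf.comp fun y => y ^ 2).mul hvf).mul hφ.isFun)).sub
      (((X.isFun_const _).mul (hvf.comp fun y => y ^ 3)).mul (X.isFun_bessel _))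
  · intro x ha hb
    have d1 : HasDerivAt u (v x) x := X.hasDerivAt_peaks P₁ P₂ ha hb
    have d2 : HasDerivAt v (u x) x := X.hasDerivAt_dpeaks P₁ P₂ ha hb
    have d3 : HasDerivAt Ψ (Ψ₁ x) x := hφ.hasDerivAt_bessel x
    have d4 : HasDerivAt Ψ₁ (Ψ x - φ x) x := hφ.hasDerivAt_bessel_deriv x
    refine (d1.mul (((d1.mul d2).mul d4).sub (((d2.mul d2).const_mul (1 / 2)).mul d3))).congr_deriv ?_
    simp only [Pi.mul_apply, Pi.sub_apply]
    ring

theorem integral_peaks_mul {φ : ℝ → ℝ} (hφ : X.IsTest φ) :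
    ∫ x, X.peaks a b P₁ P₂ x * φ x ∂X.meas
      = 2 * X.slope * (P₁ * X.bessel φ a + P₂ * X.bessel φ b) := by
  have hi : ∀ c, Integrable (fun y => X.profile (y - c) * φ y) X.meas := by
    intro c
    simp_rw [mul_comm (X.profile _)]
    exact integrable_mul_bounded hφ.integrable (X.measurable_profile_sub c)
      fun y => X.abs_profile_le _
  simp_rw [peaks, add_mul, mul_assoc]
  rw [integral_add ((hi a).const_mul P₁) ((hi b).const_mul P₂), integral_const_mul,
    integral_const_mul, integral_profile_mul, integral_profile_mul]
  ring

/-- A 2-peakon is a solution of the Novikov equation if its positions and momenta satisfy the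
system of ordinary differential equations of the multipeakons. -/
theorem isNovikovSolution_twoPeakon {T : ℝ} {q₁ q₂ p₁ p₂ : ℝ → ℝ}
    (ho : ∀ t ∈ Set.Ico 0 T, X.Ordered (q₁ t) (q₂ t))
    (hq₁ : ∀ t ∈ Set.Ico 0 T, HasDerivAt q₁
      ((p₁ t * X.height + p₂ t * X.profile (q₂ t - q₁ t)) ^ 2) t)
    (hq₂ : ∀ t ∈ Set.Ico 0 T, HasDerivAt q₂
      ((p₁ t * X.profile (q₂ t - q₁ t) + p₂ t * X.height) ^ 2) t)
    (hp₁ : ∀ t ∈ Set.Ico 0 T, HasDerivAt p₁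
      (p₁ t * (p₁ t * X.height + p₂ t * X.profile (q₂ t - q₁ t))
        * (p₂ t * X.dprofile (q₂ t - q₁ t))) t)
    (hp₂ : ∀ t ∈ Set.Ico 0 T, HasDerivAt p₂
      (-(p₂ t * (p₁ t * X.profile (q₂ t - q₁ t) + p₂ t * X.height)
        * (p₁ t * X.dprofile (q₂ t - q₁ t)))) t) :
    X.IsNovikovSolution T (X.twoPeakon q₁ q₂ p₁ p₂) := by
  refine ⟨fun t => X.dpeaks (q₁ t) (q₂ t) (p₁ t) (p₂ t), fun t ht => ⟨X.isFun_peaks _ _ _ _,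
    X.isFun_dpeaks _ _ _ _, memLp_three_of_bounded (X.integrable_peaks _ _ _ _)
      (X.abs_peaks_le _ _ _ _), memLp_three_of_bounded (X.integrable_dpeaks _ _ _ _)
      (X.abs_dpeaks_le _ _ _ _), X.isWeakDeriv_peaks _ _ (ho t ht)⟩, fun φ hφ t ht => ?_⟩
  -- The profile is a multiple of the Green function, so pairing with `φ` evaluates `D⁻²φ` at the
  -- two positions. The time derivative is then an ordinary chain rule, with no differentiation
  -- under the integral.
  have e : (fun τ => ∫ x, X.twoPeakon q₁ q₂ p₁ p₂ τ x * φ x ∂X.meas) = fun τ =>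
      2 * X.slope * (p₁ τ * X.bessel φ (q₁ τ) + p₂ τ * X.bessel φ (q₂ τ)) :=
    funext fun τ => X.integral_peaks_mul (p₁ τ) (p₂ τ) hφ
  rw [e]
  refine HasDerivAt.hasDerivWithinAt ?_
  have d₁ := (hφ.hasDerivAt_bessel (q₁ t)).comp t (hq₁ t ht)
  have d₂ := (hφ.hasDerivAt_bessel (q₂ t)).comp t (hq₂ t ht)
  refine ((((hp₁ t ht).mul d₁).add ((hp₂ t ht).mul d₂)).const_mul (2 * X.slope)).congr_deriv ?_
  refine Eq.trans ?_ (X.novikov_flux (p₁ t) (p₂ t) (ho t ht) hφ).symm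
  rw [peaks_first, peaks_second]
  simp only [Function.comp]
  ring

end Domain

/-! ### Explicit colliding solutions of the peakon system -/

/-- The scalar differential equation `η' = -g(η)` with `g` bounded between positive constants has a
solution that descends from `η₀` to `0` in finite time. -/
theorem exists_descending_flow {g : ℝ → ℝ} (hg : Continuous g) {m M : ℝ} (hm : 0 < m)
    (hgm : ∀ x, m ≤ g x) (hgM : ∀ x, g x ≤ M) {η₀ : ℝ} (hη₀ : 0 < η₀) :
    ∃ (T : ℝ) (η : ℝ → ℝ), 0 < T ∧ T ≤ η₀ / m ∧ η 0 = η₀ ∧ η T = 0 ∧ StrictAnti η ∧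
      ∀ t, HasDerivAt η (-g (η t)) t := by
  have hgp : ∀ x, 0 < g x := fun x => hm.trans_le (hgm x)
  have hM : 0 < M := (hgp 0).trans_le (hgM 0)
  have hc : Continuous fun x => (g x)⁻¹ := hg.inv₀ fun x => (hgp x).ne'
  -- Separation of variables: `σ x` is the time needed to descend from `x` to `0`, and `η` is the
  -- inverse of `σ` run backwards from `T = σ η₀`. The bound `m` controls `T`; the bound `M` makes
  -- `σ` surjective, so that `η` exists for all times.
  set σ : ℝ → ℝ := fun x => ∫ y in (0 : ℝ)..x, (g y)⁻¹ with hσ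
  have hσd : ∀ x, HasDerivAt σ (g x)⁻¹ x := fun x => hc.integral_hasStrictDerivAt 0 x |>.hasDerivAt
  have hσ0 : σ 0 = 0 := intervalIntegral.integral_same
  have hσc : Continuous σ := continuous_iff_continuousAt.2 fun x => (hσd x).continuousAt
  have hmono : StrictMono σ := strictMono_of_hasDerivAt_pos hσd fun x => inv_pos.2 (hgp x)
  have hlow : ∀ x y, x ≤ y → M⁻¹ * (y - x) ≤ σ y - σ x := by
    intro x y hxy
    refine convex_univ.mul_sub_le_image_sub_of_le_deriv hσc.continuousOn
      (fun x _ => (hσd x).differentiableAt.differentiableWithinAt) (fun x _ => ?_) x trivial y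
      trivial hxy
    rw [(hσd x).deriv]
    exact inv_anti₀ (hgp x) (hgM x)
  have hup : σ η₀ ≤ m⁻¹ * η₀ := by
    have := convex_univ.image_sub_le_mul_sub_of_deriv_le hσc.continuousOn
      (fun x _ => (hσd x).differentiableAt.differentiableWithinAt) (C := m⁻¹) (fun x _ => by
        rw [(hσd x).deriv]; exact inv_anti₀ hm (hgm x)) 0 trivial η₀ trivial hη₀.le
    simpa [hσ0] using this
  have hsurj : Function.Surjective σ := by
    refine hσc.surjective ?_ ?_
    · refine tendsto_atTop_mono' _ ?_ (tendsto_id.const_mul_atTop (inv_pos.2 hM))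
      filter_upwards [eventually_ge_atTop 0] with x hx
      simpa [hσ0] using hlow 0 x hx
    · refine tendsto_atBot_mono' _ ?_ (tendsto_id.const_mul_atBot (inv_pos.2 hM))
      filter_upwards [eventually_le_atBot 0] with x hx
      have := hlow x 0 hx
      simp only [hσ0, id] at this ⊢
      linarith
  set e := hmono.orderIsoOfSurjective σ hsurj with he
  have hes : ∀ x, σ (e.symm x) = x := fun x => e.apply_symm_apply x
  have hes' : ∀ x, e.symm (σ x) = x := fun x => e.symm_apply_apply x
  have hd : ∀ x, HasDerivAt e.symm (g (e.symm x)) x := by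
    intro x
    have := HasDerivAt.of_local_left_inverse (f := σ) (g := e.symm) (a := x)
      e.symm.continuous.continuousAt (hσd _) (inv_ne_zero (hgp _).ne')
      (Eventually.of_forall hes)
    rwa [inv_inv] at this
  refine ⟨σ η₀, fun t => e.symm (σ η₀ - t), ?_, ?_, ?_, ?_, ?_, ?_⟩
  · rw [← hσ0]; exact hmono hη₀
  · rw [div_eq_inv_mul]; exact hup
  · simp only [sub_zero, hes']
  · simp only [sub_self]
    conv_lhs => rw [← hσ0, hes']
  · intro s t hst
    exact e.symm.strictMono (by linarith)
  · intro t
    refine ((hd (σ η₀ - t)).scomp t ((hasDerivAt_id t).const_sub (σ η₀))).congr_deriv ?_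
    simp

namespace Domain

variable (X : Domain)

/-- The constant `profile² - dprofile²`. -/
def discr : Domain → ℝ
  | line => 0
  | circle => 1

/-- The inverse of the profile on a right neighbourhood of the peak. -/
def invProfile : Domain → ℝ → ℝ
  | line, A => -Real.log A
  | circle, A => Real.pi - Real.arcosh A

theorem sqrt_height_sq : √(X.height ^ 2 - X.discr) = X.slope := by
  cases X
  · simp [height, discr, slope]
  · simp only [height, discr, slope]
    rw [← Real.sinh_sq, Real.sqrt_sq (Real.sinh_pos_iff.2 Real.pi_pos).le]

theorem discr_lt_height : X.discr < X.height := by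
  cases X
  · simp [height, discr]
  · exact Real.one_lt_cosh.2 Real.pi_pos.ne'

theorem discr_lt_sq {A : ℝ} (h : X.discr < A) : X.discr < A ^ 2 := by
  cases X
  · simp only [discr] at *; positivity
  · simp only [discr] at *; nlinarith

theorem invProfile_height : X.invProfile X.height = 0 := by
  cases X
  · simp [invProfile, height]
  · simp [invProfile, height, Real.arcosh_cosh Real.pi_pos.le]

/-- The derivative is `1/E'`, expressed through `E² - E'² = discr`. No upper bound on `A` is
imposed: differentiability at `A = height` describes the gap at the collision. -/
theorem hasDerivAt_invProfile {A : ℝ} (h : X.discr < A) :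
    HasDerivAt X.invProfile (-(√(A ^ 2 - X.discr))⁻¹) A := by
  cases X
  · simp only [discr] at *
    rw [sub_zero, Real.sqrt_sq h.le]
    exact (Real.hasDerivAt_log h.ne').fun_neg
  · exact (Real.hasDerivAt_arcosh (Set.mem_Ioi.2 h)).const_sub Real.pi

theorem ordered_invProfile {A : ℝ} (h : X.discr < A) (h' : A < X.height) :
    X.Ordered 0 (X.invProfile A) := by
  cases X
  · exact neg_pos.2 (Real.log_neg h h')
  · simp only [discr, height] at h h'
    have h₁ := Real.arcosh_pos h
    have h₂ := (Real.arcosh_lt_arcosh (by linarith) (Real.cosh_pos _)).2 h'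
    rw [Real.arcosh_cosh Real.pi_pos.le] at h₂
    have := Real.pi_pos
    constructor <;> simp only [invProfile] <;> linarith

theorem perMod_invProfile {A : ℝ} (h : circle.discr < A) (h' : A ≤ circle.height) :
    perMod (circle.invProfile A) = Real.pi - Real.arcosh A := by
  simp only [discr, height] at h h'
  have h₁ := Real.arcosh_pos h
  have h₂ := (Real.arcosh_le_arcosh (by linarith) (Real.cosh_pos _)).2 h'
  rw [Real.arcosh_cosh Real.pi_pos.le] at h₂
  have := Real.pi_pos
  rw [perMod_of_mem (n := 0)] <;> simp only [invProfile] <;> push_cast <;> linarith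

theorem profile_invProfile {A : ℝ} (h : X.discr < A) (h' : A ≤ X.height) :
    X.profile (X.invProfile A) = A := by
  cases X
  · simp only [discr, height, profile, invProfile] at *
    rw [abs_neg, abs_of_nonpos (Real.log_nonpos h.le h'), neg_neg, Real.exp_log h]
  · rw [profile, perMod_invProfile h h', sub_right_comm, sub_self, zero_sub, Real.cosh_neg,
      Real.cosh_arcosh (le_of_lt h)]

theorem dprofile_invProfile {A : ℝ} (h : X.discr < A) (h' : A ≤ X.height) :
    X.dprofile (X.invProfile A) = -√(A ^ 2 - X.discr) := by
  cases X
  · have h0 : 0 ≤ line.invProfile A := neg_nonneg.2 (Real.log_nonpos (le_of_lt h) h')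
    rw [dprofile, if_pos h0]
    simp only [discr, invProfile] at *
    rw [neg_neg, Real.exp_log h, sub_zero, Real.sqrt_sq h.le]
  · rw [dprofile, perMod_invProfile h h', sub_right_comm, sub_self, zero_sub, Real.sinh_neg,
      Real.sinh_arcosh (le_of_lt h)]
    rfl

/-- Two peakons that satisfy the multipeakon system on `[0, T)` and collide at the time `T` at the
place `qT`, with total momentum `-W` in the limit, where the difference of the momenta blows up
like the power `-1/4` of the distance. -/
structure IsCollision (X : Domain) (T : ℝ) (q₁ q₂ p₁ p₂ : ℝ → ℝ) (W qT : ℝ) : Prop where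
  ordered : ∀ t ∈ Set.Ico 0 T, X.Ordered (q₁ t) (q₂ t)
  p₁_ne_zero : ∀ t ∈ Set.Ico 0 T, p₁ t ≠ 0
  p₂_ne_zero : ∀ t ∈ Set.Ico 0 T, p₂ t ≠ 0
  hasDerivAt_q₁ : ∀ t ∈ Set.Ico 0 T, HasDerivAt q₁
      ((p₁ t * X.height + p₂ t * X.profile (q₂ t - q₁ t)) ^ 2) t
  hasDerivAt_q₂ : ∀ t ∈ Set.Ico 0 T, HasDerivAt q₂
      ((p₁ t * X.profile (q₂ t - q₁ t) + p₂ t * X.height) ^ 2) t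
  hasDerivAt_p₁ : ∀ t ∈ Set.Ico 0 T, HasDerivAt p₁
      (p₁ t * (p₁ t * X.height + p₂ t * X.profile (q₂ t - q₁ t))
        * (p₂ t * X.dprofile (q₂ t - q₁ t))) t
  hasDerivAt_p₂ : ∀ t ∈ Set.Ico 0 T, HasDerivAt p₂
      (-(p₂ t * (p₁ t * X.profile (q₂ t - q₁ t) + p₂ t * X.height)
        * (p₁ t * X.dprofile (q₂ t - q₁ t)))) t
  tendsto_dist : Tendsto (fun t => q₂ t - q₁ t) (𝓝[<] T) (𝓝 0)
  tendsto_q₁ : Tendsto q₁ (𝓝[<] T) (𝓝 qT)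
  tendsto_add : Tendsto (fun t => p₁ t + p₂ t) (𝓝[<] T) (𝓝 (-W))
  tendsto_sub : ∃ L, 0 < L ∧
    Tendsto (fun t => (p₁ t - p₂ t) ^ 2 * √(q₂ t - q₁ t)) (𝓝[<] T) (𝓝 L)

/-- The value of the profile at the distance of the two peaks, in the collision parametrized by
`η`. -/
def gapValue (X : Domain) (k η : ℝ) : ℝ :=
  X.height * ((1 - (k * η ^ 2) ^ 2) / (1 + (k * η ^ 2) ^ 2))

/-- The sum of the momenta in the collision parametrized by `η`. -/
def sumMomenta (X : Domain) (H k η : ℝ) : ℝ := -(√(H - 2 * k ^ 2 * η ^ 2) / √X.height)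

/-- The difference of the momenta in the collision parametrized by `η`. -/
def diffMomenta (X : Domain) (H η : ℝ) : ℝ := -(√(H * η ^ 2 + 2) / (η * √X.height))

theorem continuous_gapValue (k : ℝ) : Continuous (X.gapValue k) := by
  unfold gapValue
  refine continuous_const.mul (Continuous.div (by fun_prop) (by fun_prop) fun x => ?_)
  positivity

/-- Together with the formula for `height + gapValue` this is the relation `(a - A)/(a + A) =
(kη²)²` that defines the parametrization. It turns `a² - A²` into a perfect square. -/
theorem height_sub_gapValue (k η : ℝ) :
    X.height - X.gapValue k η = 2 * X.height * (k * η ^ 2) ^ 2 / (1 + (k * η ^ 2) ^ 2) := by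
  have : (1 + (k * η ^ 2) ^ 2) ≠ 0 := by positivity
  rw [gapValue]
  field_simp
  ring

theorem height_add_gapValue (k η : ℝ) :
    X.height + X.gapValue k η = 2 * X.height / (1 + (k * η ^ 2) ^ 2) := by
  have : (1 + (k * η ^ 2) ^ 2) ≠ 0 := by positivity
  rw [gapValue]
  field_simp
  ring

theorem gapValue_lt {k η : ℝ} (hk : 0 < k) (hη : 0 < η) : X.gapValue k η < X.height := by
  rw [← sub_pos, height_sub_gapValue]
  have := X.height_pos
  positivity

theorem gapValue_le (k η : ℝ) : X.gapValue k η ≤ X.height := by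
  rw [← sub_nonneg, height_sub_gapValue]
  have := X.height_pos
  positivity

theorem hasDerivAt_gapValue (k η : ℝ) :
    HasDerivAt (X.gapValue k)
      (-(8 * X.height * k ^ 2 * η ^ 3 / (1 + (k * η ^ 2) ^ 2) ^ 2)) η := by
  have h0 : HasDerivAt (fun η : ℝ => (k * η ^ 2) ^ 2) (4 * k ^ 2 * η ^ 3) η := by
    refine ((((hasDerivAt_id η).pow 2).const_mul k).pow 2).congr_deriv ?_
    simp; ring
  have hne : (1 + (k * η ^ 2) ^ 2) ≠ 0 := by positivity
  refine (((h0.const_sub 1).div (h0.const_add 1) hne).const_mul X.height).congr_deriv ?_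
  field_simp
  ring

theorem hasDerivAt_sumMomenta {H k η : ℝ} (h : 0 < H - 2 * k ^ 2 * η ^ 2) :
    HasDerivAt (X.sumMomenta H k)
      (2 * k ^ 2 * η / (√(H - 2 * k ^ 2 * η ^ 2) * √X.height)) η := by
  have h0 : HasDerivAt (fun η : ℝ => H - 2 * k ^ 2 * η ^ 2) (-(4 * k ^ 2 * η)) η := by
    refine ((((hasDerivAt_id η).pow 2).const_mul (2 * k ^ 2)).const_sub H).congr_deriv ?_
    simp; ring
  refine (((h0.sqrt h.ne').div_const √X.height).neg).congr_deriv ?_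
  have := X.height_pos
  have : 0 < √X.height := Real.sqrt_pos.2 this
  have := Real.sqrt_pos.2 h
  field_simp
  ring

theorem hasDerivAt_diffMomenta {H η : ℝ} (hH : 0 < H) (hη : 0 < η) :
    HasDerivAt (X.diffMomenta H) (2 / (η ^ 2 * √(H * η ^ 2 + 2) * √X.height)) η := by
  have h : 0 < H * η ^ 2 + 2 := by positivity
  have h0 : HasDerivAt (fun η : ℝ => H * η ^ 2 + 2) (2 * H * η) η := by
    refine ((((hasDerivAt_id η).pow 2).const_mul H).add_const 2).congr_deriv ?_
    simp; ring
  have ha : 0 < √X.height := Real.sqrt_pos.2 X.height_pos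
  have hS := Real.sqrt_pos.2 h
  have h1 := (hasDerivAt_id η).mul_const √X.height
  refine (((h0.sqrt h.ne').div h1 (by simp only [id]; positivity)).neg).congr_deriv ?_
  have hS2 : √(H * η ^ 2 + 2) ^ 2 = H * η ^ 2 + 2 := Real.sq_sqrt h.le
  simp only [id]
  field_simp
  rw [hS2]
  ring

/-- The speed of the parameter `η` of the collision. -/
def paramSpeed (X : Domain) (H k η : ℝ) : ℝ :=
  √(X.gapValue k η ^ 2 - X.discr) / 2 * √(H * η ^ 2 + 2) * √(H - 2 * k ^ 2 * η ^ 2)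

theorem continuous_paramSpeed (H k : ℝ) : Continuous (X.paramSpeed H k) := by
  have := X.continuous_gapValue k
  unfold paramSpeed
  fun_prop

/-- The square root of the velocity of the left peak. -/
def leftHeight (X : Domain) (H k η : ℝ) : ℝ :=
  X.sumMomenta H k η * ((X.height + X.gapValue k η) / 2)
    - √(H * η ^ 2 + 2) * √X.height * k ^ 2 * η ^ 3 / (1 + (k * η ^ 2) ^ 2)

theorem continuous_leftHeight (H k : ℝ) : Continuous (X.leftHeight H k) := by
  have := X.continuous_gapValue k
  unfold leftHeight sumMomenta
  refine Continuous.sub (by fun_prop) (Continuous.div (by fun_prop) (by fun_prop) fun x => ?_)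
  positivity

/-- The difference of the momenta is singular like `1/η`, but it is multiplied by `height -
gapValue`, of order `η⁴`. The singularity cancels in `leftHeight`, so the velocity of the left peak
extends continuously to the collision. -/
theorem leftHeight_eq {H k η : ℝ} (hη : 0 < η) :
    X.leftHeight H k η = (X.sumMomenta H k η + X.diffMomenta H η) / 2 * X.height
      + (X.sumMomenta H k η - X.diffMomenta H η) / 2 * X.gapValue k η := by
  have ha : 0 < √X.height := Real.sqrt_pos.2 X.height_pos
  have ha2 : √X.height ^ 2 = X.height := Real.sq_sqrt X.height_pos.le
  have e : X.diffMomenta H η * (X.height - X.gapValue k η)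
      = -2 * (√(H * η ^ 2 + 2) * √X.height * k ^ 2 * η ^ 3 / (1 + (k * η ^ 2) ^ 2)) := by
    rw [height_sub_gapValue, diffMomenta]
    field_simp
    rw [ha2]
  rw [leftHeight]
  linear_combination (-1 / 2) * e

/-- The terms with `H` cancel in `w² - z²`. Multiplied by `√(a² - A²) = 2akη²/(1 + k²η⁴)`, the
product has constant modulus `k`: the second conserved quantity. -/
theorem prod_momenta {H k η : ℝ} (hH : 0 < H) (hη : 0 < η) (h : 0 < H - 2 * k ^ 2 * η ^ 2) :
    (X.sumMomenta H k η + X.diffMomenta H η) / 2 * ((X.sumMomenta H k η - X.diffMomenta H η) / 2)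
      = -((1 + (k * η ^ 2) ^ 2) / (2 * X.height * η ^ 2)) := by
  have ha : 0 < √X.height := Real.sqrt_pos.2 X.height_pos
  have hap := X.height_pos
  have ha2 : √X.height ^ 2 = X.height := Real.sq_sqrt X.height_pos.le
  have hS2 : √(H * η ^ 2 + 2) ^ 2 = H * η ^ 2 + 2 := Real.sq_sqrt (by positivity)
  have hR2 : √(H - 2 * k ^ 2 * η ^ 2) ^ 2 = H - 2 * k ^ 2 * η ^ 2 := Real.sq_sqrt h.le
  have e1 : X.sumMomenta H k η ^ 2 = (H - 2 * k ^ 2 * η ^ 2) / X.height := by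
    rw [sumMomenta, neg_sq, div_pow, hR2, ha2]
  have e2 : X.diffMomenta H η ^ 2 = (H * η ^ 2 + 2) / (η ^ 2 * X.height) := by
    rw [diffMomenta, neg_sq, div_pow, hS2, mul_pow, ha2]
  have : (X.sumMomenta H k η + X.diffMomenta H η) / 2
      * ((X.sumMomenta H k η - X.diffMomenta H η) / 2)
      = (X.sumMomenta H k η ^ 2 - X.diffMomenta H η ^ 2) / 4 := by ring
  rw [this, e1, e2]
  field_simp
  ring

/-- With `P = p₁p₂` and `B = √(A² - discr) = -E'(q)` the peakon system reads `w' = -PB(a - A)z`, `z'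
= -PB(a + A)w`, `q' = -wz(a² - A²)`. This lemma and the two that follow verify these equations by
the chain rule along `η' = -paramSpeed`; one and the same speed serves all three. -/
theorem sumMomenta_flow {H k η : ℝ} (hH : 0 < H) (hη : 0 < η) (h : 0 < H - 2 * k ^ 2 * η ^ 2) :
    2 * k ^ 2 * η / (√(H - 2 * k ^ 2 * η ^ 2) * √X.height) * -X.paramSpeed H k η
      = -((X.sumMomenta H k η + X.diffMomenta H η) / 2
          * ((X.sumMomenta H k η - X.diffMomenta H η) / 2)
        * √(X.gapValue k η ^ 2 - X.discr) * (X.height - X.gapValue k η)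
          * X.diffMomenta H η) := by
  have ha : 0 < √X.height := Real.sqrt_pos.2 X.height_pos
  have hap := X.height_pos
  have hR := Real.sqrt_pos.2 h
  rw [X.prod_momenta hH hη h, height_sub_gapValue, diffMomenta, paramSpeed]
  field_simp

theorem diffMomenta_flow {H k η : ℝ} (hH : 0 < H) (hη : 0 < η) (h : 0 < H - 2 * k ^ 2 * η ^ 2) :
    2 / (η ^ 2 * √(H * η ^ 2 + 2) * √X.height) * -X.paramSpeed H k η
      = -((X.sumMomenta H k η + X.diffMomenta H η) / 2
          * ((X.sumMomenta H k η - X.diffMomenta H η) / 2)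
        * √(X.gapValue k η ^ 2 - X.discr) * (X.height + X.gapValue k η)
          * X.sumMomenta H k η) := by
  have ha : 0 < √X.height := Real.sqrt_pos.2 X.height_pos
  have hap := X.height_pos
  have hS : 0 < √(H * η ^ 2 + 2) := Real.sqrt_pos.2 (by positivity)
  rw [X.prod_momenta hH hη h, height_add_gapValue, sumMomenta, paramSpeed]
  field_simp

theorem gap_flow {H k η : ℝ} (hη : 0 < η) (hA : X.discr < X.gapValue k η) :
    -(√(X.gapValue k η ^ 2 - X.discr))⁻¹
        * (-(8 * X.height * k ^ 2 * η ^ 3 / (1 + (k * η ^ 2) ^ 2) ^ 2) * -X.paramSpeed H k η)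
      = -(X.sumMomenta H k η * X.diffMomenta H η
        * ((X.height + X.gapValue k η) * (X.height - X.gapValue k η))) := by
  have ha : 0 < √X.height := Real.sqrt_pos.2 X.height_pos
  have hap := X.height_pos
  have ha2 : √X.height ^ 2 = X.height := Real.sq_sqrt X.height_pos.le
  have hB := Real.sqrt_pos.2 (sub_pos.2 (X.discr_lt_sq hA))
  rw [height_add_gapValue, height_sub_gapValue, sumMomenta, diffMomenta, paramSpeed]
  field_simp
  rw [ha2]
  ring

/-- The gap is asymptotically `(a - A)/slope`, of order `k²η⁴`, so its square root is of order
`kη²`. This cancels the factor `1/η²` of the squared difference of the momenta and leaves a positive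
limit: the rate of blow-up on which the exponent `5/4` depends. -/
theorem tendsto_diffMomenta_sq_mul {H k : ℝ} (hH : 0 < H) (hk : 0 < k) :
    ∃ L, 0 < L ∧ Tendsto (fun η => X.diffMomenta H η ^ 2 * √(X.invProfile (X.gapValue k η)))
      (𝓝[>] 0) (𝓝 L) := by
  have hap := X.height_pos
  have hsp := X.slope_pos
  have ha2 : √X.height ^ 2 = X.height := Real.sq_sqrt X.height_pos.le
  have hA : Tendsto (X.gapValue k) (𝓝[>] 0) (𝓝[≠] X.height) := by
    refine tendsto_nhdsWithin_of_tendsto_nhds_of_eventually_within _ ?_ ?_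
    · have := (X.continuous_gapValue k).tendsto 0
      rw [show X.gapValue k 0 = X.height by simp [gapValue]] at this
      exact this.mono_left nhdsWithin_le_nhds
    · filter_upwards [self_mem_nhdsWithin] with η hη
      exact (X.gapValue_lt hk hη).ne
  have hQ := (hasDerivAt_iff_tendsto_slope.1 (X.hasDerivAt_invProfile X.discr_lt_height)).comp hA
  rw [X.sqrt_height_sq] at hQ
  have hc : Tendsto (fun η : ℝ => (H * η ^ 2 + 2) * k / X.height *
      √(2 * X.height / (1 + (k * η ^ 2) ^ 2))) (𝓝[>] 0)
      (𝓝 ((H * 0 ^ 2 + 2) * k / X.height * √(2 * X.height / (1 + (k * 0 ^ 2) ^ 2)))) := by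
    have : Continuous fun η : ℝ => (H * η ^ 2 + 2) * k / X.height *
        √(2 * X.height / (1 + (k * η ^ 2) ^ 2)) := by
      refine Continuous.mul (by fun_prop) (Continuous.sqrt ?_)
      refine Continuous.div (by fun_prop) (by fun_prop) fun x => ?_
      positivity
    exact (this.tendsto 0).mono_left nhdsWithin_le_nhds
  have h := hc.mul (hQ.neg.sqrt)
  refine ⟨_, ?_, h.congr' ?_⟩
  · rw [neg_neg]
    positivity
  · filter_upwards [self_mem_nhdsWithin] with η hη
    have hη : 0 < η := hη
    have hlt := X.gapValue_lt hk hη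
    have hpos : 0 < X.height - X.gapValue k η := sub_pos.2 hlt
    have hS2 : √(H * η ^ 2 + 2) ^ 2 = H * η ^ 2 + 2 := Real.sq_sqrt (by positivity)
    have e2 : X.diffMomenta H η ^ 2 = (H * η ^ 2 + 2) / (η ^ 2 * X.height) := by
      rw [diffMomenta, neg_sq, div_pow, hS2, mul_pow, ha2]
    have e3 : -(_root_.slope X.invProfile X.height ∘ X.gapValue k) η
        = X.invProfile (X.gapValue k η) / (X.height - X.gapValue k η) := by
      simp only [Function.comp, slope_def_field, X.invProfile_height, sub_zero]
      rw [← neg_sub X.height, div_neg, neg_neg]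
    have e4 : X.invProfile (X.gapValue k η) = (k * η ^ 2) ^ 2 *
        (2 * X.height / (1 + (k * η ^ 2) ^ 2) *
          (X.invProfile (X.gapValue k η) / (X.height - X.gapValue k η))) := by
      have := X.height_sub_gapValue k η
      rw [eq_comm, ← mul_assoc, show (k * η ^ 2) ^ 2 * (2 * X.height / (1 + (k * η ^ 2) ^ 2))
        = X.height - X.gapValue k η by rw [this]; ring]
      field_simp
    rw [e3, e2]
    conv_rhs => rw [e4]
    rw [Real.sqrt_mul (by positivity), Real.sqrt_sq (by positivity), Real.sqrt_mul (by positivity)]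
    field_simp

/-- There are colliding peakons with prescribed parameters. -/
theorem exists_isCollision {H k η₀ : ℝ} (hH : 0 < H) (hk : 0 < k) (hη₀ : 0 < η₀)
    (hA : ∀ η ∈ Set.Icc 0 η₀, X.discr < X.gapValue k η)
    (hB : ∀ η ∈ Set.Icc 0 η₀, X.slope / 2 ≤ √(X.gapValue k η ^ 2 - X.discr))
    (hR : ∀ η ∈ Set.Icc 0 η₀, H / 2 ≤ H - 2 * k ^ 2 * η ^ 2) :
    ∃ (T : ℝ) (q₁ q₂ p₁ p₂ : ℝ → ℝ) (qT : ℝ), 0 < T ∧ T ≤ η₀ / (X.slope / 4 * √H) ∧ 0 < qT ∧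
      X.IsCollision T q₁ q₂ p₁ p₂ √(H / X.height) qT ∧
      (p₁ 0 + p₂ 0) ^ 2 ≤ H / X.height ∧
      p₁ 0 - p₂ 0 = X.diffMomenta H η₀ ∧
      q₂ 0 - q₁ 0 = X.invProfile (X.gapValue k η₀) := by
  have hap := X.height_pos
  have hsp := X.slope_pos
  have hsqH := Real.sqrt_pos.2 hH
  have ha2 : √X.height ^ 2 = X.height := Real.sq_sqrt X.height_pos.le
  have hsa : 0 < √X.height := Real.sqrt_pos.2 X.height_pos
  -- The bounds on the speed are known on `[0, η₀]` only. Clamping the argument makes them global,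
  -- and the solution up to time `T` never leaves the interval.
  set c : ℝ → ℝ := fun x => Set.projIcc 0 η₀ hη₀.le x with hc
  have hcc : Continuous c := continuous_subtype_val.comp continuous_projIcc
  have hcm : ∀ x, c x ∈ Set.Icc 0 η₀ := fun x => (Set.projIcc 0 η₀ hη₀.le x).2
  have hcid : ∀ x ∈ Set.Icc 0 η₀, c x = x := fun x hx => by
    simp only [hc, Set.projIcc_of_mem hη₀.le hx]
  -- The three factors of the speed are at least `slope/4`, `√2` and `√(H/2)`.
  have hgm : ∀ η ∈ Set.Icc 0 η₀, X.slope / 4 * √H ≤ X.paramSpeed H k η := by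
    intro η hη
    have h1 := hB η hη
    have h2 : √2 ≤ √(H * η ^ 2 + 2) := Real.sqrt_le_sqrt (by nlinarith [sq_nonneg η])
    have h3 : √(H / 2) ≤ √(H - 2 * k ^ 2 * η ^ 2) := Real.sqrt_le_sqrt (hR η hη)
    have h4 : √2 * √(H / 2) = √H := by
      rw [← Real.sqrt_mul (by norm_num)]; congr 1; ring
    calc X.slope / 4 * √H = X.slope / 2 / 2 * √2 * √(H / 2) := by rw [← h4]; ring
      _ ≤ _ := by unfold paramSpeed; gcongr
  obtain ⟨M, hM⟩ := (isCompact_Icc (a := (0 : ℝ)) (b := η₀)).exists_bound_of_continuousOn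
    (X.continuous_paramSpeed H k).continuousOn
  obtain ⟨T, η, hT, hTle, hη0, hηT, hanti, hηd⟩ := exists_descending_flow
    (g := fun x => X.paramSpeed H k (c x)) ((X.continuous_paramSpeed H k).comp hcc)
    (m := X.slope / 4 * √H) (M := M) (by positivity) (fun x => hgm _ (hcm x))
    (fun x => (le_abs_self _).trans (hM _ (hcm x))) hη₀
  have hηc : Continuous η := continuous_iff_continuousAt.2 fun t => (hηd t).continuousAt
  have hmem : ∀ t ∈ Set.Ico 0 T, 0 < η t ∧ η t ≤ η₀ := by
    intro t ht
    refine ⟨?_, ?_⟩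
    · rw [← hηT]; exact hanti ht.2
    · rw [← hη0]; exact hanti.antitone ht.1
  have hmem' : ∀ t ∈ Set.Ico 0 T, η t ∈ Set.Icc 0 η₀ := fun t ht => ⟨(hmem t ht).1.le, (hmem t ht).2⟩
  have hηd' : ∀ t ∈ Set.Ico 0 T, HasDerivAt η (-X.paramSpeed H k (η t)) t := by
    intro t ht
    have := hηd t
    rwa [hcid _ (hmem' t ht)] at this
  have hpos : ∀ t ∈ Set.Ico 0 T, 0 < H - 2 * k ^ 2 * η t ^ 2 := fun t ht =>
    (half_pos hH).trans_le (hR _ (hmem' t ht))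
  set w : ℝ → ℝ := fun t => X.sumMomenta H k (η t) with hw
  set z : ℝ → ℝ := fun t => X.diffMomenta H (η t) with hz
  set A : ℝ → ℝ := fun t => X.gapValue k (η t) with hAdef
  set B : ℝ → ℝ := fun t => √(X.gapValue k (η t) ^ 2 - X.discr) with hBdef
  have hwd : ∀ t ∈ Set.Ico 0 T, HasDerivAt w
      (-((w t + z t) / 2 * ((w t - z t) / 2) * B t * (X.height - A t) * z t)) t := by
    intro t ht
    rw [← X.sumMomenta_flow hH (hmem t ht).1 (hpos t ht)]
    exact (X.hasDerivAt_sumMomenta (hpos t ht)).comp t (hηd' t ht)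
  have hzd : ∀ t ∈ Set.Ico 0 T, HasDerivAt z
      (-((w t + z t) / 2 * ((w t - z t) / 2) * B t * (X.height + A t) * w t)) t := by
    intro t ht
    rw [← X.diffMomenta_flow hH (hmem t ht).1 (hpos t ht)]
    exact (X.hasDerivAt_diffMomenta hH (hmem t ht).1).comp t (hηd' t ht)
  set q : ℝ → ℝ := fun t => X.invProfile (A t) with hq
  have hqd : ∀ t ∈ Set.Ico 0 T, HasDerivAt q
      (-(w t * z t * ((X.height + A t) * (X.height - A t)))) t := by
    intro t ht
    rw [← X.gap_flow (H := H) (hmem t ht).1 (hA _ (hmem' t ht))]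
    exact (X.hasDerivAt_invProfile (hA _ (hmem' t ht))).comp t
      ((X.hasDerivAt_gapValue k (η t)).comp t (hηd' t ht))
  have hUc : Continuous fun t => X.leftHeight H k (η t) ^ 2 :=
    ((X.continuous_leftHeight H k).comp hηc).pow 2
  -- The left peak starts at `1` and moves to the right, which makes the place of the collision
  -- positive.
  set q₁ : ℝ → ℝ := fun t => 1 + ∫ τ in (0 : ℝ)..t, X.leftHeight H k (η τ) ^ 2 with hq₁
  have hq₁d : ∀ t, HasDerivAt q₁ (X.leftHeight H k (η t) ^ 2) t := fun t =>
    (hUc.integral_hasStrictDerivAt 0 t).hasDerivAt.const_add 1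
  have hq₁c : Continuous q₁ := continuous_iff_continuousAt.2 fun t => (hq₁d t).continuousAt
  have hpq : ∀ t, q₁ t + q t - q₁ t = q t := fun t => add_sub_cancel_left _ _
  have hprof : ∀ t ∈ Set.Ico 0 T, X.profile (q t) = A t := fun t ht =>
    X.profile_invProfile (hA _ (hmem' t ht)) (X.gapValue_le _ _)
  have hdprof : ∀ t ∈ Set.Ico 0 T, X.dprofile (q t) = -B t := fun t ht =>
    X.dprofile_invProfile (hA _ (hmem' t ht)) (X.gapValue_le _ _)
  have hUe : ∀ t ∈ Set.Ico 0 T, X.leftHeight H k (η t)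
      = (w t + z t) / 2 * X.height + (w t - z t) / 2 * A t := fun t ht =>
    X.leftHeight_eq (hmem t ht).1
  have hwneg : ∀ t ∈ Set.Ico 0 T, w t < 0 := fun t ht =>
    neg_neg_of_pos (div_pos (Real.sqrt_pos.2 (hpos t ht)) hsa)
  -- From `z < w < 0` follows `p₁ < 0 < p₂`, so neither momentum vanishes.
  have hzw : ∀ t ∈ Set.Ico 0 T, z t < w t := by
    intro t ht
    have h1 := (hmem t ht).1
    simp only [hw, hz, sumMomenta, diffMomenta]
    rw [neg_lt_neg_iff, div_lt_div_iff₀ hsa (by positivity), mul_comm (η t), mul_comm _ (√X.height * _),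
      mul_comm _ √X.height, mul_assoc]
    refine mul_lt_mul_of_pos_left ?_ hsa
    refine Real.lt_sqrt_of_sq_lt ?_
    rw [mul_pow, Real.sq_sqrt (hpos t ht).le]
    have : 0 ≤ η t ^ 2 * (2 * k ^ 2 * η t ^ 2) := by positivity
    linarith
  have hTmem : ∀ᶠ t in 𝓝[<] T, t ∈ Set.Ico 0 T := by
    filter_upwards [Ioo_mem_nhdsLT hT] with t ht
    exact ⟨ht.1.le, ht.2⟩
  have hηT0 : Tendsto η (𝓝[<] T) (𝓝[>] 0) := by
    refine tendsto_nhdsWithin_of_tendsto_nhds_of_eventually_within _ ?_ ?_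
    · rw [← hηT]
      exact hηc.continuousAt.mono_left nhdsWithin_le_nhds
    · filter_upwards [hTmem] with t ht
      exact (hmem t ht).1
  have hηT0' : Tendsto η (𝓝[<] T) (𝓝 0) := hηT0.mono_right nhdsWithin_le_nhds
  refine ⟨T, q₁, fun t => q₁ t + q t, fun t => (w t + z t) / 2, fun t => (w t - z t) / 2, q₁ T,
    hT, hTle, ?_, ⟨?_, ?_, ?_, ?_, ?_, ?_, ?_, ?_, ?_, ?_, ?_⟩, ?_, ?_, ?_⟩
  · have : 0 ≤ ∫ τ in (0 : ℝ)..T, X.leftHeight H k (η τ) ^ 2 :=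
      intervalIntegral.integral_nonneg hT.le fun τ _ => sq_nonneg _
    simp only [hq₁]
    linarith
  · intro t ht
    rw [← X.ordered_sub, hpq]
    exact X.ordered_invProfile (hA _ (hmem' t ht)) (X.gapValue_lt hk (hmem t ht).1)
  · intro t ht
    have := hwneg t ht
    have := hzw t ht
    linarith
  · intro t ht
    have := hzw t ht
    linarith
  · intro t ht
    simp only [hpq]
    rw [hprof t ht, ← hUe t ht]
    exact hq₁d t
  · intro t ht
    simp only [hpq]
    rw [hprof t ht]
    refine ((hq₁d t).add (hqd t ht)).congr_deriv ?_
    rw [hUe t ht]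
    ring
  · intro t ht
    simp only [hpq]
    rw [hprof t ht, hdprof t ht]
    refine (((hwd t ht).add (hzd t ht)).div_const 2).congr_deriv ?_
    ring
  · intro t ht
    simp only [hpq]
    rw [hprof t ht, hdprof t ht]
    refine (((hwd t ht).sub (hzd t ht)).div_const 2).congr_deriv ?_
    ring
  · simp only [hpq]
    have h1 : ContinuousAt X.invProfile X.height :=
      (X.hasDerivAt_invProfile X.discr_lt_height).continuousAt
    have h2 := ((X.continuous_gapValue k).tendsto 0).comp hηT0'
    rw [show X.gapValue k 0 = X.height by simp [gapValue]] at h2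
    have h3 := h1.tendsto.comp h2
    rwa [X.invProfile_height] at h3
  · exact hq₁c.continuousAt.mono_left nhdsWithin_le_nhds
  · have h1 : Continuous (X.sumMomenta H k) := by
      unfold sumMomenta
      fun_prop
    have h2 := (h1.tendsto 0).comp hηT0'
    have e : X.sumMomenta H k 0 = -√(H / X.height) := by
      rw [sumMomenta, Real.sqrt_div hH.le]
      simp
    rw [e] at h2
    refine h2.congr fun t => ?_
    simp only [hw, Function.comp]
    ring
  · obtain ⟨L, hL, h⟩ := X.tendsto_diffMomenta_sq_mul hH hk
    refine ⟨L, hL, (h.comp hηT0).congr fun t => ?_⟩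
    simp only [hpq, Function.comp]
    congr 2
    ring
  · have e : (w 0 + z 0) / 2 + (w 0 - z 0) / 2 = w 0 := by ring
    have h0 := hpos 0 ⟨le_rfl, hT⟩
    simp only [e]
    simp only [hw, sumMomenta]
    rw [neg_sq, div_pow, Real.sq_sqrt h0.le, ha2]
    gcongr
    have : 0 ≤ 2 * k ^ 2 * η 0 ^ 2 := by positivity
    linarith
  · have e : (w 0 + z 0) / 2 - (w 0 - z 0) / 2 = z 0 := by ring
    simp only [e]
    simp only [hz, hη0]
  · simp only [hpq]
    simp only [hq, hAdef, hη0]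

/-! ### Sobolev norms on the Fourier side -/

/-- The measure on the frequencies. -/
def freq : Domain → Measure ℝ
  | line => volume
  | circle => Measure.map (Int.cast : ℤ → ℝ) Measure.count

/-- The frequencies of the domain. -/
def IsFreq : Domain → ℝ → Prop
  | line, _ => True
  | circle, ξ => ∃ n : ℤ, ξ = n

theorem measurableEmbedding_intCast : MeasurableEmbedding (Int.cast : ℤ → ℝ) :=
  Int.isClosedEmbedding_coe_real.measurableEmbedding

theorem ae_isFreq : ∀ᵐ ξ ∂X.freq, X.IsFreq ξ := by
  cases X
  · exact Eventually.of_forall fun _ => trivial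
  · rw [freq, measurableEmbedding_intCast.ae_map_iff]
    exact Eventually.of_forall fun n => ⟨n, rfl⟩

/-- A sum over the integers is an integral for the counting measure pushed forward to `ℝ`;
thereafter one integral serves both domains. -/
theorem hsNorm_eq_lintegral (σ : ℝ) (f : ℝ → ℝ) :
    X.hsNorm σ f
      = (∫⁻ ξ, ENNReal.ofReal ((1 + ξ ^ 2) ^ σ * ‖X.fourier f ξ‖ ^ 2) ∂X.freq) ^ (1 / 2 : ℝ) := by
  cases X
  · rfl
  · rw [freq, measurableEmbedding_intCast.lintegral_map, lintegral_count]
    rfl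

theorem lintegral_weight_lt_top {ρ : ℝ} (hρ : ρ < -1 / 2) :
    ∫⁻ ξ, ENNReal.ofReal ((1 + ξ ^ 2) ^ ρ) ∂X.freq < ⊤ := by
  cases X
  · have h := integrable_rpow_neg_one_add_norm_sq (E := ℝ) (μ := volume) (r := -2 * ρ)
      (by simp only [Module.finrank_self, Nat.cast_one]; linarith)
    have e : (fun ξ : ℝ => (1 + ‖ξ‖ ^ 2) ^ (-(-2 * ρ) / 2)) = fun ξ : ℝ => (1 + ξ ^ 2) ^ ρ := by
      ext ξ
      rw [Real.norm_eq_abs, sq_abs]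
      congr 1
      ring
    rw [e] at h
    exact h.lintegral_lt_top
  · rw [freq, measurableEmbedding_intCast.lintegral_map, lintegral_count]
    have hs : Summable fun n : ℤ => (1 + (n : ℝ) ^ 2) ^ ρ := by
      refine Summable.of_norm_bounded_eventually
        (Real.summable_abs_int_rpow (b := -2 * ρ) (by linarith)) ?_
      rw [eventually_cofinite]
      refine (Set.finite_singleton (0 : ℤ)).subset fun n hn => ?_
      by_contra hne
      refine hn ?_
      have hn0 : (n : ℝ) ≠ 0 := by exact_mod_cast hne
      have hpos : 0 < |(n : ℝ)| := abs_pos.2 hn0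
      rw [Real.norm_eq_abs, abs_of_pos (by positivity),
        show -(-2 * ρ) = (2 : ℕ) * ρ by push_cast; ring, Real.rpow_mul hpos.le, Real.rpow_natCast,
        sq_abs]
      exact Real.rpow_le_rpow_of_nonpos (by positivity) (by linarith) (by linarith)
    exact hs.tsum_ofReal_lt_top

/-- The interval contains more than `R - 1` integers, and `R - 1 ≥ R/2` for `R ≥ 2`. -/
theorem le_freq_Icc {R : ℝ} (hR : 2 ≤ R) :
    ENNReal.ofReal (R / 2) ≤ X.freq (Set.Icc R (2 * R)) := by
  cases X
  · rw [freq, Real.volume_Icc]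
    exact ENNReal.ofReal_le_ofReal (by linarith)
  · rw [freq, measurableEmbedding_intCast.map_apply]
    have hsub : (Finset.Icc ⌈R⌉ ⌊2 * R⌋ : Set ℤ) ⊆ (Int.cast : ℤ → ℝ) ⁻¹' Set.Icc R (2 * R) := by
      intro n hn
      rw [Finset.coe_Icc] at hn
      exact ⟨Int.ceil_le.1 hn.1, Int.le_floor.1 hn.2⟩
    refine le_trans ?_ (measure_mono hsub)
    rw [Measure.count_apply_finset, Int.card_Icc]
    have h1 := Int.ceil_lt_add_one R
    have h2 := Int.sub_one_lt_floor (2 * R)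
    rw [← ENNReal.ofReal_natCast]
    refine ENNReal.ofReal_le_ofReal ?_
    have h3 : ((⌊2 * R⌋ + 1 - ⌈R⌉ : ℤ) : ℝ) ≤ (((⌊2 * R⌋ + 1 - ⌈R⌉).toNat : ℤ) : ℝ) := by
      exact_mod_cast Int.self_le_toNat _
    push_cast at h3
    have h4 : (((⌊2 * R⌋ + 1 - ⌈R⌉).toNat : ℤ) : ℝ) = ((⌊2 * R⌋ + 1 - ⌈R⌉).toNat : ℝ) := by
      push_cast; rfl
    push_cast at h3 h4
    linarith

/-- The character `e^{-iξx}`. -/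
def expo (ξ x : ℝ) : ℂ := (Real.cos (ξ * x) : ℂ) - Complex.I * (Real.sin (ξ * x) : ℂ)

theorem exp_eq_expo (ξ x : ℝ) :
    Complex.exp (-(Complex.I * (ξ : ℂ) * (x : ℂ))) = expo ξ x := by
  rw [show -(Complex.I * (ξ : ℂ) * (x : ℂ)) = ((-(ξ * x) : ℝ) : ℂ) * Complex.I by push_cast; ring,
    Complex.exp_mul_I, expo, ← Complex.ofReal_cos, ← Complex.ofReal_sin, Real.cos_neg,
    Real.sin_neg]
  push_cast
  ring

theorem norm_expo (ξ x : ℝ) : ‖expo ξ x‖ = 1 := by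
  rw [← exp_eq_expo, Complex.norm_exp]
  simp

theorem continuous_expo_right (ξ : ℝ) : Continuous (expo ξ) := by
  unfold expo
  fun_prop

theorem isFun_cos {ξ : ℝ} (h : X.IsFreq ξ) : X.IsFun fun x => Real.cos (ξ * x) := by
  cases X
  · trivial
  · obtain ⟨n, rfl⟩ := h
    intro x
    simp only
    rw [mul_add, Real.cos_add_int_mul_two_pi]

theorem isFun_sin {ξ : ℝ} (h : X.IsFreq ξ) : X.IsFun fun x => Real.sin (ξ * x) := by
  cases X
  · trivial
  · obtain ⟨n, rfl⟩ := h
    intro x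
    simp only
    rw [mul_add, Real.sin_add_int_mul_two_pi]

theorem hasDerivAt_cos_mul (ξ x : ℝ) :
    HasDerivAt (fun x => Real.cos (ξ * x)) (-ξ * Real.sin (ξ * x)) x := by
  refine (((hasDerivAt_id x).const_mul ξ).cos).congr_deriv ?_
  simp only [id]
  ring

theorem hasDerivAt_sin_mul (ξ x : ℝ) :
    HasDerivAt (fun x => Real.sin (ξ * x)) (ξ * Real.cos (ξ * x)) x := by
  refine (((hasDerivAt_id x).const_mul ξ).sin).congr_deriv ?_
  simp only [id]
  ring

theorem abs_const_mul_le {c y : ℝ} (hy : |y| ≤ 1) : |c * y| ≤ |c| := by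
  rw [abs_mul]
  exact mul_le_of_le_one_right (abs_nonneg _) hy

/-- The cosine is an eigenfunction of `1 - ∂²` with eigenvalue `1 + ξ²`, so the fundamental solution
property evaluates the integral. On the circle the frequency has to be an integer for the cosine to
be periodic. -/
theorem integral_profile_cos {ξ : ℝ} (h : X.IsFreq ξ) (a : ℝ) :
    ∫ x, X.profile (x - a) * Real.cos (ξ * x) ∂X.meas
      = 2 * X.slope / (1 + ξ ^ 2) * Real.cos (ξ * a) := by
  have key := X.integral_profile_sub_deriv2 (hasDerivAt_cos_mul ξ)
    (φ₂ := fun x => -ξ ^ 2 * Real.cos (ξ * x))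
    (fun x => ((hasDerivAt_sin_mul ξ x).const_mul (-ξ)).congr_deriv (by ring)) (by fun_prop)
    (X.isFun_cos h) ((X.isFun_const _).mul (X.isFun_sin h)) ((X.isFun_const _).mul (X.isFun_cos h))
    (C := max 1 (max |-ξ| |-ξ ^ 2|)) (fun x => (Real.abs_cos_le_one _).trans (le_max_left _ _))
    (fun x => (abs_const_mul_le (Real.abs_sin_le_one _)).trans
      ((le_max_left _ _).trans (le_max_right _ _)))
    (fun x => (abs_const_mul_le (Real.abs_cos_le_one _)).trans
      ((le_max_right _ _).trans (le_max_right _ _))) a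
  have e : ∀ y, X.profile (y - a) * (Real.cos (ξ * y) - -ξ ^ 2 * Real.cos (ξ * y))
      = (1 + ξ ^ 2) * (X.profile (y - a) * Real.cos (ξ * y)) := fun y => by ring
  simp_rw [e] at key
  rw [integral_const_mul] at key
  have : 0 < 1 + ξ ^ 2 := by positivity
  rw [div_mul_eq_mul_div, eq_div_iff this.ne', ← key]
  ring

theorem integral_profile_sin {ξ : ℝ} (h : X.IsFreq ξ) (a : ℝ) :
    ∫ x, X.profile (x - a) * Real.sin (ξ * x) ∂X.meas
      = 2 * X.slope / (1 + ξ ^ 2) * Real.sin (ξ * a) := by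
  have key := X.integral_profile_sub_deriv2 (hasDerivAt_sin_mul ξ)
    (φ₂ := fun x => -ξ ^ 2 * Real.sin (ξ * x))
    (fun x => ((hasDerivAt_cos_mul ξ x).const_mul ξ).congr_deriv (by ring)) (by fun_prop)
    (X.isFun_sin h) ((X.isFun_const _).mul (X.isFun_cos h)) ((X.isFun_const _).mul (X.isFun_sin h))
    (C := max 1 (max |ξ| |-ξ ^ 2|)) (fun x => (Real.abs_sin_le_one _).trans (le_max_left _ _))
    (fun x => (abs_const_mul_le (Real.abs_cos_le_one _)).trans
      ((le_max_left _ _).trans (le_max_right _ _)))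
    (fun x => (abs_const_mul_le (Real.abs_sin_le_one _)).trans
      ((le_max_right _ _).trans (le_max_right _ _))) a
  have e : ∀ y, X.profile (y - a) * (Real.sin (ξ * y) - -ξ ^ 2 * Real.sin (ξ * y))
      = (1 + ξ ^ 2) * (X.profile (y - a) * Real.sin (ξ * y)) := fun y => by ring
  simp_rw [e] at key
  rw [integral_const_mul] at key
  have : 0 < 1 + ξ ^ 2 := by positivity
  rw [div_mul_eq_mul_div, eq_div_iff this.ne', ← key]
  ring

/-- `f` is an integrable function with Fourier transform `2 s c(ξ) / (1 + ξ²)`, where `s` is the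
slope of the profile. -/
structure HasAmplitude (f : ℝ → ℝ) (c : ℝ → ℂ) : Prop where
  isFun : X.IsFun f
  integrable : Integrable f X.meas
  continuous : Continuous c
  fourier_eq : ∀ ξ, X.IsFreq ξ → X.fourier f ξ = ((2 * X.slope / (1 + ξ ^ 2) : ℝ) : ℂ) * c ξ

theorem fourier_profile {ξ : ℝ} (hξ : X.IsFreq ξ) (a : ℝ) :
    X.fourier (fun x => X.profile (x - a)) ξ
      = ((2 * X.slope / (1 + ξ ^ 2) : ℝ) : ℂ) * expo ξ a := by
  have i1 : Integrable (fun x => X.profile (x - a) * Real.cos (ξ * x)) X.meas :=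
    integrable_mul_bounded (X.integrable_profile a) (by fun_prop) (C := 1)
      fun x => Real.abs_cos_le_one _
  have i2 : Integrable (fun x => X.profile (x - a) * Real.sin (ξ * x)) X.meas :=
    integrable_mul_bounded (X.integrable_profile a) (by fun_prop) (C := 1)
      fun x => Real.abs_sin_le_one _
  have j1 : Integrable (fun x => ((X.profile (x - a) * Real.cos (ξ * x) : ℝ) : ℂ)) X.meas :=
    i1.ofReal
  have j2 : Integrable (fun x => Complex.I * ((X.profile (x - a) * Real.sin (ξ * x) : ℝ) : ℂ))
      X.meas := Integrable.const_mul i2.ofReal Complex.I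
  have e : ∀ x : ℝ, Complex.exp (-(Complex.I * (ξ : ℂ) * (x : ℂ))) * (X.profile (x - a) : ℂ)
      = ((X.profile (x - a) * Real.cos (ξ * x) : ℝ) : ℂ)
        - Complex.I * ((X.profile (x - a) * Real.sin (ξ * x) : ℝ) : ℂ) := by
    intro x
    rw [exp_eq_expo, expo]
    push_cast
    ring
  rw [fourier, integral_congr_ae (Eventually.of_forall e), integral_sub j1 j2,
    integral_const_mul, integral_complex_ofReal, integral_complex_ofReal,
    X.integral_profile_cos hξ, X.integral_profile_sin hξ, expo]
  push_cast
  ring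

theorem continuous_expo_left (a : ℝ) : Continuous fun ξ => expo ξ a := by
  unfold expo
  fun_prop

theorem hasAmplitude_profile (a : ℝ) :
    X.HasAmplitude (fun x => X.profile (x - a)) (fun ξ => expo ξ a) where
  isFun := X.isFun_profile a
  integrable := X.integrable_profile a
  continuous := continuous_expo_left a
  fourier_eq _ hξ := X.fourier_profile hξ a

theorem integrable_expo_mul {f : ℝ → ℝ} (hf : Integrable f X.meas) (ξ : ℝ) :
    Integrable (fun x : ℝ => Complex.exp (-(Complex.I * (ξ : ℂ) * (x : ℂ))) * (f x : ℂ)) X.meas := by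
  refine hf.ofReal.bdd_mul (c := 1) (by fun_prop) (Eventually.of_forall fun x => ?_)
  rw [exp_eq_expo, norm_expo]

variable {X}

theorem HasAmplitude.add {f g : ℝ → ℝ} {c d : ℝ → ℂ} (hf : X.HasAmplitude f c)
    (hg : X.HasAmplitude g d) : X.HasAmplitude (fun x => f x + g x) (fun ξ => c ξ + d ξ) where
  isFun := hf.isFun.add hg.isFun
  integrable := hf.integrable.add hg.integrable
  continuous := hf.continuous.add hg.continuous
  fourier_eq ξ hξ := by
    rw [mul_add, ← hf.fourier_eq ξ hξ, ← hg.fourier_eq ξ hξ, fourier, fourier, fourier,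
      ← integral_add (X.integrable_expo_mul hf.integrable ξ) (X.integrable_expo_mul hg.integrable ξ)]
    congr 1
    ext x
    push_cast
    ring

theorem HasAmplitude.const_mul {f : ℝ → ℝ} {c : ℝ → ℂ} (hf : X.HasAmplitude f c) (r : ℝ) :
    X.HasAmplitude (fun x => r * f x) (fun ξ => r * c ξ) where
  isFun := (X.isFun_const r).mul hf.isFun
  integrable := hf.integrable.const_mul r
  continuous := hf.continuous.const_mul _
  fourier_eq ξ hξ := by
    rw [mul_left_comm, ← hf.fourier_eq ξ hξ, fourier, fourier, ← integral_const_mul]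
    congr 1
    ext x
    push_cast
    ring

theorem HasAmplitude.sub {f g : ℝ → ℝ} {c d : ℝ → ℂ} (hf : X.HasAmplitude f c)
    (hg : X.HasAmplitude g d) : X.HasAmplitude (f - g) (fun ξ => c ξ - d ξ) := by
  have h := hf.add (hg.const_mul (-1))
  have e1 : (fun x => f x + -1 * g x) = f - g := by
    ext x
    simp [sub_eq_add_neg]
  have e2 : (fun ξ => c ξ + ((-1 : ℝ) : ℂ) * d ξ) = fun ξ => c ξ - d ξ := by
    ext ξ
    push_cast
    ring
  rwa [e1, e2] at h

theorem HasAmplitude.hsNorm_eq {f : ℝ → ℝ} {c : ℝ → ℂ} (hf : X.HasAmplitude f c) (σ : ℝ) :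
    X.hsNorm σ f = (∫⁻ ξ, ENNReal.ofReal
      (4 * X.slope ^ 2 * (1 + ξ ^ 2) ^ (σ - 2) * ‖c ξ‖ ^ 2) ∂X.freq) ^ (1 / 2 : ℝ) := by
  rw [hsNorm_eq_lintegral]
  congr 1
  refine lintegral_congr_ae ?_
  filter_upwards [X.ae_isFreq] with ξ hξ
  have hp : 0 < 1 + ξ ^ 2 := by positivity
  rw [hf.fourier_eq ξ hξ, norm_mul, Complex.norm_real, Real.norm_eq_abs, mul_pow, sq_abs,
    Real.rpow_sub hp, show (2 : ℝ) = ((2 : ℕ) : ℝ) by norm_num, Real.rpow_natCast]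
  congr 1
  push_cast
  field_simp
  ring

/-- As a weighted `L²` norm of the amplitude, the Sobolev norm inherits Minkowski's inequality. -/
theorem HasAmplitude.hsNorm_eq_eLpNorm {f : ℝ → ℝ} {c : ℝ → ℂ} (hf : X.HasAmplitude f c) (σ : ℝ) :
    X.hsNorm σ f = eLpNorm
      (fun ξ => ((2 * X.slope * (1 + ξ ^ 2) ^ (σ / 2 - 1) : ℝ) : ℂ) * c ξ) 2 X.freq := by
  rw [hf.hsNorm_eq, eLpNorm_eq_lintegral_rpow_enorm_toReal (by norm_num) (by norm_num)]
  congr 1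
  refine lintegral_congr fun ξ => ?_
  have hp : 0 < 1 + ξ ^ 2 := by positivity
  rw [show (2 : ℝ≥0∞).toReal = ((2 : ℕ) : ℝ) by simp, ENNReal.rpow_natCast, ← ofReal_norm,
    ← ENNReal.ofReal_pow (norm_nonneg _), norm_mul, Complex.norm_real, Real.norm_eq_abs, mul_pow,
    sq_abs, mul_pow, ← Real.rpow_natCast (_ ^ _), ← Real.rpow_mul hp.le]
  congr 2
  rw [show (σ / 2 - 1) * ((2 : ℕ) : ℝ) = σ - 2 by push_cast; ring]
  ring

theorem HasAmplitude.hsNorm_le_add {f g : ℝ → ℝ} {c d : ℝ → ℂ} (hf : X.HasAmplitude f c)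
    (hg : X.HasAmplitude g d) (σ : ℝ) :
    X.hsNorm σ f ≤ X.hsNorm σ (f - g) + X.hsNorm σ g ∧
      X.hsNorm σ g ≤ X.hsNorm σ (f - g) + X.hsNorm σ f := by
  have hm : Continuous fun ξ : ℝ => ((2 * X.slope * (1 + ξ ^ 2) ^ (σ / 2 - 1) : ℝ) : ℂ) := by
    refine Complex.continuous_ofReal.comp (continuous_const.mul ?_)
    exact Continuous.rpow_const (by fun_prop) fun x => Or.inl (by positivity)
  have mf := (hm.mul hf.continuous).aestronglyMeasurable (μ := X.freq)
  have mg := (hm.mul hg.continuous).aestronglyMeasurable (μ := X.freq)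
  have ms := (hm.mul (hf.sub hg).continuous).aestronglyMeasurable (μ := X.freq)
  rw [hf.hsNorm_eq_eLpNorm, hg.hsNorm_eq_eLpNorm, (hf.sub hg).hsNorm_eq_eLpNorm]
  constructor
  · refine le_trans (le_of_eq ?_) (eLpNorm_add_le ms mg (by norm_num))
    congr 1
    ext ξ
    simp only [Pi.add_apply]
    ring
  · rw [add_comm]
    refine le_trans (le_of_eq ?_) (eLpNorm_sub_le (p := 2) mf ms (by norm_num))
    congr 1
    ext ξ
    simp only [Pi.sub_apply]
    ring

/-- The integral of the weight `(1 + ξ²)^ρ`. -/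
def weightIntegral (X : Domain) (ρ : ℝ) : ℝ :=
  (∫⁻ ξ, ENNReal.ofReal ((1 + ξ ^ 2) ^ ρ) ∂X.freq).toReal

theorem weightIntegral_nonneg (ρ : ℝ) : 0 ≤ X.weightIntegral ρ := ENNReal.toReal_nonneg

theorem measurable_weight (ρ : ℝ) : Measurable fun ξ : ℝ => (1 + ξ ^ 2) ^ ρ :=
  (Continuous.rpow_const (by fun_prop) fun x => Or.inl (by positivity)).measurable

theorem lintegral_dominant {σ θ : ℝ} (h : σ + θ < 3 / 2) {K : ℝ} (hK : 0 ≤ K) :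
    ∫⁻ ξ, ENNReal.ofReal (4 * X.slope ^ 2 * K * (1 + ξ ^ 2) ^ (σ - 2 + θ)) ∂X.freq
      = ENNReal.ofReal (4 * X.slope ^ 2 * K * X.weightIntegral (σ - 2 + θ)) := by
  have hC : 0 ≤ 4 * X.slope ^ 2 * K := by positivity
  simp_rw [ENNReal.ofReal_mul hC]
  rw [lintegral_const_mul _ (measurable_weight _).ennreal_ofReal, weightIntegral,
    ENNReal.ofReal_toReal (X.lintegral_weight_lt_top (by linarith)).ne]

theorem amplitude_le_dominant {σ θ K ξ : ℝ} {c : ℂ} (h : ‖c‖ ^ 2 ≤ K * (1 + ξ ^ 2) ^ θ) :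
    ENNReal.ofReal (4 * X.slope ^ 2 * (1 + ξ ^ 2) ^ (σ - 2) * ‖c‖ ^ 2)
      ≤ ENNReal.ofReal (4 * X.slope ^ 2 * K * (1 + ξ ^ 2) ^ (σ - 2 + θ)) := by
  have hp : 0 < 1 + ξ ^ 2 := by positivity
  refine ENNReal.ofReal_le_ofReal ?_
  rw [Real.rpow_add hp]
  calc _ ≤ 4 * X.slope ^ 2 * (1 + ξ ^ 2) ^ (σ - 2) * (K * (1 + ξ ^ 2) ^ θ) := by gcongr
    _ = _ := by ring

/-- The factor `1/(1+ξ²)` of the transform lowers the exponent by `2`, and growth of the squared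
amplitude raises it by `θ`. The resulting weight is integrable since `σ - 2 + θ < -1/2`. -/
theorem HasAmplitude.hsNorm_le {f : ℝ → ℝ} {c : ℝ → ℂ} (hf : X.HasAmplitude f c) {σ θ K : ℝ}
    (h : σ + θ < 3 / 2) (hK : 0 ≤ K) (hc : ∀ ξ, ‖c ξ‖ ^ 2 ≤ K * (1 + ξ ^ 2) ^ θ) :
    X.hsNorm σ f ≤ ENNReal.ofReal √(4 * X.slope ^ 2 * K * X.weightIntegral (σ - 2 + θ)) := by
  have hW := X.weightIntegral_nonneg (σ - 2 + θ)
  rw [hf.hsNorm_eq, Real.sqrt_eq_rpow, ← ENNReal.ofReal_rpow_of_nonneg (by positivity) (by norm_num),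
    ← lintegral_dominant h hK]
  exact ENNReal.rpow_le_rpow (lintegral_mono fun ξ => amplitude_le_dominant (hc ξ)) (by norm_num)

theorem HasAmplitude.memHs {f : ℝ → ℝ} {c : ℝ → ℂ} (hf : X.HasAmplitude f c) {σ K : ℝ}
    (h : σ < 3 / 2) (hK : 0 ≤ K) (hc : ∀ ξ, ‖c ξ‖ ^ 2 ≤ K) : X.MemHs σ f :=
  ⟨hf.isFun, hf.integrable, (hf.hsNorm_le (θ := 0) (by linarith) hK fun ξ => by
    simpa using hc ξ).trans_lt ENNReal.ofReal_lt_top⟩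

/-- Dominated convergence in the frequency variable, with a power of `1 + ξ²` as the dominating
function. -/
theorem tendsto_hsNorm_zero {ι : Type*} {l : Filter ι} [l.IsCountablyGenerated] {f : ι → ℝ → ℝ}
    {c : ι → ℝ → ℂ} (hf : ∀ᶠ t in l, X.HasAmplitude (f t) (c t)) {σ θ K : ℝ} (h : σ + θ < 3 / 2)
    (hK : 0 ≤ K) (hc : ∀ᶠ t in l, ∀ ξ, ‖c t ξ‖ ^ 2 ≤ K * (1 + ξ ^ 2) ^ θ)
    (hlim : ∀ ξ, Tendsto (fun t => c t ξ) l (𝓝 0)) :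
    Tendsto (fun t => X.hsNorm σ (f t)) l (𝓝 0) := by
  have key := tendsto_lintegral_filter_of_dominated_convergence (μ := X.freq) (l := l)
    (F := fun t ξ => ENNReal.ofReal (4 * X.slope ^ 2 * (1 + ξ ^ 2) ^ (σ - 2) * ‖c t ξ‖ ^ 2))
    (f := fun _ => 0)
    (fun ξ => ENNReal.ofReal (4 * X.slope ^ 2 * K * (1 + ξ ^ 2) ^ (σ - 2 + θ))) ?_ ?_ ?_ ?_
  · rw [lintegral_zero] at key
    have key' := (ENNReal.continuous_rpow_const (y := 1 / 2)).tendsto 0 |>.comp key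
    rw [ENNReal.zero_rpow_of_pos (by norm_num)] at key'
    refine key'.congr' ?_
    filter_upwards [hf] with t ht
    rw [ht.hsNorm_eq]
    rfl
  · filter_upwards [hf] with t ht
    exact ((measurable_const.mul (measurable_weight _)).mul
      (ht.continuous.norm.pow 2).measurable).ennreal_ofReal
  · filter_upwards [hc] with t ht
    exact Eventually.of_forall fun ξ => amplitude_le_dominant (ht ξ)
  · rw [lintegral_dominant h hK]
    exact ENNReal.ofReal_ne_top
  · refine Eventually.of_forall fun ξ => ?_
    have := ((hlim ξ).norm.pow 2).const_mul (4 * X.slope ^ 2 * (1 + ξ ^ 2) ^ (σ - 2))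
    rw [norm_zero, zero_pow two_ne_zero, mul_zero] at this
    have h2 := ENNReal.tendsto_ofReal this
    rwa [ENNReal.ofReal_zero] at h2

/-- Only the frequencies in `[R, 2R]` are kept; as `σ ≤ 2`, the weight is smallest at the right end.
-/
theorem HasAmplitude.le_hsNorm {f : ℝ → ℝ} {c : ℝ → ℂ} (hf : X.HasAmplitude f c) {σ R m : ℝ}
    (hσ : σ ≤ 2) (hR : 2 ≤ R) (hm : 0 ≤ m) (hc : ∀ ξ ∈ Set.Icc R (2 * R), m ≤ ‖c ξ‖ ^ 2) :
    ENNReal.ofReal √(4 * X.slope ^ 2 * (1 + (2 * R) ^ 2) ^ (σ - 2) * m * (R / 2))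
      ≤ X.hsNorm σ f := by
  rw [hf.hsNorm_eq, Real.sqrt_eq_rpow, ← ENNReal.ofReal_rpow_of_nonneg (by positivity) (by norm_num)]
  refine ENNReal.rpow_le_rpow ?_ (by norm_num)
  refine le_trans ?_ (setLIntegral_le_lintegral (Set.Icc R (2 * R)) _)
  calc _ ≤ ENNReal.ofReal (4 * X.slope ^ 2 * (1 + (2 * R) ^ 2) ^ (σ - 2) * m)
        * X.freq (Set.Icc R (2 * R)) := by
        rw [ENNReal.ofReal_mul (by positivity)]
        gcongr
        exact X.le_freq_Icc hR
    _ = ∫⁻ _ in Set.Icc R (2 * R),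
        ENNReal.ofReal (4 * X.slope ^ 2 * (1 + (2 * R) ^ 2) ^ (σ - 2) * m) ∂X.freq := by
        rw [setLIntegral_const]
    _ ≤ _ := by
        refine setLIntegral_mono' measurableSet_Icc fun ξ hξ => ENNReal.ofReal_le_ofReal ?_
        have h1 := hc ξ hξ
        have h2 : (1 + (2 * R) ^ 2) ^ (σ - 2) ≤ (1 + ξ ^ 2) ^ (σ - 2) := by
          refine Real.rpow_le_rpow_of_nonpos (by positivity) ?_ (by linarith)
          have : ξ ^ 2 ≤ (2 * R) ^ 2 := pow_le_pow_left₀ (by linarith [hξ.1]) hξ.2 2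
          linarith
        gcongr

/-- The amplitude of two peakons. -/
def peaksAmp (a b P₁ P₂ ξ : ℝ) : ℂ := P₁ * expo ξ a + P₂ * expo ξ b

variable (X) in
theorem hasAmplitude_peaks (a b P₁ P₂ : ℝ) :
    X.HasAmplitude (X.peaks a b P₁ P₂) (peaksAmp a b P₁ P₂) :=
  ((X.hasAmplitude_profile a).const_mul P₁).add ((X.hasAmplitude_profile b).const_mul P₂)

/-- Seen from the midpoint of the peaks, `P₁e^{iy} + P₂e^{-iy} = (P₁ + P₂) cos y + i(P₁ - P₂) sin y`
with `y = ξ(b - a)/2`. The singular difference of the momenta thus comes with a sine that is small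
at frequencies below the inverse gap. -/
theorem norm_peaksAmp_sq (a b P₁ P₂ ξ : ℝ) : ‖peaksAmp a b P₁ P₂ ξ‖ ^ 2
    = (P₁ + P₂) ^ 2 * Real.cos (ξ * (b - a) / 2) ^ 2
      + (P₁ - P₂) ^ 2 * Real.sin (ξ * (b - a) / 2) ^ 2 := by
  have e : peaksAmp a b P₁ P₂ ξ = ((P₁ * Real.cos (ξ * a) + P₂ * Real.cos (ξ * b) : ℝ) : ℂ)
      + ((-(P₁ * Real.sin (ξ * a) + P₂ * Real.sin (ξ * b)) : ℝ) : ℂ) * Complex.I := by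
    simp only [peaksAmp, expo]
    push_cast
    ring
  rw [e, Complex.sq_norm, Complex.normSq_add_mul_I]
  have h1 : Real.cos (ξ * b) * Real.cos (ξ * a) + Real.sin (ξ * b) * Real.sin (ξ * a)
      = 2 * Real.cos (ξ * (b - a) / 2) ^ 2 - 1 := by
    rw [← Real.cos_sub, ← Real.cos_two_mul]
    congr 1
    ring
  have h2 := Real.sin_sq_add_cos_sq (ξ * a)
  have h3 := Real.sin_sq_add_cos_sq (ξ * b)
  have h4 := Real.sin_sq_add_cos_sq (ξ * (b - a) / 2)
  linear_combination 2 * P₁ * P₂ * h1 + P₁ ^ 2 * h2 + P₂ ^ 2 * h3 - (P₁ - P₂) ^ 2 * h4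

/-- Interpolation: a number in `[0, 1]` is at most its power `θ`, and `sin² y ≤ y²`. -/
theorem sin_sq_le {ξ q θ : ℝ} (hq : 0 ≤ q) (hθ : 0 ≤ θ) (hθ' : θ ≤ 1) :
    Real.sin (ξ * q / 2) ^ 2 ≤ q ^ (2 * θ) * (1 + ξ ^ 2) ^ θ := by
  have h1 : Real.sin (ξ * q / 2) ^ 2 ≤ (Real.sin (ξ * q / 2) ^ 2) ^ θ := by
    rcases eq_or_lt_of_le (sq_nonneg (Real.sin (ξ * q / 2))) with h | h
    · rw [← h]; positivity
    · have := Real.rpow_le_rpow_of_exponent_ge h (Real.sin_sq_le_one _) hθ'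
      rwa [Real.rpow_one] at this
  have h2 : Real.sin (ξ * q / 2) ^ 2 ≤ q ^ 2 * (1 + ξ ^ 2) := by
    have := Real.abs_sin_le_abs (x := ξ * q / 2)
    have := sq_le_sq.2 this
    have : 0 ≤ q ^ 2 * ξ ^ 2 := by positivity
    nlinarith [sq_nonneg q]
  calc _ ≤ _ := h1
    _ ≤ (q ^ 2 * (1 + ξ ^ 2)) ^ θ := Real.rpow_le_rpow (sq_nonneg _) h2 hθ
    _ = _ := by
      rw [Real.mul_rpow (by positivity) (by positivity), ← Real.rpow_natCast q 2,
        ← Real.rpow_mul hq]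
      norm_num

theorem norm_peaksAmp_sq_le {a b P₁ P₂ ξ θ : ℝ} (hab : a ≤ b) (hθ : 0 ≤ θ) (hθ' : θ ≤ 1) :
    ‖peaksAmp a b P₁ P₂ ξ‖ ^ 2
      ≤ ((P₁ + P₂) ^ 2 + (P₁ - P₂) ^ 2 * (b - a) ^ (2 * θ)) * (1 + ξ ^ 2) ^ θ := by
  rw [norm_peaksAmp_sq, add_mul]
  have h1 := Real.cos_sq_le_one (ξ * (b - a) / 2)
  have h2 := sin_sq_le (ξ := ξ) (sub_nonneg.2 hab) hθ hθ'
  have h3 : (1 : ℝ) ≤ (1 + ξ ^ 2) ^ θ := Real.one_le_rpow (by nlinarith [sq_nonneg ξ]) hθ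
  have h4 := h1.trans h3
  rw [mul_assoc]
  gcongr

end Domain

/-! ### Behaviour of colliding peakons up to the collision time -/

theorem contDiffOn_one_of_hasDerivAt {f f' : ℝ → ℝ} {T : ℝ}
    (hf : ∀ t ∈ Set.Ico 0 T, HasDerivAt f (f' t) t) (hc : ContinuousOn f' (Set.Ico 0 T)) :
    ContDiffOn ℝ 1 f (Set.Ico 0 T) := by
  rw [contDiffOn_one_iff_derivWithin (uniqueDiffOn_Ico 0 T)]
  refine ⟨fun t ht => (hf t ht).differentiableAt.differentiableWithinAt, hc.congr fun t ht => ?_⟩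
  exact (hf t ht).hasDerivWithinAt.derivWithin (uniqueDiffOn_Ico 0 T t ht)

namespace Domain

variable {X : Domain}

theorem norm_peaksAmp_le (a b P₁ P₂ ξ : ℝ) : ‖peaksAmp a b P₁ P₂ ξ‖ ≤ |P₁| + |P₂| := by
  refine (norm_add_le _ _).trans (le_of_eq ?_)
  rw [norm_mul, norm_mul, norm_expo, norm_expo, mul_one, mul_one, Complex.norm_real,
    Complex.norm_real, Real.norm_eq_abs, Real.norm_eq_abs]

theorem tendsto_peaksAmp {l : Filter ℝ} {a b P₁ P₂ : ℝ → ℝ} {a₀ b₀ Q₁ Q₂ : ℝ}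
    (ha : Tendsto a l (𝓝 a₀)) (hb : Tendsto b l (𝓝 b₀)) (h₁ : Tendsto P₁ l (𝓝 Q₁))
    (h₂ : Tendsto P₂ l (𝓝 Q₂)) (ξ : ℝ) :
    Tendsto (fun t => peaksAmp (a t) (b t) (P₁ t) (P₂ t) ξ) l (𝓝 (peaksAmp a₀ b₀ Q₁ Q₂ ξ)) := by
  have e := continuous_expo_right ξ
  exact (((Complex.continuous_ofReal.tendsto _).comp h₁).mul ((e.tendsto _).comp ha)).add
    (((Complex.continuous_ofReal.tendsto _).comp h₂).mul ((e.tendsto _).comp hb))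

theorem tendsto_hsNorm_peaks_sub {l : Filter ℝ} [l.IsCountablyGenerated] {a b P₁ P₂ : ℝ → ℝ}
    {a₀ b₀ Q₁ Q₂ : ℝ} (ha : Tendsto a l (𝓝 a₀)) (hb : Tendsto b l (𝓝 b₀))
    (h₁ : Tendsto P₁ l (𝓝 Q₁)) (h₂ : Tendsto P₂ l (𝓝 Q₂)) {σ : ℝ} (hσ : σ < 3 / 2) :
    Tendsto (fun t => X.hsNorm σ (X.peaks (a t) (b t) (P₁ t) (P₂ t) - X.peaks a₀ b₀ Q₁ Q₂)) l
      (𝓝 0) := by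
  have hlt : ∀ᶠ t in l, |P₁ t| + |P₂ t| < |Q₁| + |Q₂| + 1 :=
    (h₁.abs.add h₂.abs).eventually (gt_mem_nhds (lt_add_one _))
  refine tendsto_hsNorm_zero (θ := 0) (K := (|Q₁| + |Q₂| + 1 + (|Q₁| + |Q₂|)) ^ 2)
    (Eventually.of_forall fun t =>
      (X.hasAmplitude_peaks (a t) (b t) (P₁ t) (P₂ t)).sub (X.hasAmplitude_peaks a₀ b₀ Q₁ Q₂))
    (by linarith) (sq_nonneg _) ?_ fun ξ => ?_
  · filter_upwards [hlt] with t ht ξ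
    rw [Real.rpow_zero, mul_one]
    refine pow_le_pow_left₀ (norm_nonneg _) ((norm_sub_le _ _).trans ?_) 2
    exact add_le_add ((norm_peaksAmp_le _ _ _ _ _).trans ht.le) (norm_peaksAmp_le _ _ _ _ _)
  · have := (tendsto_peaksAmp ha hb h₁ h₂ ξ).sub_const (peaksAmp a₀ b₀ Q₁ Q₂ ξ)
    rwa [sub_self] at this

/-- The antipeakon of speed `c` has depth `√c`, and `-W·E` has depth `height·W`; this fixes `c =
(height·W)²`. -/
theorem antipeakon_eq {W : ℝ} (hW : 0 ≤ W) (qT : ℝ) :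
    X.antipeakon ((X.height * W) ^ 2) qT = fun x => -W * X.profile (x - qT) := by
  have ha := X.height_pos
  ext x
  cases X
  · simp only [antipeakon, profile]
    rw [Real.sqrt_sq (by positivity), height, one_mul]
  · simp only [antipeakon, profile]
    rw [Real.sqrt_sq (by positivity), height,
      mul_div_cancel_left₀ _ (Real.cosh_pos Real.pi).ne']

theorem hasAmplitude_antipeakon {W : ℝ} (hW : 0 ≤ W) (qT : ℝ) :
    X.HasAmplitude (X.antipeakon ((X.height * W) ^ 2) qT) (fun ξ => (-W : ℝ) * expo ξ qT) := by
  rw [antipeakon_eq hW]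
  exact (X.hasAmplitude_profile qT).const_mul (-W)

theorem norm_antipeakonAmp (W qT ξ : ℝ) : ‖((-W : ℝ) : ℂ) * expo ξ qT‖ ^ 2 = W ^ 2 := by
  rw [norm_mul, norm_expo, mul_one, Complex.norm_real, Real.norm_eq_abs, sq_abs, neg_sq]

theorem antipeakon_memHs {W : ℝ} (hW : 0 ≤ W) (qT : ℝ) {σ : ℝ} (hσ : σ < 3 / 2) :
    X.MemHs σ (X.antipeakon ((X.height * W) ^ 2) qT) :=
  (hasAmplitude_antipeakon hW qT).memHs hσ (sq_nonneg W) fun ξ => (norm_antipeakonAmp W qT ξ).le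

theorem hsNorm_antipeakon_pos {W : ℝ} (hW : 0 < W) (qT : ℝ) {σ : ℝ} (hσ : σ < 3 / 2) :
    0 < X.hsNorm σ (X.antipeakon ((X.height * W) ^ 2) qT) := by
  have hs := X.slope_pos
  refine lt_of_lt_of_le ?_ ((hasAmplitude_antipeakon hW.le qT).le_hsNorm (R := 2) (m := W ^ 2)
    (by linarith) le_rfl (sq_nonneg _) fun ξ _ => (norm_antipeakonAmp W qT ξ).ge)
  rw [ENNReal.ofReal_pos]
  positivity

theorem eventually_mem_Ico {T : ℝ} (hT : 0 < T) : ∀ᶠ t in 𝓝[<] T, t ∈ Set.Ico 0 T := by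
  filter_upwards [Ioo_mem_nhdsLT hT] with t ht
  exact ⟨ht.1.le, ht.2⟩

theorem twoPeakon_memHs (q₁ q₂ p₁ p₂ : ℝ → ℝ) (t : ℝ) {σ : ℝ} (hσ : σ < 3 / 2) :
    X.MemHs σ (X.twoPeakon q₁ q₂ p₁ p₂ t) :=
  (X.hasAmplitude_peaks (q₁ t) (q₂ t) (p₁ t) (p₂ t)).memHs hσ (sq_nonneg (|p₁ t| + |p₂ t|))
    fun _ => pow_le_pow_left₀ (norm_nonneg _) (norm_peaksAmp_le _ _ _ _ _) 2

namespace IsCollision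

variable {T W qT : ℝ} {q₁ q₂ p₁ p₂ : ℝ → ℝ} (h : X.IsCollision T q₁ q₂ p₁ p₂ W qT)

include h

theorem lt {t : ℝ} (ht : t ∈ Set.Ico 0 T) : 0 < q₂ t - q₁ t := by
  have := h.ordered t ht
  cases X
  · exact sub_pos.2 this
  · exact sub_pos.2 this.1

theorem isTwoPeakonSolution : X.IsTwoPeakonSolution T q₁ q₂ p₁ p₂ := by
  have c1 : ContinuousOn q₁ (Set.Ico 0 T) := fun t ht =>
    (h.hasDerivAt_q₁ t ht).continuousAt.continuousWithinAt
  have c2 : ContinuousOn q₂ (Set.Ico 0 T) := fun t ht =>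
    (h.hasDerivAt_q₂ t ht).continuousAt.continuousWithinAt
  have c3 : ContinuousOn p₁ (Set.Ico 0 T) := fun t ht =>
    (h.hasDerivAt_p₁ t ht).continuousAt.continuousWithinAt
  have c4 : ContinuousOn p₂ (Set.Ico 0 T) := fun t ht =>
    (h.hasDerivAt_p₂ t ht).continuousAt.continuousWithinAt
  have cA : ContinuousOn (fun t => X.profile (q₂ t - q₁ t)) (Set.Ico 0 T) :=
    X.continuous_profile.comp_continuousOn (c2.sub c1)
  have cB : ContinuousOn (fun t => X.dprofile (q₂ t - q₁ t)) (Set.Ico 0 T) := fun t ht =>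
    ContinuousAt.comp_continuousWithinAt (f := fun t => q₂ t - q₁ t)
      (X.hasDerivAt_dprofile (X.not_isPeak_sub (h.ordered t ht))).continuousAt
      ((c2.sub c1) t ht)
  exact
    { contDiffOn_q₁ := contDiffOn_one_of_hasDerivAt h.hasDerivAt_q₁ (by fun_prop)
      contDiffOn_q₂ := contDiffOn_one_of_hasDerivAt h.hasDerivAt_q₂ (by fun_prop)
      contDiffOn_p₁ := contDiffOn_one_of_hasDerivAt h.hasDerivAt_p₁ (by fun_prop)
      contDiffOn_p₂ := contDiffOn_one_of_hasDerivAt h.hasDerivAt_p₂ (by fun_prop)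
      p₁_ne_zero := h.p₁_ne_zero
      p₂_ne_zero := h.p₂_ne_zero
      ordered := h.ordered
      solution := X.isNovikovSolution_twoPeakon h.ordered h.hasDerivAt_q₁ h.hasDerivAt_q₂
        h.hasDerivAt_p₁ h.hasDerivAt_p₂ }

theorem tendsto_dist_pos (hT : 0 < T) : Tendsto (fun t => q₂ t - q₁ t) (𝓝[<] T) (𝓝[>] 0) :=
  tendsto_nhdsWithin_of_tendsto_nhds_of_eventually_within _ h.tendsto_dist <| by
    filter_upwards [eventually_mem_Ico hT] with t ht
    exact h.lt ht

theorem tendsto_slope_gap (hT : 0 < T) :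
    Tendsto (fun t => (X.height - X.profile (q₂ t - q₁ t)) / (q₂ t - q₁ t)) (𝓝[<] T)
      (𝓝 X.slope) := by
  have h0 := X.hasDerivWithinAt_profile 0
  rw [X.dprofile_zero, hasDerivWithinAt_iff_tendsto_slope, Set.Ici_sdiff_left] at h0
  have h1 := (h0.comp (h.tendsto_dist_pos hT)).neg
  rw [neg_neg] at h1
  refine h1.congr fun t => ?_
  simp only [Function.comp, slope_def_field, X.profile_zero, sub_zero]
  rw [← neg_div, neg_sub]

/-- A continuation need only be the same function; its positions and momenta are not compared with
the given ones. Evaluating both forms at the peaks gives `u(q₁) - u(q₂) = z(a - E(q))`. Near `T`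
this is at most a constant times `q`, since the momenta of the continuation stay bounded, and `a -
E(q) ≥ (slope/2)·q`. So `z` is bounded and `z²√q → 0`, against its positive limit. -/
theorem hasLifespan (hT : 0 < T) : X.HasLifespan T q₁ q₂ p₁ p₂ := by
  refine ⟨h.isTwoPeakonSolution, fun T' Q₁ Q₂ P₁ P₂ hTT' hQ => ?_⟩
  by_contra! hne
  have ha := X.height_pos
  have hs := X.slope_pos
  have hnb : Set.Ico 0 T' ∈ 𝓝 T := Ico_mem_nhds hT hTT'
  have hP₁ : Tendsto P₁ (𝓝[<] T) (𝓝 (P₁ T)) :=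
    (hQ.contDiffOn_p₁.continuousOn.continuousAt hnb).mono_left nhdsWithin_le_nhds
  have hP₂ : Tendsto P₂ (𝓝[<] T) (𝓝 (P₂ T)) :=
    (hQ.contDiffOn_p₂.continuousOn.continuousAt hnb).mono_left nhdsWithin_le_nhds
  set M := |P₁ T| + |P₂ T| + 1 with hM
  have hMpos : 0 < M := by positivity
  have hlt : ∀ᶠ t in 𝓝[<] T, |P₁ t| + |P₂ t| < M :=
    (hP₁.abs.add hP₂.abs).eventually (gt_mem_nhds (lt_add_one _))
  have hsl : ∀ᶠ t in 𝓝[<] T,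
      X.slope / 2 < (X.height - X.profile (q₂ t - q₁ t)) / (q₂ t - q₁ t) :=
    (h.tendsto_slope_gap hT).eventually (lt_mem_nhds (half_lt_self hs))
  have hz : ∀ᶠ t in 𝓝[<] T, |p₁ t - p₂ t| ≤ 2 * M * X.height / X.slope := by
    filter_upwards [hlt, hsl, eventually_mem_Ico hT] with t h1 h2 ht
    have hq := h.lt ht
    rw [lt_div_iff₀ hq] at h2
    have e := hne t ht
    have e1 := congrFun e (q₁ t)
    have e2 := congrFun e (q₂ t)
    simp only [twoPeakon, sub_self, X.profile_zero, X.profile_sub_comm (q₁ t) (q₂ t)] at e1 e2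
    have b1 := X.abs_profile_sub_le (q₁ t - Q₁ t) (q₂ t - Q₁ t)
    have b2 := X.abs_profile_sub_le (q₁ t - Q₂ t) (q₂ t - Q₂ t)
    rw [sub_sub_sub_cancel_right, abs_sub_comm (q₁ t), abs_of_pos hq] at b1 b2
    have key : (p₁ t - p₂ t) * (X.height - X.profile (q₂ t - q₁ t))
        = P₁ t * (X.profile (q₁ t - Q₁ t) - X.profile (q₂ t - Q₁ t))
          + P₂ t * (X.profile (q₁ t - Q₂ t) - X.profile (q₂ t - Q₂ t)) := by
      linear_combination e2 - e1
    have hpos : 0 < X.height - X.profile (q₂ t - q₁ t) := lt_trans (by positivity) h2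
    have b3 : |p₁ t - p₂ t| * (X.height - X.profile (q₂ t - q₁ t))
        ≤ M * (X.height * (q₂ t - q₁ t)) := by
      rw [← abs_of_pos hpos, ← abs_mul, key]
      refine (abs_add_le _ _).trans ?_
      rw [abs_mul, abs_mul]
      calc _ ≤ |P₁ t| * (X.height * (q₂ t - q₁ t)) + |P₂ t| * (X.height * (q₂ t - q₁ t)) := by
            gcongr
        _ = (|P₁ t| + |P₂ t|) * (X.height * (q₂ t - q₁ t)) := by ring
        _ ≤ _ := by gcongr
    have b4 : |p₁ t - p₂ t| * (X.slope / 2 * (q₂ t - q₁ t))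
        ≤ |p₁ t - p₂ t| * (X.height - X.profile (q₂ t - q₁ t)) := by gcongr
    rw [le_div_iff₀ hs]
    have b5 : (|p₁ t - p₂ t| * X.slope) * (q₂ t - q₁ t)
        ≤ (2 * M * X.height) * (q₂ t - q₁ t) := by linarith
    exact le_of_mul_le_mul_right b5 hq
  obtain ⟨L, hL, hLt⟩ := h.tendsto_sub
  have h0 : Tendsto (fun t => (2 * M * X.height / X.slope) ^ 2 * √(q₂ t - q₁ t)) (𝓝[<] T) (𝓝 0) := by
    have := (h.tendsto_dist.sqrt).const_mul ((2 * M * X.height / X.slope) ^ 2)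
    rwa [Real.sqrt_zero, mul_zero] at this
  refine absurd (le_of_tendsto_of_tendsto hLt h0 ?_) (not_le.2 hL)
  filter_upwards [hz] with t ht
  have : (p₁ t - p₂ t) ^ 2 ≤ (2 * M * X.height / X.slope) ^ 2 := by
    rw [← sq_abs]
    exact pow_le_pow_left₀ (abs_nonneg _) ht 2
  gcongr

theorem tendsto_twoPeakon {σ t₀ : ℝ} (hσ : σ < 3 / 2) (ht₀ : t₀ ∈ Set.Ico 0 T) :
    Tendsto (fun t => X.hsNorm σ (X.twoPeakon q₁ q₂ p₁ p₂ t - X.twoPeakon q₁ q₂ p₁ p₂ t₀))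
      (𝓝 t₀) (𝓝 0) :=
  tendsto_hsNorm_peaks_sub (h.hasDerivAt_q₁ t₀ ht₀).continuousAt
    (h.hasDerivAt_q₂ t₀ ht₀).continuousAt (h.hasDerivAt_p₁ t₀ ht₀).continuousAt
    (h.hasDerivAt_p₂ t₀ ht₀).continuousAt hσ

theorem continuousInHs {σ : ℝ} (hσ : σ < 3 / 2) :
    X.ContinuousInHs σ (Set.Ico 0 T) (X.twoPeakon q₁ q₂ p₁ p₂) :=
  ⟨fun t _ => twoPeakon_memHs q₁ q₂ p₁ p₂ t hσ, fun _ ht₀ =>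
    (h.tendsto_twoPeakon hσ ht₀).mono_left nhdsWithin_le_nhds⟩

/-- Norm inflation. -/
theorem tendsto_hsNorm_top (hT : 0 < T) {σ : ℝ} (hσ : 5 / 4 < σ) (hσ' : σ < 3 / 2) :
    Tendsto (fun t => X.hsNorm σ (X.twoPeakon q₁ q₂ p₁ p₂ t)) (𝓝[<] T) (𝓝 ⊤) := by
  have hs := X.slope_pos
  obtain ⟨L, hL, hLt⟩ := h.tendsto_sub
  have hR : Tendsto (fun t => (q₂ t - q₁ t)⁻¹) (𝓝[<] T) atTop :=
    tendsto_inv_nhdsGT_zero.comp (h.tendsto_dist_pos hT)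
  -- At frequencies about `R = 1/q` the weight contributes `R^(2σ-4)`, the length of the band `R`,
  -- and `z²` a multiple of `R^(1/2)`. The total exponent `2σ - 5/2` is positive exactly for `σ >
  -- 5/4`.
  have hpow := (tendsto_rpow_atTop (y := 2 * σ - 5 / 2) (by linarith)).comp hR
  -- The factor `5^(σ-2)` comes from `1 + (2R)² ≤ 5R²`, and `32 = 16·2` from `sin² ≥ 1/16` and the
  -- mass `R/2` of the band.
  have hgrow := (hpow.atTop_mul_pos hL hLt).const_mul_atTop
    (show 0 < 4 * X.slope ^ 2 * (5 : ℝ) ^ (σ - 2) / 32 by positivity)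
  have htop := ENNReal.tendsto_ofReal_atTop.comp (Real.tendsto_sqrt_atTop.comp hgrow)
  refine tendsto_nhds_top_mono htop ?_
  filter_upwards [hR.eventually_ge_atTop 2, eventually_mem_Ico hT] with t hR2 ht
  have hq := h.lt ht
  set R := (q₂ t - q₁ t)⁻¹ with hRdef
  have hRpos : 0 < R := inv_pos.2 hq
  have hqR : q₂ t - q₁ t = R⁻¹ := by rw [hRdef, inv_inv]
  refine le_trans ?_ ((X.hasAmplitude_peaks (q₁ t) (q₂ t) (p₁ t) (p₂ t)).le_hsNorm (σ := σ)
    (R := R) (m := (p₁ t - p₂ t) ^ 2 / 16) (by linarith) hR2 (by positivity) fun ξ hξ => ?_)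
  · refine ENNReal.ofReal_le_ofReal (Real.sqrt_le_sqrt ?_)
    have h5 : (5 * R ^ 2) ^ (σ - 2) ≤ (1 + (2 * R) ^ 2) ^ (σ - 2) :=
      Real.rpow_le_rpow_of_nonpos (by positivity) (by nlinarith) (by linarith)
    have h6 : (5 * R ^ 2) ^ (σ - 2) = 5 ^ (σ - 2) * R ^ (2 * σ - 4) := by
      rw [Real.mul_rpow (by norm_num) (by positivity), ← Real.rpow_natCast R 2,
        ← Real.rpow_mul hRpos.le]
      congr 2
      push_cast
      ring
    have h7 : √(q₂ t - q₁ t) = R ^ (-(1 / 2) : ℝ) := by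
      rw [hqR, Real.sqrt_eq_rpow, Real.inv_rpow hRpos.le, Real.rpow_neg hRpos.le]
    have h8 : R ^ (2 * σ - 5 / 2) * R ^ (-(1 / 2) : ℝ) = R ^ (2 * σ - 4) * R := by
      rw [← Real.rpow_add hRpos]
      conv_rhs => rw [← Real.rpow_one R, ← Real.rpow_mul hRpos.le, ← Real.rpow_add hRpos]
      congr 1
      ring
    simp only [Function.comp]
    calc _ = 4 * X.slope ^ 2 * 5 ^ (σ - 2) / 32 * (p₁ t - p₂ t) ^ 2
          * (R ^ (2 * σ - 5 / 2) * R ^ (-(1 / 2) : ℝ)) := by rw [h7]; ring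
      _ = 4 * X.slope ^ 2 * (5 * R ^ 2) ^ (σ - 2) * ((p₁ t - p₂ t) ^ 2 / 16) * (R / 2) := by
        rw [h8, h6]; ring
      _ ≤ _ := by gcongr
  -- For `ξ` in `[R, 2R]` the angle `ξq/2` lies in `[1/2, 1]`; Jordan's inequality gives a sine of
  -- at least `1/4`.
  · rw [norm_peaksAmp_sq, hqR, ← div_eq_mul_inv, div_div, mul_comm R, ← div_div]
    have h1 : 1 / 2 ≤ ξ / 2 / R := by
      rw [le_div_iff₀ hRpos]; linarith [hξ.1]
    have h2 : ξ / 2 / R ≤ 1 := by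
      rw [div_le_one hRpos]; linarith [hξ.2]
    have h3 := Real.mul_le_sin (x := ξ / 2 / R) (by linarith) (by linarith [Real.pi_gt_three])
    have h4 : 1 / 2 ≤ 2 / Real.pi := by
      rw [le_div_iff₀ Real.pi_pos]; linarith [Real.pi_le_four]
    have h5 : 1 / 4 ≤ Real.sin (ξ / 2 / R) := by nlinarith
    have h6 : 1 / 16 ≤ Real.sin (ξ / 2 / R) ^ 2 := by nlinarith
    have h7 : (p₁ t - p₂ t) ^ 2 / 16 ≤ (p₁ t - p₂ t) ^ 2 * Real.sin (ξ / 2 / R) ^ 2 := by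
      rw [div_eq_mul_one_div]; gcongr
    have : 0 ≤ (p₁ t + p₂ t) ^ 2 * Real.cos (ξ / 2 / R) ^ 2 := by positivity
    linarith

/-- Convergence to an antipeakon. -/
theorem tendsto_hsNorm_sub_antipeakon (hT : 0 < T) (hW : 0 ≤ W) {σ : ℝ} (hσ : σ < 5 / 4) :
    Tendsto (fun t => X.hsNorm σ (X.twoPeakon q₁ q₂ p₁ p₂ t
      - X.antipeakon ((X.height * W) ^ 2) qT)) (𝓝[<] T) (𝓝 0) := by
  -- `θ > 1/4` makes `z² q^(2θ)` tend to zero, and `θ < 3/2 - σ` keeps the dominating weight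
  -- integrable. The two are compatible exactly when `σ < 5/4`.
  obtain ⟨θ, hθ, hθ'⟩ := exists_between (show 1 / 4 < min 1 (3 / 2 - σ) by
    rw [lt_min_iff]; constructor <;> linarith)
  rw [lt_min_iff] at hθ'
  obtain ⟨L, hL, hLt⟩ := h.tendsto_sub
  have hz : Tendsto (fun t => (p₁ t - p₂ t) ^ 2 * (q₂ t - q₁ t) ^ (2 * θ)) (𝓝[<] T) (𝓝 0) := by
    have h1 : Tendsto (fun t => (q₂ t - q₁ t) ^ (2 * θ - 1 / 2)) (𝓝[<] T) (𝓝 0) := by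
      have := h.tendsto_dist.rpow_const (p := 2 * θ - 1 / 2) (Or.inr (by linarith))
      rwa [Real.zero_rpow (by linarith)] at this
    have h2 := hLt.mul h1
    rw [mul_zero] at h2
    refine h2.congr' ?_
    filter_upwards [eventually_mem_Ico hT] with t ht
    rw [mul_assoc, Real.sqrt_eq_rpow, ← Real.rpow_add (h.lt ht)]
    congr 2
    ring
  have hq₂ : Tendsto q₂ (𝓝[<] T) (𝓝 qT) := by
    have := h.tendsto_q₁.add h.tendsto_dist
    rw [add_zero] at this
    exact this.congr fun t => by ring
  -- The amplitude splits into a symmetric pair with bounded momenta `w/2`, which merges into the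
  -- antipeakon, and a dipole with momenta `±z/2`.
  have split : ∀ t ξ, peaksAmp (q₁ t) (q₂ t) (p₁ t) (p₂ t) ξ - ((-W : ℝ) : ℂ) * expo ξ qT
      = (peaksAmp (q₁ t) (q₂ t) ((p₁ t + p₂ t) / 2) ((p₁ t + p₂ t) / 2) ξ
          - ((-W : ℝ) : ℂ) * expo ξ qT)
        + peaksAmp (q₁ t) (q₂ t) ((p₁ t - p₂ t) / 2) (-((p₁ t - p₂ t) / 2)) ξ := by
    intro t ξ
    simp only [peaksAmp]
    push_cast
    ring
  have hsecond : ∀ t ∈ Set.Ico 0 T, ∀ ξ,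
      ‖peaksAmp (q₁ t) (q₂ t) ((p₁ t - p₂ t) / 2) (-((p₁ t - p₂ t) / 2)) ξ‖ ^ 2
        ≤ (p₁ t - p₂ t) ^ 2 * (q₂ t - q₁ t) ^ (2 * θ) * (1 + ξ ^ 2) ^ θ := by
    intro t ht ξ
    refine (norm_peaksAmp_sq_le (sub_pos.1 (h.lt ht)).le (by linarith) hθ'.1.le).trans
      (le_of_eq ?_)
    ring
  have hW1 : ∀ᶠ t in 𝓝[<] T, |p₁ t + p₂ t| < |(-W)| + 1 :=
    h.tendsto_add.abs.eventually (gt_mem_nhds (lt_add_one _))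
  -- In `K`, the factor `2` is from `(x + y)² ≤ 2(x² + y²)`; `2W + 1` bounds the symmetric part near
  -- `T`, where `|w| < W + 1`, and `1` bounds the dipole.
  refine tendsto_hsNorm_zero (θ := θ) (K := 2 * ((2 * W + 1) ^ 2 + 1))
    (Eventually.of_forall fun t => (X.hasAmplitude_peaks (q₁ t) (q₂ t) (p₁ t) (p₂ t)).sub
      (hasAmplitude_antipeakon hW qT)) (by linarith) (by positivity) ?_ fun ξ => ?_
  · filter_upwards [eventually_mem_Ico hT, hW1, hz.eventually (gt_mem_nhds one_pos)]
      with t ht h1 h2 ξ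
    rw [split]
    have a1 : ‖peaksAmp (q₁ t) (q₂ t) ((p₁ t + p₂ t) / 2) ((p₁ t + p₂ t) / 2) ξ
          - ((-W : ℝ) : ℂ) * expo ξ qT‖ ^ 2 ≤ (2 * W + 1) ^ 2 := by
      refine pow_le_pow_left₀ (norm_nonneg _) ((norm_sub_le _ _).trans ?_) 2
      have := norm_peaksAmp_le (q₁ t) (q₂ t) ((p₁ t + p₂ t) / 2) ((p₁ t + p₂ t) / 2) ξ
      rw [norm_mul, norm_expo, mul_one, Complex.norm_real, Real.norm_eq_abs]
      rw [abs_div, abs_of_pos (two_pos : (0 : ℝ) < 2)] at this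
      rw [abs_neg, abs_of_nonneg hW] at h1 ⊢
      linarith
    have a2 := hsecond t ht ξ
    have hθ1 : (1 : ℝ) ≤ (1 + ξ ^ 2) ^ θ :=
      Real.one_le_rpow (by nlinarith [sq_nonneg ξ]) (by linarith)
    have a3 : (p₁ t - p₂ t) ^ 2 * (q₂ t - q₁ t) ^ (2 * θ) * (1 + ξ ^ 2) ^ θ
        ≤ 1 * (1 + ξ ^ 2) ^ θ := by gcongr
    have a4 : (2 * W + 1) ^ 2 ≤ (2 * W + 1) ^ 2 * (1 + ξ ^ 2) ^ θ :=
      le_mul_of_one_le_right (by positivity) hθ1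
    refine (pow_le_pow_left₀ (norm_nonneg _) (norm_add_le _ _) 2).trans ?_
    refine add_sq_le.trans ?_
    rw [mul_assoc, add_mul]
    linarith
  · simp_rw [split]
    rw [← add_zero (0 : ℂ)]
    refine Tendsto.add ?_ ?_
    · have hw := h.tendsto_add.div_const 2
      have := (tendsto_peaksAmp h.tendsto_q₁ hq₂ hw hw ξ).sub_const (((-W : ℝ) : ℂ) * expo ξ qT)
      have e : peaksAmp qT qT (-W / 2) (-W / 2) ξ - ((-W : ℝ) : ℂ) * expo ξ qT = 0 := by
        simp only [peaksAmp]
        push_cast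
        ring
      rwa [e] at this
    · rw [tendsto_zero_iff_norm_tendsto_zero]
      have h0 := (hz.mul_const ((1 + ξ ^ 2) ^ θ)).sqrt
      rw [zero_mul, Real.sqrt_zero] at h0
      refine squeeze_zero' (Eventually.of_forall fun t => norm_nonneg _) ?_ h0
      filter_upwards [eventually_mem_Ico hT] with t ht
      exact Real.le_sqrt_of_sq_le (hsecond t ht ξ)

theorem tendsto_hsNorm (hT : 0 < T) (hW : 0 ≤ W) {σ : ℝ} (hσ : σ < 5 / 4) :
    Tendsto (fun t => X.hsNorm σ (X.twoPeakon q₁ q₂ p₁ p₂ t)) (𝓝[<] T)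
      (𝓝 (X.hsNorm σ (X.antipeakon ((X.height * W) ^ 2) qT))) := by
  have hd := h.tendsto_hsNorm_sub_antipeakon hT hW hσ
  have hfin := (antipeakon_memHs (X := X) hW qT (show σ < 3 / 2 by linarith)).2.2.ne
  have tri := fun t => (X.hasAmplitude_peaks (q₁ t) (q₂ t) (p₁ t) (p₂ t)).hsNorm_le_add
    (hasAmplitude_antipeakon hW qT) σ
  have lo := ENNReal.Tendsto.sub (tendsto_const_nhds (x := X.hsNorm σ
    (X.antipeakon ((X.height * W) ^ 2) qT)) (f := 𝓝[<] T)) hd (Or.inl hfin)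
  have hi := hd.add (tendsto_const_nhds (x := X.hsNorm σ
    (X.antipeakon ((X.height * W) ^ 2) qT)) (f := 𝓝[<] T))
  rw [tsub_zero] at lo
  rw [zero_add] at hi
  exact tendsto_of_tendsto_of_tendsto_of_le_of_le lo hi
    (fun t => tsub_le_iff_left.2 (tri t).2) (fun t => (tri t).1)

theorem continuousInHs_extended (hT : 0 < T) (hW : 0 ≤ W) {σ : ℝ} (hσ : σ < 5 / 4) :
    X.ContinuousInHs σ (Set.Icc 0 T) (fun t => if t < T then X.twoPeakon q₁ q₂ p₁ p₂ t
      else X.antipeakon ((X.height * W) ^ 2) qT) := by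
  have hσ' : σ < 3 / 2 := by linarith
  refine ⟨fun t _ => ?_, fun t₀ ht₀ => ?_⟩
  · simp only
    split_ifs
    · exact twoPeakon_memHs q₁ q₂ p₁ p₂ t hσ'
    · exact antipeakon_memHs hW qT hσ'
  · rcases lt_or_eq_of_le ht₀.2 with hlt | rfl
    · simp only [if_pos hlt]
      refine ((h.tendsto_twoPeakon hσ' ⟨ht₀.1, hlt⟩).mono_left nhdsWithin_le_nhds).congr' ?_
      filter_upwards [mem_nhdsWithin_of_mem_nhds (Iio_mem_nhds hlt)] with t ht
      rw [if_pos (Set.mem_Iio.1 ht)]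
    · simp only [lt_irrefl, if_false]
      -- At the collision time itself, the approach from the left and the constant value at the
      -- point are treated separately.
      have hle : 𝓝[Set.Icc 0 t₀] t₀ ≤ 𝓝[<] t₀ ⊔ pure t₀ := by
        rw [← nhdsWithin_singleton, ← nhdsWithin_union, Set.union_comm, Set.singleton_union,
          Set.Iio_insert]
        exact nhdsWithin_mono _ fun x hx => hx.2
      refine Tendsto.mono_left ?_ hle
      rw [tendsto_sup]
      constructor
      · refine (h.tendsto_hsNorm_sub_antipeakon hT hW hσ).congr' ?_
        filter_upwards [self_mem_nhdsWithin] with t ht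
        rw [if_pos (Set.mem_Iio.1 ht)]
      · rw [tendsto_pure_left]
        intro s hs
        simp only [lt_irrefl, if_false, sub_self]
        have e : X.hsNorm σ 0 = 0 := by
          rw [hsNorm_eq_lintegral]
          simp [fourier]
        rw [e]
        exact mem_of_mem_nhds hs

end IsCollision

/-! ### Choice of the parameters -/

variable (X) in
/-- There are colliding peakons with small lifespan and small initial size. -/
theorem exists_small_isCollision {s : ℝ} (hs : s < 3 / 2) {ε : ℝ} (hε : 0 < ε) :
    ∃ (T : ℝ) (q₁ q₂ p₁ p₂ : ℝ → ℝ) (W qT : ℝ), 0 < T ∧ T < ε ∧ 0 < W ∧ 0 < qT ∧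
      X.IsCollision T q₁ q₂ p₁ p₂ W qT ∧
      X.hsNorm s (X.twoPeakon q₁ q₂ p₁ p₂ 0) < ENNReal.ofReal ε := by
  have ha := X.height_pos
  have hsl := X.slope_pos
  -- Any positive `θ` below `3/2 - s` will do: at time `0` the gap can be shrunk with `z` fixed.
  obtain ⟨θ, hθ, hθ'⟩ := exists_between (show 0 < min 1 (3 / 2 - s) by
    rw [lt_min_iff]; constructor <;> linarith)
  rw [lt_min_iff] at hθ'
  set I := X.weightIntegral (s - 2 + θ) with hI
  have hI0 : 0 ≤ I := weightIntegral_nonneg _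
  have hD : 0 < 4 * X.slope ^ 2 * (I + 1) := by positivity
  -- The squared initial norm is at most `4·slope²·I` times `w² + z² q^(2θ)`, so a sum below `δ`
  -- suffices; `I + 1` replaces `I` to keep the denominator positive.
  set δ := ε ^ 2 / (4 * X.slope ^ 2 * (I + 1)) with hδ
  have hδ0 : 0 < δ := by positivity
  -- Then `w² ≤ H/height = δ/2`, one half of the budget.
  set H := X.height * (δ / 2) with hH
  have hH0 : 0 < H := by positivity
  have hsqH := Real.sqrt_pos.2 hH0
  -- Chosen so that the bound on the collision time equals `ε/2`.
  set η₀ := ε / 2 * (X.slope / 4 * √H) with hη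
  have hη0 : 0 < η₀ := by positivity
  have hG : Continuous fun r : ℝ => X.height * ((1 - r ^ 2) / (1 + r ^ 2)) := by
    refine continuous_const.mul (Continuous.div (by fun_prop) (by fun_prop) fun x => ?_)
    positivity
  have hGe : ∀ k η, X.gapValue k η = (fun r : ℝ => X.height * ((1 - r ^ 2) / (1 + r ^ 2)))
    (k * η ^ 2) := fun k η => rfl
  set G := fun r : ℝ => X.height * ((1 - r ^ 2) / (1 + r ^ 2)) with hGdef
  have hG0 : G 0 = X.height := by simp [hGdef]
  have ev1 : ∀ᶠ r in 𝓝 (0 : ℝ), X.discr < G r :=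
    (hG.tendsto 0).eventually (lt_mem_nhds (by rw [hG0]; exact X.discr_lt_height))
  have ev2 : ∀ᶠ r in 𝓝 (0 : ℝ), X.slope / 2 < √(G r ^ 2 - X.discr) := by
    have hc : Continuous fun r => √(G r ^ 2 - X.discr) := by fun_prop
    refine (hc.tendsto 0).eventually (lt_mem_nhds ?_)
    rw [hG0, X.sqrt_height_sq]
    exact half_lt_self hsl
  obtain ⟨ρ, hρ, hball⟩ := Metric.eventually_nhds_iff.1 (ev1.and ev2)
  have ek1 : ∀ᶠ k in 𝓝 (0 : ℝ), k * η₀ ^ 2 < ρ := by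
    have hc : Continuous fun k : ℝ => k * η₀ ^ 2 := by fun_prop
    exact (hc.tendsto 0).eventually (gt_mem_nhds (by simpa using hρ))
  have ek2 : ∀ᶠ k in 𝓝 (0 : ℝ), 2 * k ^ 2 * η₀ ^ 2 < H / 2 := by
    have hc : Continuous fun k : ℝ => 2 * k ^ 2 * η₀ ^ 2 := by fun_prop
    exact (hc.tendsto 0).eventually (gt_mem_nhds (by simpa using hH0))
  -- The initial `z` depends on `H` and `η₀` only, whereas the initial gap tends to zero with `k`. A
  -- small `k` therefore brings the second half of the budget below `δ/2`.
  have ek3 : ∀ᶠ k in 𝓝 (0 : ℝ),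
      X.diffMomenta H η₀ ^ 2 * X.invProfile (X.gapValue k η₀) ^ (2 * θ) < δ / 2 := by
    have h1 : Tendsto (fun k : ℝ => X.gapValue k η₀) (𝓝 0) (𝓝 X.height) := by
      have hc : Continuous fun k : ℝ => G (k * η₀ ^ 2) := by fun_prop
      have := hc.tendsto 0
      rwa [zero_mul, hG0] at this
    have h2 := (X.hasDerivAt_invProfile X.discr_lt_height).continuousAt.tendsto.comp h1
    rw [X.invProfile_height] at h2
    have h3 := (h2.rpow_const (p := 2 * θ) (Or.inr (by linarith))).const_mul
      (X.diffMomenta H η₀ ^ 2)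
    rw [Real.zero_rpow (by linarith), mul_zero] at h3
    exact h3.eventually (gt_mem_nhds (half_pos hδ0))
  obtain ⟨k, ⟨⟨hk1, hk2⟩, hk3⟩, hk⟩ := (((ek1.and ek2).and ek3).filter_mono
    (nhdsWithin_le_nhds (s := Set.Ioi 0)) |>.and self_mem_nhdsWithin).exists
  have hk : 0 < k := hk
  have hr : ∀ η ∈ Set.Icc 0 η₀, X.discr < X.gapValue k η ∧
      X.slope / 2 < √(X.gapValue k η ^ 2 - X.discr) := by
    intro η hη
    rw [hGe]
    refine hball ?_
    have hη2 : η ^ 2 ≤ η₀ ^ 2 := pow_le_pow_left₀ hη.1 hη.2 2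
    rw [Real.dist_eq, sub_zero, abs_of_nonneg (by positivity)]
    exact (mul_le_mul_of_nonneg_left hη2 hk.le).trans_lt hk1
  obtain ⟨T, q₁, q₂, p₁, p₂, qT, hT, hTle, hqT, hcol, hw, hz, hq⟩ :=
    X.exists_isCollision hH0 hk hη0 (fun η hη => (hr η hη).1) (fun η hη => (hr η hη).2.le)
      (fun η hη => by
        have hη2 : η ^ 2 ≤ η₀ ^ 2 := pow_le_pow_left₀ hη.1 hη.2 2
        have : 2 * k ^ 2 * η ^ 2 ≤ 2 * k ^ 2 * η₀ ^ 2 := by gcongr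
        linarith)
  refine ⟨T, q₁, q₂, p₁, p₂, √(H / X.height), qT, hT, ?_, by positivity, hqT, hcol, ?_⟩
  · refine hTle.trans_lt ?_
    rw [hη, mul_div_assoc, div_self (by positivity), mul_one]
    exact half_lt_self hε
  · have h0 := hcol.lt (t := 0) ⟨le_rfl, hT⟩
    have hb := (X.hasAmplitude_peaks (q₁ 0) (q₂ 0) (p₁ 0) (p₂ 0)).hsNorm_le (σ := s) (θ := θ)
      (by linarith) (by positivity)
      (fun ξ => norm_peaksAmp_sq_le (sub_pos.1 h0).le hθ.le hθ'.1.le)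
    refine hb.trans_lt ?_
    rw [ENNReal.ofReal_lt_ofReal_iff hε, Real.sqrt_lt' hε, hz, hq]
    have hHa : H / X.height = δ / 2 := by rw [hH]; field_simp
    rw [hHa] at hw
    have hsum : (p₁ 0 + p₂ 0) ^ 2
        + X.diffMomenta H η₀ ^ 2 * X.invProfile (X.gapValue k η₀) ^ (2 * θ) < δ := by linarith
    calc _ ≤ 4 * X.slope ^ 2 * δ * I := by gcongr
      _ < 4 * X.slope ^ 2 * δ * (I + 1) := by
        have : 0 < 4 * X.slope ^ 2 * δ := by positivity
        nlinarith
      _ = ε ^ 2 := by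
        rw [hδ]
        field_simp

end Domain

end Novikov
end

theorem mainTheorem1 (X : Novikov.Domain) (s : ℝ) (hs : s < 3 / 2) (ε : ℝ) (hε : 0 < ε) :
    ∃ (T : ℝ) (q₁ q₂ p₁ p₂ : ℝ → ℝ) (u : ℝ → ℝ → ℝ),
      u = X.twoPeakon q₁ q₂ p₁ p₂ ∧
      -- a 2-peakon solution whose lifespan is positive and small and ends with a collision
      0 < T ∧ T < ε ∧
      X.HasLifespan T q₁ q₂ p₁ p₂ ∧
      Tendsto (fun t => q₂ t - q₁ t) (𝓝[<] T) (𝓝 0) ∧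
      (∀ σ : ℝ, σ < 3 / 2 → X.ContinuousInHs σ (Set.Ico 0 T) u) ∧
      -- small initial size
      X.hsNorm s (u 0) < ENNReal.ofReal ε ∧
      -- norm inflation
      (∀ σ : ℝ, 5 / 4 < σ → σ < 3 / 2 →
        Tendsto (fun t => X.hsNorm σ (u t)) (𝓝[<] T) (𝓝 ⊤)) ∧
      -- convergence to an antipeakon
      ∃ c qT : ℝ, 0 < c ∧ 0 < qT ∧ ∀ σ : ℝ, σ < 5 / 4 →
        (∃ C : ℝ, 0 < C ∧
          Tendsto (fun t => X.hsNorm σ (u t)) (𝓝[<] T) (𝓝 (ENNReal.ofReal C)) ∧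
          X.hsNorm σ (X.antipeakon c qT) = ENNReal.ofReal C) ∧
        Tendsto (fun t => X.hsNorm σ (u t - X.antipeakon c qT)) (𝓝[<] T) (𝓝 0) ∧
        X.ContinuousInHs σ (Set.Icc 0 T) (fun t => if t < T then u t else X.antipeakon c qT) := by
  obtain ⟨T, q₁, q₂, p₁, p₂, W, qT, hT, hTε, hW, hqT, h, hsmall⟩ :=
    X.exists_small_isCollision hs hε
  have ha := X.height_pos
  refine ⟨T, q₁, q₂, p₁, p₂, _, rfl, hT, hTε, h.hasLifespan hT, h.tendsto_dist,
    fun σ hσ => h.continuousInHs hσ, hsmall, fun σ hσ hσ' => h.tendsto_hsNorm_top hT hσ hσ',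
    (X.height * W) ^ 2, qT, by positivity, hqT, fun σ hσ => ⟨?_, ?_, ?_⟩⟩
  · have hσ' : σ < 3 / 2 := by linarith
    have hfin := (Novikov.Domain.antipeakon_memHs (X := X) hW.le qT hσ').2.2.ne
    have hpos := Novikov.Domain.hsNorm_antipeakon_pos (X := X) hW qT hσ'
    refine ⟨_, ENNReal.toReal_pos hpos.ne' hfin, ?_, (ENNReal.ofReal_toReal hfin).symm⟩
    rw [ENNReal.ofReal_toReal hfin]
    exact h.tendsto_hsNorm hT hW.le hσ
  · exact h.tendsto_hsNorm_sub_antipeakon hT hW.le hσ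
  · exact h.continuousInHs_extended hT hW.le hσ
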